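/- All hypergraphs $H=(V(H),E(H))$ are finite, with $E(H)\subseteq 2^{V(H)}$ and with vertices named by natural numbers; $I_v$ denotes the set of edges of $H$ containing $v$. A hypergraph $M$ is a *hypergraph dilution* of $H$ if it is isomorphic to a hypergraph reached from $H$ by a finite sequence of the following operations: (1) deleting a vertex (from the vertex set and from all edges); (2) deleting an edge that is a proper subset of another edge; (3) *merging* on a vertex $v$: replacing all edges in $I_v$ by the single new edge $(\bigcup I_v)\setminus\{v\}$ and removing $v$. A conjunctive query (CQ) $q$ is a finite conjunction of relational atoms $R(x_1,\dots,x_n)$ over variables (self-joins and repeated variables are allowed), and a database $D$ is a finite set of ground atoms. A solution of $q$ for $D$ is an assignment of constants to the variables of $q$ under which every atom of $q$ becomes an element of $D$; $q(D)$ is the set of solutions. The hypergraph of $q$ has the variables of $q$ as vertices and one edge $\{x_1,\dots,x_n\}$ for each atom $R(x_1,\dots,x_n)$, and no other edges. For a class $\mathcal{C}$ of hypergraphs, $\text{p-CQ}(\mathcal{C})$ is the following parameterised problem. Instances: pairs $(q,D)$ of a CQ $q$ whose hypergraph belongs to $\mathcal{C}$ and a database $D$. Question: is $q(D)\neq\emptyset$?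 Parameter: the hypergraph of $q$ (up to isomorphism, coded as a natural number). A parameterised problem $P$ with parameter $\kappa$ is *fpt-reducible* to a parameterised problem $P'$ with parameter $\kappa'$ if there are a map $R$ from the instances of $P$ to the instances of $P'$, a polynomial $p$ and computable functions $f,g$ such that for every instance $x$ of $P$: (a) $x$ is a yes-instance of $P$ if and only if $R(x)$ is a yes-instance of $P'$; (b) $R(x)$ is computed from $x$ by a (multi-stack) Turing machine, the same for all $x$, in at most $f(\kappa(x))\cdot p(|x|)$ steps; (c) $\kappa'(R(x))\le g(\kappa(x))$. Here membership in the set of instances of $P$ need not be decidable; accordingly, $f$ and $g$ are partial computable functions that are defined at least on all parameters $\kappa(x)$ of instances $x$ of $P$. **Theorem.** Let $\mathcal{H}$ be a recursively enumerable class of hypergraphs, and let $\mathcal{M}$ be any class of hypergraphs each of whose members is a hypergraph dilution of some member of $\mathcal{H}$ without isolated vertices (that is, one in which every vertex lies in some edge). Then $\text{p-CQ}(\mathcal{M})$ is fpt-reducible to $\text{p-CQ}(\mathcal{H})$. -/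

import Mathlib

open Computability

/-! ### Hypergraphs and dilutions -/

namespace Hypergraph

variable {α : Type*}

/-- `H.incident v` is the set `I_v` of the edges of `H` that contain `v`. -/
def incident (H : Hypergraph α) (v : α) : Set (Set α) := {e ∈ H.edgeSet | v ∈ e}

/-- Isomorphism of hypergraphs: an injective renaming of the vertices of `H` turns `H` into `H'`. -/
def Iso (H H' : Hypergraph α) : Prop :=
  ∃ φ : α → α, Set.InjOn φ H.vertexSet ∧ H.image φ = H'

/-- Deletion of the vertex `v` from the vertex set and from all edges. -/
def deleteVertex (H : Hypergraph α) (v : α) : Hypergraph α where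
  vertexSet := H.vertexSet \ {v}
  edgeSet := (fun e => e \ {v}) '' H.edgeSet
  subset_vertexSet_of_mem_edgeSet' := by
    rintro _ ⟨e, he, rfl⟩
    exact Set.sdiff_subset_sdiff_left (H.subset_vertexSet_of_mem_edgeSet' he)

/-- Deletion of the edge `f`. -/
def deleteEdge (H : Hypergraph α) (f : Set α) : Hypergraph α where
  vertexSet := H.vertexSet
  edgeSet := H.edgeSet \ {f}
  subset_vertexSet_of_mem_edgeSet' := fun _ he => H.subset_vertexSet_of_mem_edgeSet' he.1

/-- Merging on `v`: all edges incident to `v` are replaced by the single new edge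
`(⋃ I_v) \ {v}`. The vertex `v`, which is in no edge any more, is removed. -/
def merge (H : Hypergraph α) (v : α) : Hypergraph α where
  vertexSet := H.vertexSet \ {v}
  edgeSet := insert (⋃₀ H.incident v \ {v}) (H.edgeSet \ H.incident v)
  subset_vertexSet_of_mem_edgeSet' := by
    intro e he
    rcases he with rfl | ⟨h1, h2⟩
    · exact Set.sdiff_subset_sdiff_left
        (Set.sUnion_subset fun e' he' => H.subset_vertexSet_of_mem_edgeSet' he'.1)
    · refine fun x hx => ⟨H.subset_vertexSet_of_mem_edgeSet' h1 hx, ?_⟩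
      rintro rfl
      exact h2 ⟨h1, hx⟩

/-- `DilutionStep H H'`: the hypergraph `H'` is obtained from `H` by one dilution operation. -/
inductive DilutionStep : Hypergraph α → Hypergraph α → Prop
  | deleteVertex (H : Hypergraph α) (v : α) (hv : v ∈ H.vertexSet) :
      DilutionStep H (H.deleteVertex v)
  | deleteEdge (H : Hypergraph α) (f e : Set α) (hf : f ∈ H.edgeSet) (he : e ∈ H.edgeSet)
      (hfe : f ⊂ e) : DilutionStep H (H.deleteEdge f)
  | merge (H : Hypergraph α) (v : α) (hv : v ∈ H.vertexSet) : DilutionStep H (H.merge v)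

/-- `IsDilutionOf M H`: the hypergraph `M` is a hypergraph dilution of `H`, that is, `M` is
isomorphic to a hypergraph that is reached from `H` by finitely many dilution operations. -/
def IsDilutionOf (M H : Hypergraph α) : Prop :=
  ∃ H', Relation.ReflTransGen DilutionStep H H' ∧ Iso M H'

/-- The finite hypergraph that is written as a list of vertices and a list of edges, each edge being
a list of vertices; order and repetitions in the lists do not matter. -/
def IsPresentedBy (H : Hypergraph α) (c : List α × List (List α)) : Prop :=
  H.vertexSet = {v | v ∈ c.1} ∧ H.edgeSet = {e | ∃ l ∈ c.2, e = {v | v ∈ l}}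

/-- A class of hypergraphs (whose vertices are named by natural numbers) is recursively enumerable
if all its members are finite and the set of the presentations of its members is recursively
enumerable. -/
def RecursivelyEnumerable (C : Set (Hypergraph ℕ)) : Prop :=
  (∀ H ∈ C, ∃ c, H.IsPresentedBy c) ∧
    REPred (fun c : List ℕ × List (List ℕ) => ∃ H ∈ C, H.IsPresentedBy c)

/-- The isomorphism type of a finite hypergraph `H` as a natural number: the least Gödel number of a
presentation of a hypergraph isomorphic to `H`. -/
noncomputable def isoCode (H : Hypergraph ℕ) : ℕ :=
  sInf {n | ∃ (H' : Hypergraph ℕ) (c : List ℕ × List (List ℕ)),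
    Iso H H' ∧ H'.IsPresentedBy c ∧ n = Encodable.encode c}

end Hypergraph

/-! ### Conjunctive queries and databases -/

/-- A relational atom `R(t₁, …, tₙ)`. In queries the arguments name variables, in databases they
name constants. The relation symbol is the pair of the name `rel` and the arity `args.length`. -/
@[ext]
structure RelAtom where
  /-- the name of the relation symbol -/
  rel : ℕ
  /-- the arguments -/
  args : List ℕ

/-- A conjunctive query (without quantifiers), written as the list of its atoms. -/
abbrev ConjQuery := List RelAtom

/-- A finite database, written as a list of ground atoms (in any order). -/
abbrev Database := List RelAtom

/-- The assignment `ν` of variables to constants is a solution of `q` for `D` if replacing the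
variables according to `ν` turns every atom of `q` into an element of `D`. -/
def ConjQuery.IsSolution (q : ConjQuery) (D : Database) (ν : ℕ → ℕ) : Prop :=
  ∀ a ∈ q, RelAtom.mk a.rel (a.args.map ν) ∈ D

/-- The hypergraph of a query: its vertices are the variables of `q`, its edges the sets of
variables of the atoms of `q`. -/
def ConjQuery.hypergraph (q : ConjQuery) : Hypergraph ℕ where
  vertexSet := {x | ∃ a ∈ q, x ∈ a.args}
  edgeSet := {e | ∃ a ∈ q, e = {x | x ∈ a.args}}
  subset_vertexSet_of_mem_edgeSet' := by
    rintro _ ⟨a, ha, rfl⟩ x hx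
    exact ⟨a, ha, hx⟩

/-! ### Instances as strings -/

/-- A natural number as a string: binary digits, least significant first, followed by a comma. -/
def encodeNatStr (n : ℕ) : List Γ' := (encodeNat n).map Γ'.bit ++ [Γ'.comma]

/-- An atom as a string: `[`, the name of the relation symbol, the arguments, `]`. -/
def encodeAtomStr (a : RelAtom) : List Γ' :=
  Γ'.bra :: (encodeNatStr a.rel ++ (a.args.flatMap encodeNatStr ++ [Γ'.ket]))

/-- A pair of a query and a database as a string: the atoms of the query, a comma, the atoms of the
database. -/
def encodeInstStr (x : ConjQuery × Database) : List Γ' :=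
  x.1.flatMap encodeAtomStr ++ (Γ'.comma :: x.2.flatMap encodeAtomStr)

theorem encodeNatStr_cancel (m n : ℕ) (s t : List Γ')
    (h : encodeNatStr m ++ s = encodeNatStr n ++ t) : m = n ∧ s = t := by
  have key : ∀ (A B : List Bool), A.map Γ'.bit ++ Γ'.comma :: s = B.map Γ'.bit ++ Γ'.comma :: t →
      A = B ∧ s = t := by
    intro A
    induction A with
    | nil => intro B hB; cases B <;> simp_all
    | cons a A ih =>
      intro B hB
      cases B with
      | nil => simp at hB
      | cons b B =>
        simp only [List.map_cons, List.cons_append, List.cons.injEq, Γ'.bit.injEq] at hB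
        have := ih B hB.2
        simp [hB.1, this.1, this.2]
  have h2 := key (encodeNat m) (encodeNat n) (by simpa [encodeNatStr] using h)
  refine ⟨?_, h2.2⟩
  rw [← decode_encodeNat m, ← decode_encodeNat n, h2.1]

theorem encodeArgsStr_cancel (l l' : List ℕ) (s t : List Γ')
    (h : l.flatMap encodeNatStr ++ Γ'.ket :: s = l'.flatMap encodeNatStr ++ Γ'.ket :: t) :
    l = l' ∧ s = t := by
  have head : ∀ (n : ℕ) (u v : List Γ'), Γ'.ket :: u ≠ encodeNatStr n ++ v := by
    intro n u v hn
    unfold encodeNatStr at hn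
    cases hb : encodeNat n <;> simp [hb] at hn
  induction l generalizing l' with
  | nil =>
    cases l' with
    | nil => simpa using h
    | cons b l' => exact absurd (by simpa using h) (head b s (l'.flatMap encodeNatStr ++ Γ'.ket :: t))
  | cons a l ih =>
    cases l' with
    | nil =>
      exact absurd (by simpa using h.symm) (head a t (l.flatMap encodeNatStr ++ Γ'.ket :: s))
    | cons b l' =>
      obtain ⟨h1, h2⟩ := encodeNatStr_cancel a b (l.flatMap encodeNatStr ++ Γ'.ket :: s)
        (l'.flatMap encodeNatStr ++ Γ'.ket :: t) (by simpa using h)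
      obtain ⟨h3, h4⟩ := ih l' h2
      exact ⟨by rw [h1, h3], h4⟩

theorem encodeAtomStr_cancel (a b : RelAtom) (s t : List Γ')
    (h : encodeAtomStr a ++ s = encodeAtomStr b ++ t) : a = b ∧ s = t := by
  obtain ⟨h1, h2⟩ := encodeNatStr_cancel a.rel b.rel
    (a.args.flatMap encodeNatStr ++ Γ'.ket :: s) (b.args.flatMap encodeNatStr ++ Γ'.ket :: t)
    (by simpa [encodeAtomStr] using h)
  obtain ⟨h3, h4⟩ := encodeArgsStr_cancel _ _ _ _ h2
  exact ⟨RelAtom.ext h1 h3, h4⟩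

theorem encodeInstStr_injective : Function.Injective encodeInstStr := by
  have hD : ∀ l l' : List RelAtom, l.flatMap encodeAtomStr = l'.flatMap encodeAtomStr → l = l' := by
    intro l
    induction l with
    | nil => intro l' h; cases l' <;> simp_all [encodeAtomStr]
    | cons a l ih =>
      intro l' h
      cases l' with
      | nil => simp [encodeAtomStr] at h
      | cons b l' =>
        obtain ⟨h1, h2⟩ := encodeAtomStr_cancel a b _ _
          (by simpa only [List.flatMap_cons] using h)
        rw [h1, ih l' h2]
  have hq : ∀ (l l' : List RelAtom) (s t : List Γ'),
      l.flatMap encodeAtomStr ++ Γ'.comma :: s = l'.flatMap encodeAtomStr ++ Γ'.comma :: t →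
      l = l' ∧ s = t := by
    intro l
    induction l with
    | nil => intro l' s t h; cases l' <;> simp_all [encodeAtomStr]
    | cons a l ih =>
      intro l' s t h
      cases l' with
      | nil => simp [encodeAtomStr] at h
      | cons b l' =>
        obtain ⟨h1, h2⟩ := encodeAtomStr_cancel a b _ _
          (by simpa only [List.flatMap_cons, List.append_assoc] using h)
        obtain ⟨h3, h4⟩ := ih l' s t h2
        exact ⟨by rw [h1, h3], h4⟩
  rintro ⟨q, D⟩ ⟨q', D'⟩ h
  obtain ⟨h1, h2⟩ := hq _ _ _ _ h
  rw [Prod.mk.injEq]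
  exact ⟨h1, hD _ _ h2⟩

/-! ### Parameterised problems and fpt-reductions -/

/-- A parameterised decision problem: a set of instances, an encoding of the instances as strings
over a finite alphabet, the set of yes-instances, and a parameter for every instance. -/
structure ParamProblem where
  /-- the instances -/
  Inst : Type
  /-- the alphabet -/
  Symb : Type
  finite_symb : Finite Symb
  /-- the encoding of instances -/
  encode : Inst → List Symb
  encode_injective : Function.Injective encode
  /-- the yes-instances -/
  Yes : Inst → Prop
  /-- the parameter of an instance -/
  param : Inst → ℕ

/-- `P` is fpt-reducible to `Q`: some map `R` from the instances of `P` to the instances of `Q`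
* preserves and reflects yes-instances,
* is computed by a multi-stack Turing machine in at most `f k * p n` steps, where `k` is the
  parameter and `n` the length of the input, `f` is computable and `p` is a polynomial,
* and the parameter of `R x` is at most `g k` for a computable `g`.

No algorithm has to recognise the instances of `P` among all strings; accordingly `f` and `g` are
partial recursive functions that have to be defined on all parameters of instances of `P`. -/
def FPTReducible (P Q : ParamProblem) : Prop :=
  ∃ R : P.Inst → Q.Inst,
    (∀ x, P.Yes x ↔ Q.Yes (R x)) ∧
    (∃ (M : Turing.TM2ComputableAux P.Symb Q.Symb) (f : ℕ →. ℕ) (p : Polynomial ℕ),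
      Partrec f ∧
      ∀ x, ∃ b ∈ f (P.param x),
        Nonempty (Turing.TM2OutputsInTime M.tm
          ((P.encode x).map M.inputAlphabet.symm)
          (some ((Q.encode (R x)).map M.outputAlphabet.symm))
          (b * p.eval (P.encode x).length))) ∧
    (∃ g : ℕ →. ℕ, Partrec g ∧ ∀ x, ∃ b ∈ g (P.param x), Q.param (R x) ≤ b)

/-- The problem `p-CQ(C)` for a class `C` of hypergraphs. Instances are the pairs of a query `q`
whose hypergraph is in `C` and a database `D`, the question is whether `q` has a solution for `D`,
and the parameter is the hypergraph of `q` (up to isomorphism). -/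
noncomputable def pCQ (C : Set (Hypergraph ℕ)) : ParamProblem where
  Inst := {x : ConjQuery × Database // ConjQuery.hypergraph x.1 ∈ C}
  Symb := Γ'
  finite_symb := inferInstance
  encode := fun x => encodeInstStr x.1
  encode_injective := encodeInstStr_injective.comp Subtype.val_injective
  Yes := fun x => ∃ ν : ℕ → ℕ, ConjQuery.IsSolution x.1.1 x.1.2 ν
  param := fun x => (ConjQuery.hypergraph x.1.1).isoCode

/-! ### Programs on four stacks -/

/-! Let `(q, D)` be an instance whose hypergraph `M` is a dilution of `H`, with `H` in the class `𝓗`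
and without isolated vertices. Undoing the dilution one operation at a time yields a sketch
(`exists_isSketch`): every edge `e` of `H` gets an edge `π e` of `M`, and every vertex `w` of `H`
gets a label, a set of vertices of `M` that is contained in `π e` whenever `w` lies in `e`. The
edges of `H` that are linked by a shared vertex labelled with a whole edge `F` of `M` act together
as `F`. From some edge over `F`, such links lead to every vertex `v` of `F`, and `v`, regarded as a
vertex of `H`, has a label containing `v`.

A query with hypergraph `H` is obtained by letting the variable `w` store the values of all
variables of `q` in the label of `w`. For an atom `a` of `q` and an edge `e` over the edge of `a`
there is one new atom; its tuples are the restrictions, label by label, of the tuples of `D` that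
match `a`. A solution of `q` gives a solution of the new query by restriction. Conversely, a vertex
labelled with the whole edge forces the tuples chosen at all edges through it to agree, so one tuple
is chosen along a linked family of edges. Its value for `v` can be read off at the vertex `v` of
`H`, and this value is the same for all atoms. This gives `exists_isSolution_newQuery_iff`.

Written as a finite list, a sketch becomes a `Blueprint`. Fitness of a blueprint for the list `masks
q` of edges is recursively enumerable, so a blueprint can be found by a search that halts on all
lists in question (`exists_partrec_isFor`, `exists_isFor`). The search is a partial recursive
function, hence computed by a program in time bounded by a partial recursive function
(`exists_program_of_partrec'`, by means of step-bounded evaluation, which is primitive recursive).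
Given the blueprint, the rest takes polynomial time (`polyTime_reduction`). A total time `p (n +
t)`, with `n` the input length and `t` the search time, is at most `p (n + 1) * p (t + 1)`. The
parameter knows the hypergraph only up to isomorphism, whereas the search depends on an order of
vertices and edges; `exists_partrec_isoCode_bound` therefore takes a bound over all orders.

The machines are programs acting on binary trees that are kept on one stack in prefix notation, the
other stacks being scratch space. -/

namespace StackMachine

/-- The four stacks: `main` holds the data, the others are used during elementary operations. -/
inductive Reg
  | main
  | left
  | right
  | count
  deriving DecidableEq

instance : Fintype Reg :=
  ⟨{.main, .left, .right, .count}, fun k => by cases k <;> decide⟩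

/-- The contents of the stacks. -/
abbrev Store := Reg → List Γ'

/-- An instruction with jumps to labels in `Λ`, where `none` is the exit. -/
inductive Instr (Λ : Type)
  | push (k : Reg) (a : Γ') (l : Option Λ)
  | pop (k : Reg) (next : Option Γ' → Option Λ)

/-- Renaming of the labels, including the exit. -/
def Instr.relabel {Λ Λ' : Type} (ι : Option Λ → Option Λ') : Instr Λ → Instr Λ'
  | .push k a l => .push k a (ι l)
  | .pop k next => .pop k fun o => ι (next o)

/-- The label after an instruction. -/
def Instr.next {Λ : Type} (s : Store) : Instr Λ → Option Λ
  | .push _ _ l => l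
  | .pop k next => next (s k).head?

/-- The stacks after an instruction. -/
def Instr.store {Λ : Type} (s : Store) : Instr Λ → Store
  | .push k a _ => Function.update s k (a :: s k)
  | .pop k _ => Function.update s k (s k).tail

theorem Instr.next_relabel {Λ Λ' : Type} (ι : Option Λ → Option Λ') (s : Store) (i : Instr Λ) :
    (i.relabel ι).next s = ι (i.next s) := by
  cases i <;> rfl

theorem Instr.store_relabel {Λ Λ' : Type} (ι : Option Λ → Option Λ') (s : Store) (i : Instr Λ) :
    (i.relabel ι).store s = i.store s := by
  cases i <;> rfl

/-- `Run code l s l' s' n`: from label `l` and stacks `s` the code leads to `l'` and `s'` in `n`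
steps. -/
inductive Run {Λ : Type} (code : Λ → Instr Λ) : Option Λ → Store → Option Λ → Store → ℕ → Prop
  | refl (l : Option Λ) (s : Store) : Run code l s l s 0
  | step {l : Λ} {s : Store} {l' : Option Λ} {s' : Store} {n : ℕ} :
      Run code ((code l).next s) ((code l).store s) l' s' n → Run code (some l) s l' s' (n + 1)

theorem Run.trans {Λ : Type} {code : Λ → Instr Λ} {l₁ l₂ l₃ : Option Λ} {s₁ s₂ s₃ : Store}
    {m n : ℕ} (h₁ : Run code l₁ s₁ l₂ s₂ m) (h₂ : Run code l₂ s₂ l₃ s₃ n) :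
    Run code l₁ s₁ l₃ s₃ (m + n) := by
  induction h₁ with
  | refl => simpa using h₂
  | @step l s l' s' n' h ih =>
    rw [show n' + 1 + n = n' + n + 1 by omega]
    exact .step (ih h₂)

/-- Only labels `some l` are constrained by `hι`, while `ι none` is free. Hence the exit of one
piece of code can be redirected to the entry of another, which is how `seq` and `branch` are glued.
-/
theorem Run.relabel {Λ Λ' : Type} {code : Λ → Instr Λ} {code' : Λ' → Instr Λ'}
    (ι : Option Λ → Option Λ') (hι : ∀ l, ∃ l', ι (some l) = some l' ∧
      code' l' = (code l).relabel ι) {l₁ l₂ : Option Λ} {s₁ s₂ : Store} {n : ℕ}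
    (h : Run code l₁ s₁ l₂ s₂ n) : Run code' (ι l₁) s₁ (ι l₂) s₂ n := by
  induction h with
  | refl => exact .refl _ _
  | @step l s l' s' n _ ih =>
    obtain ⟨l'', h₁, h₂⟩ := hι l
    rw [h₁]
    apply Run.step
    rwa [h₂, Instr.next_relabel, Instr.store_relabel]

/-- The total height of the stacks. -/
def height (s : Store) : ℕ := ∑ k, (s k).length

theorem height_update (s : Store) (k : Reg) (l : List Γ') (h : l.length ≤ (s k).length + 1) :
    height (Function.update s k l) ≤ height s + 1 := by
  have hu : (Finset.univ : Finset Reg) = {.main, .left, .right, .count} := rfl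
  unfold height
  rw [hu]
  cases k <;> simp [Function.update] <;> omega

/-- An instruction adds at most one symbol. Through `Trans.size_le`, every time bound thus also
bounds the size of the result, as compositions of programs require. -/
theorem Run.height_le {Λ : Type} {code : Λ → Instr Λ} {l₁ l₂ : Option Λ} {s₁ s₂ : Store} {n : ℕ}
    (h : Run code l₁ s₁ l₂ s₂ n) : height s₂ ≤ height s₁ + n := by
  induction h with
  | refl => simp
  | @step l s l' s' n _ ih =>
    have : height ((code l).store s) ≤ height s + 1 := by
      cases hc : code l with
      | push k a l => exact height_update _ _ _ (by simp)
      | pop k next => exact height_update _ _ _ (by simp; omega)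
    omega

/-- A program with finitely many labels. -/
structure Program where
  /-- the labels -/
  Λ : Type
  fin : Fintype Λ
  /-- the first label -/
  entry : Option Λ
  /-- the instructions -/
  code : Λ → Instr Λ

namespace Program

instance (P : Program) : Fintype P.Λ := P.fin

/-- `P.Exec s s' t`: the program `P` transforms `s` into `s'` in at most `t` steps. -/
def Exec (P : Program) (s s' : Store) (t : ℕ) : Prop :=
  ∃ n ≤ t, Run P.code P.entry s none s' n

theorem Exec.mono {P : Program} {s s' : Store} {t t' : ℕ} (h : P.Exec s s' t) (ht : t ≤ t') :
    P.Exec s s' t' :=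
  let ⟨n, hn, h⟩ := h
  ⟨n, hn.trans ht, h⟩

theorem Exec.height_le {P : Program} {s s' : Store} {t : ℕ} (h : P.Exec s s' t) :
    height s' ≤ height s + t :=
  let ⟨_, hn, h⟩ := h
  h.height_le.trans (by omega)

/-- The program that does nothing. -/
def skip : Program where
  Λ := Empty
  fin := inferInstance
  entry := none
  code l := l.elim

theorem exec_skip (s : Store) : skip.Exec s s 0 := ⟨0, le_rfl, .refl _ _⟩

/-- Push the symbol `a` on the stack `k`. -/
def push (k : Reg) (a : Γ') : Program where
  Λ := Unit
  fin := inferInstance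
  entry := some ()
  code _ := .push k a none

theorem exec_push (k : Reg) (a : Γ') (s : Store) :
    (push k a).Exec s (Function.update s k (a :: s k)) 1 :=
  ⟨1, le_rfl, .step (.refl _ _)⟩

/-- First `P`, then `Q`. -/
def seq (P Q : Program) : Program where
  Λ := P.Λ ⊕ Q.Λ
  fin := inferInstance
  entry := P.entry.elim (Q.entry.map .inr) fun l => some (.inl l)
  code
    | .inl l => (P.code l).relabel fun o => o.elim (Q.entry.map .inr) fun l => some (.inl l)
    | .inr l => (Q.code l).relabel (Option.map .inr)

theorem Exec.seq {P Q : Program} {s₁ s₂ s₃ : Store} {t t' : ℕ} (h₁ : P.Exec s₁ s₂ t)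
    (h₂ : Q.Exec s₂ s₃ t') : (P.seq Q).Exec s₁ s₃ (t + t') := by
  obtain ⟨m, hm, h₁⟩ := h₁
  obtain ⟨n, hn, h₂⟩ := h₂
  refine ⟨m + n, by omega, Run.trans (l₂ := Q.entry.map .inr) (s₂ := s₂) ?_ ?_⟩
  · exact h₁.relabel (code' := (P.seq Q).code)
      (fun o => o.elim (Q.entry.map .inr) fun l => some (.inl l)) fun l => ⟨.inl l, rfl, rfl⟩
  · exact h₂.relabel (code' := (P.seq Q).code) (Option.map .inr) fun l => ⟨.inr l, rfl, rfl⟩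

/-- Pop a symbol `o` from the stack `k` (`none` if it is empty) and run `F o`; then start again or
leave, according to `again o`. -/
def branch (k : Reg) (F : Option Γ' → Program) (again : Option Γ' → Bool) : Program where
  Λ := Option (Σ o, (F o).Λ)
  fin := inferInstance
  entry := some none
  code
    | none => .pop k fun o =>
        (F o).entry.elim (if again o then some none else none) fun l => some (some ⟨o, l⟩)
    | some ⟨o, l⟩ => ((F o).code l).relabel fun x =>
        x.elim (if again o then some none else none) fun l => some (some ⟨o, l⟩)

theorem run_branch {k : Reg} {F : Option Γ' → Program} {again : Option Γ' → Bool} {s s' : Store}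
    {t : ℕ} (h : (F (s k).head?).Exec (Function.update s k (s k).tail) s' t) :
    ∃ n ≤ t + 1, Run (branch k F again).code (branch k F again).entry s
      (if again (s k).head? then some none else none) s' n := by
  obtain ⟨n, hn, h⟩ := h
  refine ⟨n + 1, by omega, .step ?_⟩
  exact h.relabel (code' := (branch k F again).code)
    (fun x => x.elim (if again (s k).head? then some none else none)
      fun l => some (some ⟨(s k).head?, l⟩)) fun l => ⟨some ⟨_, l⟩, rfl, rfl⟩

theorem exec_branch {k : Reg} {F : Option Γ' → Program} {again : Option Γ' → Bool} {s s' : Store}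
    {t : ℕ} (ha : again (s k).head? = false)
    (h : (F (s k).head?).Exec (Function.update s k (s k).tail) s' t) :
    (branch k F again).Exec s s' (t + 1) := by
  obtain ⟨n, hn, h⟩ := run_branch (again := again) h
  rw [ha] at h
  exact ⟨n, hn, h⟩

theorem exec_branch_again {k : Reg} {F : Option Γ' → Program} {again : Option Γ' → Bool}
    {s s' s'' : Store} {t t' : ℕ} (ha : again (s k).head? = true)
    (h : (F (s k).head?).Exec (Function.update s k (s k).tail) s' t)
    (h' : (branch k F again).Exec s' s'' t') :
    (branch k F again).Exec s s'' (t + t' + 1) := by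
  obtain ⟨n, hn, h⟩ := run_branch (again := again) h
  obtain ⟨m, hm, h'⟩ := h'
  rw [ha] at h
  exact ⟨n + m, by omega, h.trans h'⟩

/-! ### Programs as Turing machines -/

/-- The Turing machine statement that executes an instruction. -/
def stmt {Λ : Type} : Instr Λ → Turing.TM2.Stmt (fun _ : Reg => Γ') (Option Λ) (Option Γ')
  | .push k a l => .push k (fun _ => a) (.goto fun _ => l)
  | .pop k next => .pop k (fun _ o => o) (.goto next)

/-- The program as a Turing machine with input in `left` and output in `right`. -/
def machine (P : Program) : Turing.FinTM2 where
  K := Reg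
  k₀ := .left
  k₁ := .right
  Γ _ := Γ'
  Λ := Option P.Λ
  main := P.entry
  ΛFin := inferInstance
  σ := Option Γ'
  initialState := none
  Γk₀Fin := inferInstanceAs (Fintype Γ')
  m
    | none => .load (fun _ => none) .halt
    | some l => stmt (P.code l)

/-- The internal state only keeps the last popped symbol, which no later step consults, so its final
value may stay unspecified. -/
theorem machine_run (P : Program) {l l' : Option P.Λ} {s s' : Store} {n : ℕ}
    (h : Run P.code l s l' s' n) (v : Option Γ') : ∃ v' : Option Γ',
      (flip bind P.machine.step)^[n] (some ⟨some l, v, s⟩) = some ⟨some l', v', s'⟩ := by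
  induction h generalizing v with
  | refl => exact ⟨v, rfl⟩
  | @step l s l' s' n _ ih =>
    have : ∃ v', flip bind P.machine.step (some ⟨some (some l), v, s⟩) =
        some ⟨some ((P.code l).next s), v', (P.code l).store s⟩ := by
      cases hc : P.code l with
      | push k a l' =>
        refine ⟨v, ?_⟩
        change some (Turing.TM2.stepAux (stmt (P.code l)) v s) = _
        rw [hc]
        rfl
      | pop k next =>
        refine ⟨(s k).head?, ?_⟩
        change some (Turing.TM2.stepAux (stmt (P.code l)) v s) = _
        rw [hc]
        rfl
    obtain ⟨v', hv⟩ := this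
    obtain ⟨v'', hv'⟩ := ih v'
    exact ⟨v'', by rw [Function.iterate_succ_apply, hv, hv']⟩

/-- The program as a Turing machine over the alphabet `Γ'`. -/
def machineAux (P : Program) : Turing.TM2ComputableAux Γ' Γ' where
  tm := P.machine
  inputAlphabet := Equiv.refl Γ'
  outputAlphabet := Equiv.refl Γ'

theorem Exec.outputs {P : Program} {x y : List Γ'} {t : ℕ}
    (h : P.Exec (Function.update (fun _ => []) .left x) (Function.update (fun _ => []) .right y) t) :
    Nonempty (Turing.TM2OutputsInTime P.machineAux.tm
      (x.map P.machineAux.inputAlphabet.symm)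
      (some (y.map P.machineAux.outputAlphabet.symm)) (t + 1)) := by
  obtain ⟨n, hn, h⟩ := h
  obtain ⟨v, hv⟩ := P.machine_run h none
  -- The additional step is taken at the exit label. It resets the internal state, so that the last
  -- configuration is exactly `haltList`.
  refine ⟨⟨⟨n + 1, ?_⟩, Nat.add_le_add_right hn 1⟩⟩
  have h1 : Turing.initList P.machineAux.tm (x.map P.machineAux.inputAlphabet.symm) =
      (⟨some P.entry, none, Function.update (fun _ => []) .left x⟩ : P.machine.Cfg) := by
    have hx : x.map P.machineAux.inputAlphabet.symm = x := List.map_id x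
    rw [hx]
    unfold Turing.initList
    congr 1
    funext k
    cases k <;> rfl
  have h2 : Turing.haltList P.machineAux.tm (y.map P.machineAux.outputAlphabet.symm) =
      (⟨none, none, Function.update (fun _ => []) .right y⟩ : P.machine.Cfg) := by
    have hy : y.map P.machineAux.outputAlphabet.symm = y := List.map_id y
    rw [hy]
    unfold Turing.haltList
    congr 1
    funext k
    cases k <;> rfl
  rw [h1, Option.map_some, h2, Function.iterate_succ_apply']
  exact (congrArg (flip bind P.machine.step) hv).trans rfl

end Program

end StackMachine

/-! ### Binary trees and elementary operations on them -/

namespace StackMachine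

/-- Binary trees, the data on which programs operate. -/
inductive Data
  | nil
  | pair (x y : Data)

namespace Data

/-- Trees as strings in prefix notation. -/
def ser : Data → List Γ'
  | nil => [Γ'.ket]
  | pair x y => Γ'.bra :: (ser x ++ ser y)

/-- The length of the string of a tree. -/
def size (x : Data) : ℕ := x.ser.length

@[simp] theorem size_nil : size nil = 1 := rfl

@[simp] theorem size_pair (x y : Data) : size (pair x y) = size x + size y + 1 := by
  simp [size, ser]

/-- Prefix notation is uniquely readable: the end of a tree can be recognised whatever follows. -/
theorem ser_cancel (x y : Data) (s t : List Γ') (h : x.ser ++ s = y.ser ++ t) : x = y ∧ s = t := by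
  induction x generalizing y s t with
  | nil =>
    cases y with
    | nil => simpa [ser] using h
    | pair y₁ y₂ => simp [ser] at h
  | pair x₁ x₂ ih₁ ih₂ =>
    cases y with
    | nil => simp [ser] at h
    | pair y₁ y₂ =>
      simp only [ser, List.cons_append, List.append_assoc, List.cons.injEq, true_and] at h
      obtain ⟨h₁, h⟩ := ih₁ _ _ _ h
      obtain ⟨h₂, h⟩ := ih₂ _ _ _ h
      exact ⟨by rw [h₁, h₂], h⟩

theorem ser_injective : Function.Injective ser := fun x y h =>
  (ser_cancel x y [] [] (by simpa using h)).1

end Data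

/-- The store with the given contents of the four stacks. -/
def st (m a b c : List Γ') : Store
  | .main => m
  | .left => a
  | .right => b
  | .count => c

section st

variable (m a b c x : List Γ')

@[simp] theorem st_main : st m a b c .main = m := rfl
@[simp] theorem st_left : st m a b c .left = a := rfl
@[simp] theorem st_right : st m a b c .right = b := rfl
@[simp] theorem st_count : st m a b c .count = c := rfl

@[simp] theorem update_st_main : Function.update (st m a b c) .main x = st x a b c := by
  funext k; cases k <;> rfl

@[simp] theorem update_st_left : Function.update (st m a b c) .left x = st m x b c := by
  funext k; cases k <;> rfl

@[simp] theorem update_st_right : Function.update (st m a b c) .right x = st m a x c := by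
  funext k; cases k <;> rfl

@[simp] theorem update_st_count : Function.update (st m a b c) .count x = st m a b x := by
  funext k; cases k <;> rfl

end st

namespace Program

/-- Remove the top symbol of the stack `k`. -/
def discard (k : Reg) : Program := branch k (fun _ => skip) fun _ => false

theorem exec_discard (k : Reg) (s : Store) :
    (discard k).Exec s (Function.update s k (s k).tail) 1 :=
  exec_branch rfl (exec_skip _)

/-- Put the string `w` on top of the stack `k`. -/
def pushAll (k : Reg) (w : List Γ') : Program := w.foldr (fun a P => P.seq (push k a)) skip

theorem exec_pushAll (k : Reg) (w : List Γ') (s : Store) :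
    (pushAll k w).Exec s (Function.update s k (w ++ s k)) w.length := by
  induction w with
  | nil => simpa [pushAll] using exec_skip s
  | cons a w ih =>
    have := ih.seq (exec_push k a _)
    simpa [pushAll] using this

/-- Move the contents of the stack `k` to the stack `k'`. -/
def move (k k' : Reg) : Program :=
  branch k (fun o => o.elim skip (push k')) Option.isSome

theorem exec_move {k k' : Reg} (hk : k ≠ k') (w : List Γ') (s : Store) (hs : s k = w) :
    (move k k').Exec s (Function.update (Function.update s k' (w.reverse ++ s k')) k [])
      (2 * w.length + 1) := by
  induction w generalizing s with
  | nil =>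
    exact exec_branch (by simp [hs]) (by simpa [hs] using exec_skip _)
  | cons a w ih =>
    have h := ih (Function.update (Function.update s k w) k' (a :: s k'))
      (by simp [Function.update_of_ne hk])
    have : (move k k').Exec s _ _ := exec_branch_again (by simp [hs])
      (by simpa [hs, Function.update_of_ne hk.symm] using exec_push k' a (Function.update s k w)) h
    convert this.mono (t' := 2 * (a :: w).length + 1) (by simp; omega) using 1
    funext j
    by_cases h1 : j = k
    · subst h1; simp
    · by_cases h2 : j = k'
      · subst h2; simp [h1]
      · simp [h1, h2]

theorem exec_move_left_main (m a b c : List Γ') :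
    (move .left .main).Exec (st m a b c) (st (a.reverse ++ m) [] b c) (2 * a.length + 1) := by
  simpa using exec_move (k := .left) (k' := .main) (by decide) a (st m a b c) rfl

theorem exec_move_right_main (m a b c : List Γ') :
    (move .right .main).Exec (st m a b c) (st (b.reverse ++ m) a [] c) (2 * b.length + 1) := by
  simpa using exec_move (k := .right) (k' := .main) (by decide) b (st m a b c) rfl

theorem exec_move_left_right (m a b c : List Γ') :
    (move .left .right).Exec (st m a b c) (st m [] (a.reverse ++ b) c) (2 * a.length + 1) := by
  simpa using exec_move (k := .left) (k' := .right) (by decide) a (st m a b c) rfl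

/-- Push a symbol on `left`, on `right`, on both or on none. -/
def emit (l r : Bool) (x : Γ') : Program :=
  (cond l (push .left x) skip).seq (cond r (push .right x) skip)

/-- The effect of `emit` for a string. -/
def emitted (l : Bool) (w a : List Γ') : List Γ' := cond l (w.reverse ++ a) a

theorem emitted_append (l : Bool) (v w a : List Γ') :
    emitted l (v ++ w) a = emitted l w (emitted l v a) := by
  cases l <;> simp [emitted]

theorem exec_emit (l r : Bool) (x : Γ') (m a b c : List Γ') :
    (emit l r x).Exec (st m a b c) (st m (emitted l [x] a) (emitted r [x] b) c) 2 := by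
  have h1 : (cond l (push .left x) skip).Exec (st m a b c) (st m (emitted l [x] a) b c) 1 := by
    cases l
    · exact (exec_skip _).mono (by simp)
    · simpa [emitted] using exec_push .left x (st m a b c)
  have h2 : (cond r (push .right x) skip).Exec (st m (emitted l [x] a) b c)
      (st m (emitted l [x] a) (emitted r [x] b) c) 1 := by
    cases r
    · exact (exec_skip _).mono (by simp)
    · simpa [emitted] using exec_push .right x (st m (emitted l [x] a) b c)
  exact h1.seq h2

/-- The loop of `take`: the stack `count` has one symbol for every tree that is still to be read. -/
def takeLoop (l r : Bool) : Program :=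
  branch .count (fun o => o.elim skip fun _ => branch .main
    (fun o => if o = some .bra then (emit l r .bra).seq (pushAll .count [.blank, .blank])
      else emit l r .ket) fun _ => false) Option.isSome

/-- The induction goes through in continuation form, since after the first subtree of a pair the
same loop proceeds with the second. The symbol `bra` is the most expensive one: two pops, two steps
for `emit` and two pushes on `count`, hence the factor 6. -/
theorem exec_takeLoop (l r : Bool) (x : Data) (m a b c : List Γ') (s : Store) (t : ℕ)
    (h : (takeLoop l r).Exec (st m (emitted l x.ser a) (emitted r x.ser b) c) s t) :
    (takeLoop l r).Exec (st (x.ser ++ m) a b (.blank :: c)) s (t + 6 * x.size) := by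
  induction x generalizing m a b c t with
  | nil =>
    refine (exec_branch_again (t := 3) (by simp) ?_ h).mono (by simp; omega)
    exact exec_branch rfl (by simpa [Data.ser] using exec_emit l r .ket m a b c)
  | pair x y ihx ihy =>
    have h1 := ihx (y.ser ++ m) (emitted l [.bra] a) (emitted r [.bra] b) (.blank :: c) _
      (ihy m (emitted l x.ser (emitted l [.bra] a)) (emitted r x.ser (emitted r [.bra] b)) c t (by
      simpa only [Data.ser, ← emitted_append, List.singleton_append, List.append_assoc,
        List.cons_append, List.nil_append] using h))
    refine (exec_branch_again (t := 5) (by simp) ?_ h1).mono (by simp; omega)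
    refine exec_branch (t := 4) rfl ?_
    have h2 := (exec_emit l r .bra (x.ser ++ (y.ser ++ m)) a b c).seq
      (exec_pushAll .count [.blank, .blank] _)
    simpa [Data.ser] using h2

/-- Remove the top tree from `main`; its string is pushed on `left` and on `right` if so wished. -/
def take (l r : Bool) : Program := (push .count .blank).seq (takeLoop l r)

theorem exec_take (l r : Bool) (x : Data) (m a b : List Γ') :
    (take l r).Exec (st (x.ser ++ m) a b []) (st m (emitted l x.ser a) (emitted r x.ser b) [])
      (6 * x.size + 2) := by
  have h1 := exec_push .count .blank (st (x.ser ++ m) a b [])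
  have h2 : (takeLoop l r).Exec (st m (emitted l x.ser a) (emitted r x.ser b) [])
      (st m (emitted l x.ser a) (emitted r x.ser b) []) 1 :=
    exec_branch (by simp) (by simpa using exec_skip _)
  refine (h1.seq (t' := 1 + 6 * x.size) ?_).mono (by omega)
  simpa using exec_takeLoop l r x m a b [] _ _ h2

/-- `P.Trans xs ys t`: if the trees `xs` are on top of `main` and the other stacks are empty, then
the program replaces `xs` by `ys` in at most `t` steps. -/
def Trans (P : Program) (xs ys : List Data) (t : ℕ) : Prop :=
  ∀ m, P.Exec (st (xs.flatMap Data.ser ++ m) [] [] []) (st (ys.flatMap Data.ser ++ m) [] [] []) t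

theorem Trans.mono {P : Program} {xs ys : List Data} {t t' : ℕ} (h : P.Trans xs ys t)
    (ht : t ≤ t') : P.Trans xs ys t' := fun m => (h m).mono ht

theorem Trans.seq {P Q : Program} {xs ys zs : List Data} {t t' : ℕ} (h : P.Trans xs ys t)
    (h' : Q.Trans ys zs t') : (P.seq Q).Trans xs zs (t + t') := fun m => (h m).seq (h' m)

/-- `Trans` quantifies over everything below the trees in question, so further trees are absorbed
there. -/
theorem Trans.frame {P : Program} {xs ys : List Data} {t : ℕ} (h : P.Trans xs ys t)
    (zs : List Data) : P.Trans (xs ++ zs) (ys ++ zs) t := fun m => by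
  simpa using h (zs.flatMap Data.ser ++ m)

theorem Trans.size_le {P : Program} {x y : Data} {t : ℕ} (h : P.Trans [x] [y] t) :
    y.size ≤ x.size + t := by
  have hu : (Finset.univ : Finset Reg) = {.main, .left, .right, .count} := rfl
  simpa [height, hu, Data.size] using (h []).height_le

theorem trans_skip (xs : List Data) : skip.Trans xs xs 0 := fun _ => exec_skip _

/-- Duplicate the top tree. -/
def dup : Program := ((take true true).seq (move .left .main)).seq (move .right .main)

theorem trans_dup (x : Data) : dup.Trans [x] [x, x] (10 * x.size + 4) := fun m => by
  have h := ((exec_take true true x m [] []).seq (exec_move_left_main _ _ _ _)).seq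
    (exec_move_right_main _ _ _ _)
  refine Exec.mono (by simpa [emitted, dup] using h) ?_
  simp [Data.size]
  omega

/-- Exchange the two top trees. -/
def swap : Program :=
  (((take true false).seq (take false true)).seq (move .left .main)).seq (move .right .main)

theorem trans_swap (x y : Data) : swap.Trans [x, y] [y, x] (8 * x.size + 8 * y.size + 6) :=
  fun m => by
  have h := (((exec_take true false x (y.ser ++ m) [] []).seq
    (exec_take false true y m _ _)).seq
    (exec_move_left_main _ _ _ _)).seq (exec_move_right_main _ _ _ _)
  refine Exec.mono (by simpa [emitted, swap] using h) ?_
  simp [Data.size]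
  omega

/-- Remove the top tree. -/
def drop : Program := take false false

theorem trans_drop (x : Data) : drop.Trans [x] [] (6 * x.size + 2) := fun m => by
  simpa [emitted, drop] using exec_take false false x m [] []

/-- Put the tree `x` on top. -/
def pushData (x : Data) : Program := pushAll .main x.ser

theorem trans_pushData (x : Data) : (pushData x).Trans [] [x] x.size := fun m => by
  simpa [pushData, Data.size] using exec_pushAll .main x.ser (st m [] [] [])

/-- Replace the two top trees by their pair. -/
def cons : Program := push .main .bra

theorem trans_cons (x y : Data) : cons.Trans [x, y] [.pair x y] 1 := fun m => by
  simpa [Data.ser, cons] using exec_push .main .bra (st (x.ser ++ (y.ser ++ m)) [] [] [])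

/-- Take the top tree apart; continue with `P` if it is a pair, else with `Q`. -/
def ifPair (P Q : Program) : Program :=
  branch .main (fun o => if o = some .bra then P else Q) fun _ => false

theorem trans_ifPair_pair {P : Program} (Q : Program) {x y : Data} {xs ys : List Data} {t : ℕ}
    (h : P.Trans (x :: y :: xs) ys t) : (ifPair P Q).Trans (.pair x y :: xs) ys (t + 1) :=
  fun m => exec_branch rfl (by simpa [Data.ser] using h m)

theorem trans_ifPair_nil (P : Program) {Q : Program} {xs ys : List Data} {t : ℕ}
    (h : Q.Trans xs ys t) : (ifPair P Q).Trans (.nil :: xs) ys (t + 1) :=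
  fun m => exec_branch rfl (by simpa [Data.ser] using h m)

/-- While the top tree is a pair, take it apart and run `P`. -/
def whilePair (P : Program) : Program :=
  branch .main (fun o => if o = some .bra then P else skip) fun o => o = some .bra

theorem trans_whilePair_pair {P : Program} {x y : Data} {xs ys zs : List Data} {t t' : ℕ}
    (h : P.Trans (x :: y :: xs) ys t) (h' : (whilePair P).Trans ys zs t') :
    (whilePair P).Trans (.pair x y :: xs) zs (t + t' + 1) :=
  fun m => exec_branch_again (by simp [Data.ser]) (by simpa [Data.ser] using h m) (h' m)

theorem trans_whilePair_nil (P : Program) (xs : List Data) :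
    (whilePair P).Trans (.nil :: xs) xs 1 :=
  fun m => exec_branch (by simp [Data.ser]) (by simpa [Data.ser] using exec_skip _)

end Program

end StackMachine

/-! ### Comparison of trees, conversions between strings and trees -/

namespace StackMachine

namespace Data

/-- Truth values as trees. -/
def ofBool : Bool → Data
  | false => nil
  | true => pair nil nil

/-- Lists as trees. -/
def ofList {α : Type*} (f : α → Data) : List α → Data
  | [] => nil
  | a :: l => pair (f a) (ofList f l)

/-- Numbers in unary notation as trees. -/
def chain : ℕ → Data
  | 0 => nil
  | n + 1 => pair nil (chain n)

/-- The symbols in a fixed order. -/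
def symbols : List Γ' := [.blank, .bit false, .bit true, .bra, .ket, .comma]

/-- Symbols as trees. -/
def ofSymbol (a : Γ') : Data := chain (symbols.idxOf a)

theorem size_ofSymbol_le (a : Γ') : (ofSymbol a).size ≤ 11 := by
  rcases a with _ | (_ | _) | _ | _ | _ <;> decide

/-- The string of a tree as a list of truth values. -/
def bits (x : Data) : List Bool := x.ser.map fun a => decide (a = .ket)

theorem map_bits (x : Data) : x.bits.map (fun b => cond b Γ'.ket .bra) = x.ser := by
  unfold bits
  rw [List.map_map]
  induction x with
  | nil => rfl
  | pair x y ihx ihy => simp_all [ser]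

theorem bits_injective : Function.Injective bits := fun x y h =>
  ser_injective (by rw [← map_bits, ← map_bits, h])

end Data

namespace Program

/-- The first part of `equal`: compare the stacks `left` and `right`. -/
def compareLoop : Program :=
  branch .left (fun o => o.elim skip fun a =>
    branch .right (fun o' => if o' = some a then skip else push .count .blank) fun _ => false)
    Option.isSome

/-- A mismatch, or a string `b` that ends too early, leaves a symbol on `count`; a string `b` that
is too long leaves a remainder on `right`. Emptiness of both stacks is therefore the test for
equality. -/
theorem exec_compareLoop (m a b c : List Γ') : ∃ b' c', (b' = [] ∧ c' = [] ↔ a = b ∧ c = []) ∧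
    b'.length ≤ b.length ∧ c'.length ≤ c.length + a.length ∧
    compareLoop.Exec (st m a b c) (st m [] b' c') (3 * a.length + 1) := by
  induction a generalizing b c with
  | nil =>
    exact ⟨b, c, by simp [eq_comm], by simp, by simp,
      exec_branch (by simp) (by simpa using exec_skip _)⟩
  | cons x a ih =>
    by_cases hx : b.head? = some x
    · obtain ⟨b', c', h1, h2, h3, h4⟩ := ih b.tail c
      refine ⟨b', c', ?_, h2.trans (by simp), h3.trans (by simp),
        (exec_branch_again (t := 1) (by simp) ?_ h4).mono (by simp; omega)⟩
      · rw [h1]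
        cases b with
        | nil => simp at hx
        | cons y b =>
          obtain rfl : y = x := by simpa using hx
          simp
      · exact exec_branch rfl (by simpa [hx] using exec_skip _)
    · obtain ⟨b', c', h1, h2, h3, h4⟩ := ih b.tail (.blank :: c)
      refine ⟨b', c', ?_, h2.trans (by simp), h3.trans (by simp; omega),
        (exec_branch_again (t := 2) (by simp) ?_ h4).mono (by simp; omega)⟩
      · rw [h1]
        cases b with
        | nil => simp
        | cons y b => simp_all [eq_comm]
      · refine exec_branch (t := 1) rfl ?_
        simpa [hx] using exec_push .count .blank (st m a b.tail c)

/-- Empty the stack `right`; if it was not empty, push symbols on `count`. -/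
def flushRight : Program :=
  branch .right (fun o => o.elim skip fun _ => push .count .blank) Option.isSome

theorem exec_flushRight (m a b c : List Γ') : ∃ c', (c' = [] ↔ b = [] ∧ c = []) ∧
    c'.length ≤ c.length + b.length ∧
    flushRight.Exec (st m a b c) (st m a [] c') (2 * b.length + 1) := by
  induction b generalizing c with
  | nil => exact ⟨c, by simp, by simp, exec_branch (by simp) (by simpa using exec_skip _)⟩
  | cons x b ih =>
    obtain ⟨c', h1, h2, h3⟩ := ih (.blank :: c)
    refine ⟨c', by simp [h1], h2.trans (by simp; omega),
      (exec_branch_again (t := 1) (by simp) ?_ h3).mono (by simp; omega)⟩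
    simpa using exec_push .count .blank (st m a b c)

/-- Empty the stack `count`. -/
def flushCount : Program := branch .count (fun _ => skip) Option.isSome

theorem exec_flushCount (m a b c : List Γ') :
    flushCount.Exec (st m a b c) (st m a b []) (c.length + 1) := by
  induction c with
  | nil => exact exec_branch (by simp) (by simpa using exec_skip _)
  | cons x c ih =>
    refine (exec_branch_again (t := 0) (by simp) ?_ ih).mono (by simp)
    simpa using exec_skip _

/-- Replace the two top trees by the truth value of their equality. -/
def equal : Program :=
  (((((take true false).seq (take false true)).seq compareLoop).seq flushRight).seq
    (branch .count (fun o => pushAll .main (Data.ofBool o.isNone).ser) fun _ => false)).seq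
    flushCount

open Classical in
theorem trans_equal (x y : Data) :
    equal.Trans [x, y] [.ofBool (decide (x = y))] (10 * x.size + 9 * y.size + 20) := fun m => by
  have h1 := exec_take true false x (y.ser ++ m) [] []
  have h2 := exec_take false true y m (emitted true x.ser []) (emitted false x.ser [])
  obtain ⟨b, c, h3, h4, h5, h6⟩ := exec_compareLoop m x.ser.reverse y.ser.reverse []
  obtain ⟨c', h7, h8, h9⟩ := exec_flushRight m [] b c
  have h10 : c'.head?.isNone = decide (x = y) := by
    have : c' = [] ↔ x = y := by
      rw [h7, h3]
      simp [Data.ser_injective.eq_iff]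
    rw [← show decide (c' = []) = decide (x = y) from decide_eq_decide.2 this]
    cases c' <;> simp
  have h11 : (branch .count (fun o => pushAll .main (Data.ofBool o.isNone).ser)
      fun _ => false).Exec (st m [] [] c') (st ((Data.ofBool (decide (x = y))).ser ++ m) [] [] c'.tail)
      (3 + 1) := by
    refine exec_branch rfl ?_
    refine Exec.mono (by simpa [h10] using exec_pushAll .main _ (st m [] [] c'.tail)) ?_
    cases decide (x = y) <;> decide
  simp only [emitted, cond_true, cond_false, List.append_nil] at h1 h2
  have h := ((((h1.seq h2).seq h6).seq h9).seq h11).seq (exec_flushCount _ _ _ _)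
  refine Exec.mono (by simpa [equal] using h) ?_
  simp only [List.length_reverse, List.length_nil, List.length_tail, zero_add] at *
  simp only [Data.size]
  omega

/-- The loop of `quote`. -/
def quoteLoop : Program :=
  branch .left (fun o => o.elim skip fun a =>
    pushAll .main (.bra :: (Data.ofBool (decide (a = .ket))).ser)) Option.isSome

/-- `take` leaves the string reversed on `left`, so its last symbol is popped first and the list is
built from its end. -/
theorem exec_quoteLoop (m a : List Γ') (l : List Bool) :
    quoteLoop.Exec (st ((Data.ofList .ofBool l).ser ++ m) a [] [])
      (st ((Data.ofList .ofBool (a.reverse.map (fun x => decide (x = .ket)) ++ l)).ser ++ m) [] [] [])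
      (5 * a.length + 1) := by
  induction a generalizing l with
  | nil => exact exec_branch (by simp) (by simpa using exec_skip _)
  | cons x a ih =>
    have h := ih (decide (x = .ket) :: l)
    have h' := exec_pushAll .main (.bra :: (Data.ofBool (decide (x = .ket))).ser)
      (st ((Data.ofList .ofBool l).ser ++ m) a [] [])
    simp only [List.reverse_cons, List.map_append, List.map_cons, List.map_nil, List.append_assoc,
      List.singleton_append]
    refine (exec_branch_again (t := 4) (by simp) ?_ h).mono (by simp; omega)
    refine Exec.mono (by simpa [Data.ofList, Data.ser] using h') ?_
    cases decide (x = .ket) <;> decide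

/-- Replace a tree by the list of truth values that describes it. -/
def quote : Program := ((take true false).seq (push .main .ket)).seq quoteLoop

theorem trans_quote (x : Data) :
    quote.Trans [x] [.ofList .ofBool x.bits] (11 * x.size + 4) := fun m => by
  have h := ((exec_take true false x m [] []).seq (exec_push .main .ket _)).seq
    (by simpa [emitted, Data.ser, Data.ofList] using exec_quoteLoop m x.ser.reverse [])
  refine Exec.mono (by simpa [quote, Data.bits] using h) ?_
  simp only [Data.size]
  omega

/-- The loop of `unquote`. -/
def unquoteLoop : Program :=
  branch .main (fun o => if o = some .bra then
      branch .main (fun o => if o = some .bra then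
        ((discard .main).seq (discard .main)).seq (push .left .ket)
        else push .left .bra) fun _ => false
      else skip) fun o => o = some .bra

theorem exec_unquoteLoop (m a : List Γ') (l : List Bool) :
    unquoteLoop.Exec (st ((Data.ofList .ofBool l).ser ++ m) a [] [])
      (st m ((l.map fun b => cond b Γ'.ket .bra).reverse ++ a) [] []) (5 * l.length + 1) := by
  induction l generalizing a with
  | nil =>
    exact exec_branch (by simp [Data.ser, Data.ofList])
      (by simpa [Data.ser, Data.ofList] using exec_skip _)
  | cons b l ih =>
    have h := ih ((cond b Γ'.ket .bra) :: a)
    simp only [List.map_cons, List.reverse_cons, List.append_assoc, List.singleton_append] at h ⊢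
    refine (exec_branch_again (t := 4) (by simp [Data.ser, Data.ofList]) ?_ h).mono
      (by simp; omega)
    cases b
    · refine Exec.mono (t := 1 + 1) ?_ (by simp)
      simp only [Data.ofList, Data.ofBool, Data.ser, st_main]
      refine exec_branch rfl ?_
      simpa using exec_push .left .bra (st ((Data.ofList .ofBool l).ser ++ m) a [] [])
    · simp only [Data.ofList, Data.ofBool, Data.ser, st_main]
      refine exec_branch (t := 3) rfl ?_
      simpa using ((exec_discard .main (st (.ket :: .ket :: ((Data.ofList .ofBool l).ser ++ m))
        a [] [])).seq (exec_discard .main _)).seq (exec_push .left .ket _)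

/-- Replace the list of truth values that describes a tree by this tree. -/
def unquote : Program := unquoteLoop.seq (move .left .main)

theorem trans_unquote (x : Data) :
    unquote.Trans [.ofList .ofBool x.bits] [x] (7 * x.size + 2) := fun m => by
  have h := (exec_unquoteLoop m [] x.bits).seq (exec_move_left_main _ _ _ _)
  refine Exec.mono (by simpa [unquote, Data.map_bits] using h) ?_
  simp [Data.size, Data.bits]
  omega

/-- The loop of `readInput`. -/
def readLoop : Program :=
  branch .right (fun o => o.elim skip fun a => pushAll .main (.bra :: (Data.ofSymbol a).ser))
    Option.isSome

theorem exec_readLoop (b : List Γ') (l : List Γ') :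
    readLoop.Exec (st (Data.ofList .ofSymbol l).ser [] b [])
      (st (Data.ofList .ofSymbol (b.reverse ++ l)).ser [] [] []) (13 * b.length + 1) := by
  induction b generalizing l with
  | nil => exact exec_branch (by simp) (by simpa using exec_skip _)
  | cons x b ih =>
    have h := ih (x :: l)
    have h' := exec_pushAll .main (.bra :: (Data.ofSymbol x).ser)
      (st (Data.ofList .ofSymbol l).ser [] b [])
    simp only [List.reverse_cons, List.append_assoc, List.singleton_append] at h ⊢
    refine (exec_branch_again (t := 12) (by simp) ?_ h).mono (by simp; omega)
    refine Exec.mono (by simpa [Data.ofList, Data.ser] using h') ?_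
    have := Data.size_ofSymbol_le x
    simpa [Data.size, Nat.lt_succ_iff] using this

/-- Turn the string in `left` into a tree. -/
def readInput : Program := ((move .left .right).seq (push .main .ket)).seq readLoop

theorem exec_readInput (w : List Γ') :
    readInput.Exec (st [] w [] []) (st (Data.ofList .ofSymbol w).ser [] [] [])
      (15 * w.length + 3) := by
  have h := ((exec_move_left_right [] w [] []).seq (exec_push .main .ket _)).seq
    (by simpa [Data.ser, Data.ofList] using exec_readLoop w.reverse [])
  refine Exec.mono (by simpa [readInput] using h) ?_
  omega

/-- Read a symbol from `main` and push it on `left`. -/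
def readSymbol : List Γ' → Program
  | [] => skip
  | a :: l => branch .main (fun o => if o = some .bra then (discard .main).seq (readSymbol l)
      else push .left a) fun _ => false

theorem exec_readSymbol (L : List Γ') (n : ℕ) (x : Γ') (h : L[n]? = some x) (m a : List Γ') :
    (readSymbol L).Exec (st ((Data.chain n).ser ++ m) a [] []) (st m (x :: a) [] [])
      (2 * n + 2) := by
  induction n generalizing L with
  | zero =>
    cases L with
    | nil => simp at h
    | cons y L =>
      obtain rfl : y = x := by simpa using h
      exact exec_branch (t := 1) rfl
        (by simpa [Data.chain, Data.ser] using exec_push .left y (st m a [] []))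
  | succ n ih =>
    cases L with
    | nil => simp at h
    | cons y L =>
      have h1 := (exec_discard .main (st (.ket :: ((Data.chain n).ser ++ m)) a [] [])).seq
        (by simpa using ih L (by simpa using h))
      exact (exec_branch rfl (by simpa [Data.chain, Data.ser] using h1)).mono (by omega)

/-- The loop of `writeOutput`. -/
def writeLoop : Program :=
  branch .main (fun o => if o = some .bra then readSymbol Data.symbols else skip)
    fun o => o = some .bra

theorem exec_writeLoop (a l : List Γ') :
    writeLoop.Exec (st (Data.ofList .ofSymbol l).ser a [] []) (st [] (l.reverse ++ a) [] [])
      (13 * l.length + 1) := by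
  induction l generalizing a with
  | nil =>
    exact exec_branch (by simp [Data.ser, Data.ofList])
      (by simpa [Data.ser, Data.ofList] using exec_skip _)
  | cons x l ih =>
    have h := ih (x :: a)
    simp only [List.reverse_cons, List.append_assoc, List.singleton_append]
    refine (exec_branch_again (t := 12) (by simp [Data.ser, Data.ofList]) ?_ h).mono
      (by simp; omega)
    -- The largest of the six positions is 5, and `2 * 5 + 2 = 12` is the time allotted to one
    -- symbol.
    have h1 : Data.symbols[Data.symbols.idxOf x]? = some x ∧ Data.symbols.idxOf x ≤ 5 := by
      rcases x with _ | (_ | _) | _ | _ | _ <;> decide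
    refine Exec.mono (t := 2 * Data.symbols.idxOf x + 2) ?_ (by omega)
    have h' := exec_readSymbol _ _ x h1.1 (Data.ofList .ofSymbol l).ser a
    simpa [Data.ser, Data.ofList, Data.ofSymbol] using h'

/-- Write the string that is represented by the top tree to `right`. -/
def writeOutput : Program := writeLoop.seq (move .left .right)

theorem exec_writeOutput (w : List Γ') :
    writeOutput.Exec (st (Data.ofList .ofSymbol w).ser [] [] []) (st [] [] w [])
      (15 * w.length + 2) := by
  have h := (exec_writeLoop [] w).seq (exec_move_left_right _ _ _ _)
  refine Exec.mono (by simpa [writeOutput] using h) ?_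
  omega

end Program

end StackMachine

/-! ### Polynomial-time functions -/

namespace Polynomial

theorem eval_nat_mono (p : Polynomial ℕ) {m n : ℕ} (h : m ≤ n) : p.eval m ≤ p.eval n := by
  induction p using Polynomial.induction_on' with
  | add p q hp hq => simpa using add_le_add hp hq
  | monomial k a => simpa using Nat.mul_le_mul_left a (Nat.pow_le_pow_left h k)

/-- Natural coefficients satisfy `a ≤ a * a`, and the mixed products of a sum can only enlarge the
right-hand side. -/
theorem eval_nat_mul_le (p : Polynomial ℕ) (m n : ℕ) :
    p.eval (m * n) ≤ p.eval m * p.eval n := by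
  induction p using Polynomial.induction_on' with
  | add p q hp hq =>
    simp only [eval_add]
    nlinarith [Nat.zero_le (p.eval m * q.eval n), Nat.zero_le (q.eval m * p.eval n)]
  | monomial k a =>
    simp only [eval_monomial, mul_pow]
    calc a * (m ^ k * n ^ k) ≤ (a * a) * (m ^ k * n ^ k) :=
          Nat.mul_le_mul_right _ (Nat.le_mul_self a)
      _ = _ := by ring

/-- Because `m + n ≤ (m + 1) * (n + 1)`, the two summands separate. This brings the running time of
the reduction into the form `f k * p n`. -/
theorem eval_nat_add_le (p : Polynomial ℕ) (m n : ℕ) :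
    p.eval (m + n) ≤ p.eval (m + 1) * p.eval (n + 1) :=
  (p.eval_nat_mono (by nlinarith [Nat.zero_le (m * n)])).trans (p.eval_nat_mul_le _ _)

end Polynomial

namespace StackMachine

open Data Program

/-- Types whose elements are coded as trees. -/
class Coded (α : Type*) where
  /-- the code of an element -/
  toData : α → Data
  toData_injective : Function.Injective toData

open Coded

instance : Coded Bool where
  toData := ofBool
  toData_injective a b h := by cases a <;> cases b <;> simp_all [ofBool]

instance {α β : Type*} [Coded α] [Coded β] : Coded (α × β) where
  toData p := pair (toData p.1) (toData p.2)
  toData_injective p q h := by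
    simp only [Data.pair.injEq] at h
    exact Prod.ext (toData_injective h.1) (toData_injective h.2)

theorem Data.ofList_injective {α : Type*} {f : α → Data} (hf : Function.Injective f) :
    Function.Injective (ofList f) := by
  intro l l' h
  induction l generalizing l' with
  | nil => cases l' <;> simp_all [ofList]
  | cons a l ih =>
    cases l' with
    | nil => simp [ofList] at h
    | cons b l' =>
      simp only [ofList, Data.pair.injEq] at h
      rw [hf h.1, ih h.2]

instance {α : Type*} [Coded α] : Coded (List α) where
  toData := ofList toData
  toData_injective := ofList_injective toData_injective

instance : Coded Γ' where
  toData := ofSymbol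
  toData_injective := Function.LeftInverse.injective
    -- A chain of length `n` has size `2 * n + 1`, so halving the size recovers the position in
    -- `symbols`.
    (g := fun x => symbols.getD (x.size / 2) .blank) fun a => by
      rcases a with _ | (_ | _) | _ | _ | _ <;> rfl

/-- The size of the code of an element. -/
def sz {α : Type*} [Coded α] (a : α) : ℕ := (toData a).size

section size

variable {α β : Type*} [Coded α] [Coded β]

theorem toData_mk (a : α) (b : β) : toData (a, b) = pair (toData a) (toData b) := rfl

theorem toData_cons (a : α) (l : List α) : toData (a :: l) = pair (toData a) (toData l) := rfl

@[simp] theorem sz_mk (a : α) (b : β) : sz (a, b) = sz a + sz b + 1 := size_pair _ _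

@[simp] theorem sz_nil : sz ([] : List α) = 1 := rfl

@[simp] theorem sz_cons (a : α) (l : List α) : sz (a :: l) = sz a + sz l + 1 := size_pair _ _

theorem sz_bool_le (b : Bool) : sz b ≤ 3 := by cases b <;> decide

@[simp] theorem sz_append (l l' : List α) : sz (l ++ l') + 1 = sz l + sz l' := by
  induction l with
  | nil => simp; omega
  | cons a l ih => simp only [List.cons_append, sz_cons]; omega

theorem length_lt_sz (l : List α) : l.length < sz l := by
  induction l with
  | nil => simp
  | cons a l ih => simp only [List.length_cons, sz_cons]; omega

end size

/-- Run `P` and `Q` on copies of the top tree and pair the results. -/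
def Program.both (P Q : Program) : Program := (((dup.seq Q).seq swap).seq P).seq cons

theorem Program.Trans.both {P Q : Program} {x y z : Data} {t t' : ℕ} (h : P.Trans [x] [y] t)
    (h' : Q.Trans [x] [z] t') :
    (P.both Q).Trans [x] [pair y z] (t + t' + (18 * x.size + 8 * z.size + 11)) :=
  ((((trans_dup x).seq (h'.frame [x])).seq (trans_swap z x)).seq (h.frame [z])).seq
    (trans_cons y z) |>.mono (by omega)

/-- Run `C` on a copy of the top tree, and then `P` or `Q` according to the result. -/
def Program.cond (C P Q : Program) : Program :=
  (dup.seq C).seq (ifPair ((drop.seq drop).seq P) Q)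

theorem Program.Trans.cond {C P Q : Program} {x y : Data} {b : Bool} {t t' : ℕ}
    (hC : C.Trans [x] [toData b] t') (hP : b = true → P.Trans [x] [y] t)
    (hQ : b = false → Q.Trans [x] [y] t) :
    (cond C P Q).Trans [x] [y] (t + t' + (10 * x.size + 30)) := by
  refine (((trans_dup x).seq (hC.frame [x])).seq (t' := t + 20) ?_).mono (by omega)
  cases b with
  | false => exact (trans_ifPair_nil _ (hQ rfl)).mono (by omega)
  | true =>
    have h1 : drop.Trans [nil, nil, x] [nil, x] 8 := (trans_drop nil).frame [nil, x]
    have h2 : drop.Trans [nil, x] [x] 8 := (trans_drop nil).frame [x]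
    exact (trans_ifPair_pair Q ((h1.seq h2).seq (hP rfl))).mono (by omega)

/-- The functions computed by programs in polynomial time. -/
def PolyTime {α β : Type*} [Coded α] [Coded β] (f : α → β) : Prop :=
  ∃ (P : Program) (p : Polynomial ℕ), ∀ a, P.Trans [toData a] [toData (f a)] (p.eval (sz a))

/-! ### Closure properties of the polynomial-time functions. -/

namespace PolyTime

open Polynomial

variable {α β γ σ : Type*} [Coded α] [Coded β] [Coded γ] [Coded σ]

theorem sz_le {f : α → β} (hf : PolyTime f) : ∃ q : Polynomial ℕ, ∀ a, sz (f a) ≤ q.eval (sz a) := by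
  obtain ⟨P, p, h⟩ := hf
  exact ⟨X + p, fun a => by simpa [sz] using (h a).size_le⟩

theorem of_eq {f g : α → β} (hf : PolyTime f) (h : ∀ a, f a = g a) : PolyTime g :=
  (funext h : f = g) ▸ hf

protected theorem id : PolyTime fun a : α => a :=
  ⟨skip, 0, fun _ => (trans_skip _).mono (by simp)⟩

theorem comp {f : β → γ} {g : α → β} (hf : PolyTime f) (hg : PolyTime g) :
    PolyTime fun a => f (g a) := by
  obtain ⟨q, hq⟩ := hg.sz_le
  obtain ⟨P, p, hP⟩ := hf
  obtain ⟨P', p', hP'⟩ := hg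
  refine ⟨P'.seq P, p' + p.comp q, fun a => ((hP' a).seq (hP (g a))).mono ?_⟩
  simpa using p.eval_nat_mono (hq a)

theorem const (b : β) : PolyTime fun _ : α => b :=
  ⟨drop.seq (pushData (toData b)), 6 * X + C (2 + sz b), fun a =>
    ((trans_drop _).seq (trans_pushData _)).mono (by simp [sz]; omega)⟩

theorem pair {f : α → β} {g : α → γ} (hf : PolyTime f) (hg : PolyTime g) :
    PolyTime fun a => (f a, g a) := by
  obtain ⟨q, hq⟩ := hg.sz_le
  obtain ⟨P, p, hP⟩ := hf
  obtain ⟨P', p', hP'⟩ := hg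
  refine ⟨P.both P', p + p' + (18 * X + 8 * q + 11), fun a => ((hP a).both (hP' a)).mono ?_⟩
  have := hq a
  simp only [sz] at *
  simp
  omega

theorem fst : PolyTime (Prod.fst : α × β → α) := by
  refine ⟨ifPair (swap.seq drop) skip, 16 * X + 10, fun p => ?_⟩
  obtain ⟨a, b⟩ := p
  refine (trans_ifPair_pair _ ((trans_swap _ _).seq ((trans_drop _).frame [_]))).mono ?_
  simp [sz, toData_mk]
  omega

theorem snd : PolyTime (Prod.snd : α × β → β) := by
  refine ⟨ifPair drop skip, 6 * X + 10, fun p => ?_⟩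
  obtain ⟨a, b⟩ := p
  refine (trans_ifPair_pair _ ((trans_drop _).frame [_])).mono ?_
  simp [sz, toData_mk]
  omega

protected theorem cond {c : α → Bool} {f g : α → β} (hc : PolyTime c) (hf : PolyTime f)
    (hg : PolyTime g) : PolyTime fun a => cond (c a) (f a) (g a) := by
  obtain ⟨C, p, hC⟩ := hc
  obtain ⟨P, p', hP⟩ := hf
  obtain ⟨Q, p'', hQ⟩ := hg
  refine ⟨C.cond P Q, p' + p'' + p + (10 * X + 30), fun a => ?_⟩
  refine (Trans.cond (t := p'.eval (sz a) + p''.eval (sz a)) (hC a) (fun h => ?_)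
    fun h => ?_).mono ?_
  · simp only [h, cond_true]; exact (hP a).mono (by omega)
  · simp only [h, cond_false]; exact (hQ a).mono (by omega)
  · simp [sz]

protected theorem ite {c : α → Prop} [DecidablePred c] {f g : α → β}
    (hc : PolyTime fun a => decide (c a)) (hf : PolyTime f) (hg : PolyTime g) :
    PolyTime fun a => if c a then f a else g a :=
  (hc.cond hf hg).of_eq fun a => by by_cases h : c a <;> simp [h]

theorem eq [DecidableEq β] {f g : α → β} (hf : PolyTime f) (hg : PolyTime g) :
    PolyTime fun a => decide (f a = g a) := by
  have h : PolyTime fun p : β × β => decide (p.1 = p.2) := by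
    refine ⟨ifPair equal skip, 10 * X + 30, fun p => ?_⟩
    have h1 := trans_equal (toData p.1) (toData p.2)
    rw [decide_eq_decide.2 toData_injective.eq_iff] at h1
    refine (trans_ifPair_pair _ h1).mono ?_
    obtain ⟨a, b⟩ := p
    simp [sz, toData_mk]
    omega
  exact h.comp (hf.pair hg)

theorem and {f g : α → Bool} (hf : PolyTime f) (hg : PolyTime g) :
    PolyTime fun a => f a && g a :=
  (hf.cond hg (const false)).of_eq fun a => by cases f a <;> rfl

theorem list_cons {f : α → β} {g : α → List β} (hf : PolyTime f) (hg : PolyTime g) :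
    PolyTime fun a => f a :: g a :=
  hf.pair hg

theorem list_casesOn {f : α → List β} {g : α → σ} {h : α × β × List β → σ} (hf : PolyTime f)
    (hg : PolyTime g) (hh : PolyTime h) :
    PolyTime fun a => List.casesOn (motive := fun _ => σ) (f a) (g a) fun b l => h (a, b, l) := by
  have key : PolyTime fun p : List β × α =>
      List.casesOn (motive := fun _ => σ) p.1 (g p.2) fun b l => h (p.2, b, l) := by
    obtain ⟨P, p, hP⟩ := hg
    obtain ⟨Q, q, hQ⟩ := hh
    refine ⟨ifPair (ifPair ((cons.seq swap).seq (cons.seq Q)) P) skip,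
      p + q.comp (X + 1) + 8 * X + 20, ?_⟩
    rintro ⟨_ | ⟨b, l⟩, a⟩
    · refine (trans_ifPair_pair _ (trans_ifPair_nil _ (hP a))).mono ?_
      have := p.eval_nat_mono (show sz a ≤ sz (([] : List β), a) by simp; omega)
      simp at *
      omega
    · have h1 := (((trans_cons (toData b) (toData l)).frame [toData a]).seq
        (trans_swap (toData (b, l)) (toData a))).seq ((trans_cons _ _).seq (hQ (a, b, l)))
      refine (trans_ifPair_pair _ (trans_ifPair_pair _ h1)).mono ?_
      have := q.eval_nat_mono (show sz (a, b, l) ≤ sz (b :: l, a) + 1 by simp; omega)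
      simp [← sz.eq_1] at *
      omega
  exact key.comp (hf.pair PolyTime.id)

/-- The loop over a list, when the accumulator grows by a bounded amount in every round. -/
theorem exists_foldl {h : α × σ × β → σ} (hh : PolyTime h) :
    ∃ (P : Program) (p : Polynomial ℕ), ∀ (a : α) (K L M : ℕ),
      (∀ s b, sz b ≤ L → sz (h (a, s, b)) ≤ sz s + K) → ∀ (l : List β) (s : σ), sz l ≤ L →
      sz s + l.length * K ≤ M → P.Trans [toData l, toData (a, s)]
        [toData (a, l.foldl (fun s b => h (a, s, b)) s)]
        (l.length * p.eval (sz a + L + M) + 1) := by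
  have hF : PolyTime fun x : (β × List β) × (α × σ) => (x.1.2, x.2.1, h (x.2.1, x.2.2, x.1.1)) :=
    (snd.comp fst).pair ((fst.comp snd).pair (hh.comp ((fst.comp snd).pair ((snd.comp snd).pair
      (fst.comp fst)))))
  obtain ⟨P, p, hP⟩ := hF
  -- In each round the trees `b`, `l`, `(a, s)` are packed into one, `P` replaces it by the
  -- remaining list with the new state, and the result is unpacked for the next test.
  refine ⟨whilePair ((cons.seq cons).seq (P.seq (ifPair skip skip))), p.comp (X + 3) + 4,
    fun a K L M hK l => ?_⟩
  induction l with
  | nil => exact fun s _ _ => (trans_whilePair_nil _ _).mono (by simp)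
  | cons b l ih =>
    intro s hL hM
    simp only [sz_cons, List.length_cons, add_mul, one_mul] at hL hM
    have hs := hK s b (by omega)
    have h1 := ih (h (a, s, b)) (by omega) (by omega)
    have h2 := ((trans_cons (toData b) (toData l)).frame [toData (a, s)]).seq
      (trans_cons (toData (b, l)) (toData (a, s)))
    have h3 := h2.seq ((hP ((b, l), (a, s))).seq (trans_ifPair_pair skip (trans_skip _)))
    refine (trans_whilePair_pair h3 h1).mono ?_
    have := p.eval_nat_mono (show sz ((b, l), (a, s)) ≤ sz a + L + M + 3 by simp; omega)
    simp only [List.length_cons, eval_add, eval_comp, eval_X, eval_ofNat, add_mul] at *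
    omega

/-- The growth per round that `hq` allows does not depend on the accumulator. Its size thus stays
below the initial size plus the number of rounds times a polynomial, which excludes exponential
growth. -/
theorem foldl {f : α → List β} {g : α → σ} {h : α × σ × β → σ} (hf : PolyTime f) (hg : PolyTime g)
    (hh : PolyTime h) (hq : ∃ q : Polynomial ℕ, ∀ a s b, sz (h (a, s, b)) ≤ sz s + q.eval (sz a + sz b)) :
    PolyTime fun a => (f a).foldl (fun s b => h (a, s, b)) (g a) := by
  have key : PolyTime fun x : List β × α × σ =>
      (x.2.1, x.1.foldl (fun s b => h (x.2.1, s, b)) x.2.2) := by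
    obtain ⟨P, p, hP⟩ := exists_foldl hh
    obtain ⟨q, hq⟩ := hq
    refine ⟨ifPair P skip, X * p.comp (2 * X + X * q) + 2, fun x => ?_⟩
    obtain ⟨l, a, s⟩ := x
    set n := sz (l, a, s) with hn
    simp only [sz_mk] at hn
    have hl : l.length ≤ n := (length_lt_sz l).le.trans (by omega)
    have h1 := hP a (q.eval n) (sz l) (n + n * q.eval n)
      (fun s b hb => (hq a s b).trans (Nat.add_le_add_left (q.eval_nat_mono (by omega)) _)) l s
      le_rfl (add_le_add (by omega) (Nat.mul_le_mul_right _ hl))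
    refine (trans_ifPair_pair skip h1).mono ?_
    have h2 := p.eval_nat_mono (show sz a + sz l + (n + n * q.eval n) ≤ 2 * n + n * q.eval n by omega)
    have h3 := Nat.mul_le_mul hl h2
    simp only [eval_add, eval_mul, eval_comp, eval_X, eval_ofNat]
    omega
  exact snd.comp (key.comp (hf.pair (PolyTime.id.pair hg)))

theorem list_reverse : PolyTime (List.reverse : List α → List α) := by
  have h : PolyTime fun x : List α × List α × α => x.2.2 :: x.2.1 :=
    list_cons (snd.comp snd) (fst.comp snd)
  refine (foldl PolyTime.id (const []) h ⟨X + 1, fun a s b => ?_⟩).of_eq fun l => ?_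
  · simp; omega
  · simp

theorem foldr {f : α → List β} {g : α → σ} {h : α × β × σ → σ} (hf : PolyTime f) (hg : PolyTime g)
    (hh : PolyTime h) (hq : ∃ q : Polynomial ℕ, ∀ a b s, sz (h (a, b, s)) ≤ sz s + q.eval (sz a + sz b)) :
    PolyTime fun a => (f a).foldr (fun b s => h (a, b, s)) (g a) := by
  have h' : PolyTime fun x : α × σ × β => h (x.1, x.2.2, x.2.1) :=
    hh.comp (fst.pair ((snd.comp snd).pair (fst.comp snd)))
  obtain ⟨q, hq⟩ := hq
  exact (foldl (list_reverse.comp hf) hg h' ⟨q, fun a s b => hq a b s⟩).of_eq fun a => by simp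

theorem sz_le₂ {k : α × β → σ} (hk : PolyTime k) :
    ∃ q : Polynomial ℕ, ∀ a b, sz (k (a, b)) ≤ q.eval (sz a + sz b) := by
  obtain ⟨q, hq⟩ := hk.sz_le
  exact ⟨q.comp (X + 1), fun a b => by simpa using hq (a, b)⟩

theorem list_append {f g : α → List β} (hf : PolyTime f) (hg : PolyTime g) :
    PolyTime fun a => f a ++ g a := by
  have h : PolyTime fun x : α × β × List β => x.2.1 :: x.2.2 :=
    list_cons (fst.comp snd) (snd.comp snd)
  refine (foldr hf hg h ⟨X + 1, fun a b s => ?_⟩).of_eq fun a => ?_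
  · simp; omega
  · simp

theorem list_map {f : α → List β} {k : α × β → σ} (hf : PolyTime f) (hk : PolyTime k) :
    PolyTime fun a => (f a).map fun b => k (a, b) := by
  have h : PolyTime fun x : α × β × List σ => k (x.1, x.2.1) :: x.2.2 :=
    list_cons (hk.comp (fst.pair (fst.comp snd))) (snd.comp snd)
  obtain ⟨q, hq⟩ := hk.sz_le₂
  refine (foldr hf (const []) h ⟨q + 1, fun a b s => ?_⟩).of_eq fun a => ?_
  · have := hq a b
    simp; omega
  · induction f a <;> simp_all

theorem list_filter {f : α → List β} {k : α × β → Bool} (hf : PolyTime f) (hk : PolyTime k) :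
    PolyTime fun a => (f a).filter fun b => k (a, b) := by
  have h : PolyTime fun x : α × β × List β => cond (k (x.1, x.2.1)) (x.2.1 :: x.2.2) x.2.2 :=
    (hk.comp (fst.pair (fst.comp snd))).cond (list_cons (fst.comp snd) (snd.comp snd))
      (snd.comp snd)
  refine (foldr hf (const []) h ⟨X + 1, fun a b s => ?_⟩).of_eq fun a => ?_
  · cases k (a, b) <;> simp; omega
  · induction f a with
    | nil => rfl
    | cons b l ih => cases hb : k (a, b) <;> simp_all

theorem list_flatMap {f : α → List β} {k : α × β → List σ} (hf : PolyTime f) (hk : PolyTime k) :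
    PolyTime fun a => (f a).flatMap fun b => k (a, b) := by
  have h : PolyTime fun x : α × β × List σ => k (x.1, x.2.1) ++ x.2.2 :=
    list_append (hk.comp (fst.pair (fst.comp snd))) (snd.comp snd)
  obtain ⟨q, hq⟩ := hk.sz_le₂
  refine (foldr hf (const []) h ⟨q, fun a b s => ?_⟩).of_eq fun a => ?_
  · have := hq a b
    have := sz_append (k (a, b)) s
    simp only
    omega
  · induction f a <;> simp_all

theorem list_any {f : α → List β} {k : α × β → Bool} (hf : PolyTime f) (hk : PolyTime k) :
    PolyTime fun a => (f a).any fun b => k (a, b) := by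
  have h : PolyTime fun x : α × β × Bool => cond (k (x.1, x.2.1)) true x.2.2 :=
    (hk.comp (fst.pair (fst.comp snd))).cond (const true) (snd.comp snd)
  refine (foldr hf (const false) h ⟨3, fun a b s => ?_⟩).of_eq fun a => ?_
  · exact (sz_bool_le _).trans (by simp)
  · induction f a with
    | nil => rfl
    | cons b l ih => cases hb : k (a, b) <;> simp_all

theorem list_mem [DecidableEq β] {f : α → β} {g : α → List β} (hf : PolyTime f)
    (hg : PolyTime g) : PolyTime fun a => decide (f a ∈ g a) := by
  refine (list_any hg (eq (hf.comp fst) snd)).of_eq fun a => ?_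
  rw [Bool.eq_iff_iff]
  simp

theorem list_headD {f : α → List β} (b : β) (hf : PolyTime f) :
    PolyTime fun a => (f a).headD b :=
  (list_casesOn hf (const b) (fst.comp snd)).of_eq fun a => by cases f a <;> rfl

theorem list_tail {f : α → List β} (hf : PolyTime f) : PolyTime fun a => (f a).tail :=
  (list_casesOn hf (const []) (snd.comp snd)).of_eq fun a => by cases f a <;> rfl

/-- One fold over the first list suffices: the state holds the unread part of the second list and
the reversed result, which no longer changes once the second list is exhausted. -/
theorem list_zip {f : α → List β} {g : α → List γ} (hf : PolyTime f) (hg : PolyTime g) :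
    PolyTime fun a => (f a).zip (g a) := by
  have h : PolyTime fun x : α × (List γ × List (β × γ)) × β =>
      (x.2.1.1.tail, List.casesOn (motive := fun _ => List (β × γ)) x.2.1.1 x.2.1.2
        fun c _ => (x.2.2, c) :: x.2.1.2) := by
    refine (list_tail (fst.comp (fst.comp snd))).pair (list_casesOn
      (h := fun y : (α × (List γ × List (β × γ)) × β) × γ × List γ =>
        (y.1.2.2, y.2.1) :: y.1.2.1.2) (fst.comp (fst.comp snd)) (snd.comp (fst.comp snd)) ?_)
    exact list_cons ((snd.comp (snd.comp fst)).pair (fst.comp snd))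
      (snd.comp (fst.comp (snd.comp fst)))
  have h' := foldl hf (hg.pair (const [])) h ⟨X + 3, fun a s b => by
    obtain ⟨_ | ⟨c, s₁⟩, s₂⟩ := s <;> simp; omega⟩
  refine (list_reverse.comp (snd.comp h')).of_eq fun a => ?_
  suffices ∀ (l : List β) (l' : List γ) (s : List (β × γ)),
      (l.foldl (fun s b => (s.1.tail, List.casesOn (motive := fun _ => List (β × γ)) s.1 s.2
        fun c _ => (b, c) :: s.2)) (l', s)).2 = (l.zip l').reverse ++ s by
    simp [this]
  intro l
  induction l with
  | nil => simp
  | cons b l ih =>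
    intro l' s
    cases l' with
    | nil => simp [ih]
    | cons c l' => simp [ih]

end PolyTime

end StackMachine

/-! ### Binary numbers and partial recursive functions -/

namespace StackMachine

open Data Program Coded

/-- The successor in binary notation. -/
def binSucc : List Bool → List Bool
  | [] => [true]
  | false :: l => true :: l
  | true :: l => false :: binSucc l

theorem encodePosNum_succ (n : PosNum) : encodePosNum n.succ = binSucc (encodePosNum n) := by
  induction n with
  | one => rfl
  | bit0 n ih => rfl
  | bit1 n ih => simp [PosNum.succ, encodePosNum, binSucc, ih]

theorem encodeNat_succ (n : ℕ) : encodeNat (n + 1) = binSucc (encodeNat n) := by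
  unfold encodeNat
  rw [show ((n + 1 : ℕ) : Num) = (n : Num).succ from
    (Nat.cast_succ n).trans (Num.add_one _)]
  cases (n : Num) with
  | zero => rfl
  | pos n => exact encodePosNum_succ n

/-- The state of the fold is the carry and the reversed list of digits; a carry left at the end
becomes a new leading digit. As a fold, `binSucc` is seen to be both polynomial-time and primitive
recursive. -/
theorem foldl_binSucc (l : List Bool) (c : Bool) (s : List Bool) :
    (l.foldl (fun s b => (s.1 && b, (s.1 != b) :: s.2)) (c, s)).2.reverse ++
      cond (l.foldl (fun s b => (s.1 && b, (s.1 != b) :: s.2)) (c, s)).1 [true] [] =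
    s.reverse ++ cond c (binSucc l) l := by
  induction l generalizing c s with
  | nil => cases c <;> rfl
  | cons b l ih =>
    rw [List.foldl_cons, ih]
    cases b <;> cases c <;> simp [binSucc]

instance : Coded ℕ where
  toData n := toData (encodeNat n)
  toData_injective m n h := by
    rw [← decode_encodeNat m, toData_injective h, decode_encodeNat]

instance {n : ℕ} : Coded (List.Vector ℕ n) where
  toData v := toData v.toList
  toData_injective _ _ h := List.Vector.toList_injective (toData_injective h)

namespace PolyTime

theorem binSucc : PolyTime binSucc := by
  have h : PolyTime fun x : List Bool × (Bool × List Bool) × Bool =>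
      (x.2.1.1 && x.2.2, (x.2.1.1 != x.2.2) :: x.2.1.2) := by
    have h1 : PolyTime fun x : List Bool × (Bool × List Bool) × Bool => x.2.1.1 :=
      fst.comp (fst.comp snd)
    have h2 : PolyTime fun x : List Bool × (Bool × List Bool) × Bool => x.2.2 := snd.comp snd
    refine (h1.and h2).pair (list_cons ?_ (snd.comp (fst.comp snd)))
    refine ((eq h1 h2).cond (const false) (const true)).of_eq fun x => ?_
    cases x.2.1.1 <;> cases x.2.2 <;> rfl
  have h' := foldl (h := fun x => (x.2.1.1 && x.2.2, (x.2.1.1 != x.2.2) :: x.2.1.2))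
    PolyTime.id (const (true, [])) h ⟨8, fun a s b => by
      have h1 := sz_bool_le (s.1 && b)
      have h2 := sz_bool_le (s.1 != b)
      obtain ⟨s₁, s₂⟩ := s
      simp at *; omega⟩
  refine (list_append (list_reverse.comp (snd.comp h')) ((fst.comp h').cond (const [true])
    (const []))).of_eq fun l => ?_
  exact foldl_binSucc l true []

/-- A number and its list of digits have the same tree, so the program for `binSucc` serves
unchanged. -/
theorem nat_succ : PolyTime Nat.succ := by
  obtain ⟨P, p, hP⟩ := binSucc
  refine ⟨P, p, fun n => ?_⟩
  have := hP (encodeNat n)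
  rwa [← encodeNat_succ] at this

theorem vector_toList {n : ℕ} : PolyTime (List.Vector.toList : List.Vector ℕ n → List ℕ) :=
  PolyTime.id (α := List.Vector ℕ n)

theorem vector_toList_iff {α : Type*} [Coded α] {n : ℕ} {f : α → List.Vector ℕ n} :
    (PolyTime fun a => (f a).toList) ↔ PolyTime f := Iff.rfl

end PolyTime

theorem sz_binSucc_le (l : List Bool) : sz (binSucc l) ≤ sz l + 4 := by
  induction l with
  | nil => decide
  | cons b l ih =>
    cases b
    · simp only [binSucc, sz_cons]
      have : sz true = 3 := rfl
      omega
    · simp only [binSucc, sz_cons]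
      have : sz true = 3 := rfl
      have : sz false = 1 := rfl
      omega

theorem sz_nat_le (n : ℕ) : sz n ≤ 4 * n + 1 := by
  induction n with
  | zero => decide
  | succ n ih =>
    have : sz (n + 1) ≤ sz n + 4 := by
      change sz (encodeNat (n + 1)) ≤ sz (encodeNat n) + 4
      rw [encodeNat_succ]
      exact sz_binSucc_le _
    omega

/-- Types for which the size of the codes is bounded by a primitive recursive function. -/
class SizeBounded (α : Type*) [Primcodable α] [Coded α] : Prop where
  exists_bound : ∃ B : α → ℕ, Primrec B ∧ ∀ a, sz a ≤ B a

instance : SizeBounded ℕ :=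
  ⟨fun n => 4 * n + 1, Primrec.succ.comp (Primrec.nat_mul.comp (Primrec.const 4) Primrec.id),
    sz_nat_le⟩

instance {α β : Type*} [Primcodable α] [Coded α] [Primcodable β] [Coded β] [SizeBounded α]
    [SizeBounded β] : SizeBounded (α × β) := by
  obtain ⟨A, hA, hA'⟩ := SizeBounded.exists_bound (α := α)
  obtain ⟨B, hB, hB'⟩ := SizeBounded.exists_bound (α := β)
  refine ⟨fun p => A p.1 + B p.2 + 1, Primrec.succ.comp (Primrec.nat_add.comp
    (hA.comp Primrec.fst) (hB.comp Primrec.snd)), fun p => ?_⟩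
  have := hA' p.1
  have := hB' p.2
  obtain ⟨a, b⟩ := p
  simp at *
  omega

instance {α : Type*} [Primcodable α] [Coded α] [SizeBounded α] : SizeBounded (List α) := by
  obtain ⟨A, hA, hA'⟩ := SizeBounded.exists_bound (α := α)
  refine ⟨fun l => l.foldr (fun a s => A a + s + 1) 1, ?_, fun l => ?_⟩
  · exact Primrec.list_foldr Primrec.id (Primrec.const 1) (Primrec.succ.comp (Primrec.nat_add.comp
      (hA.comp (Primrec.fst.comp Primrec.snd)) (Primrec.snd.comp Primrec.snd))).to₂
  · induction l with
    | nil => simp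
    | cons a l ih =>
      have := hA' a
      simp only [sz_cons, List.foldr_cons] at ih ⊢
      omega

instance {n : ℕ} : SizeBounded (List.Vector ℕ n) := by
  obtain ⟨A, hA, hA'⟩ := SizeBounded.exists_bound (α := List ℕ)
  exact ⟨fun v => A v.toList, hA.comp Primrec.vector_toList, fun v => hA' v.toList⟩

theorem primrec_eval (p : Polynomial ℕ) : Primrec fun n => p.eval n := by
  induction p using Polynomial.induction_on' with
  | add p q hp hq => exact (Primrec.nat_add.comp hp hq).of_eq fun n => by simp
  | monomial k a =>
    have : ∀ k, Primrec fun n : ℕ => n ^ k := fun k => by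
      induction k with
      | zero => exact Primrec.const 1
      | succ k ih => exact (Primrec.nat_mul.comp ih Primrec.id).of_eq fun n => by simp [pow_succ]
    exact (Primrec.nat_mul.comp (Primrec.const a) (this k)).of_eq fun n => by simp

/-- Such sums are the running times of loops: `τ` is the cost of a round and `k` the number of
rounds. -/
theorem primrec_sum_iterate {σ : Type*} [Primcodable σ] {τ : σ → ℕ} {body : σ → σ} (hτ : Primrec τ) (hb : Primrec body) :
    Primrec₂ fun (s : σ) (k : ℕ) => ∑ i ∈ Finset.range k, τ (body^[i] s) := by
  have h : Primrec₂ fun (x : σ × ℕ) (y : ℕ × ℕ) => y.2 + τ (body^[y.1] x.1) :=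
    (Primrec.nat_add.comp (Primrec.snd.comp Primrec.snd) (hτ.comp (Primrec.nat_iterate
      (Primrec.fst.comp Primrec.snd) (Primrec.fst.comp Primrec.fst) (hb.comp Primrec.snd).to₂))).to₂
  refine (Primrec.nat_rec' (f := Prod.snd) (g := fun _ => 0) Primrec.snd (Primrec.const 0)
    h).to₂.of_eq fun s k => ?_
  induction k with
  | zero => rfl
  | succ k ih => simp only [Finset.sum_range_succ, ← ih]

/-- The primitive recursive functions that are computed by programs in primitive recursive time. -/
def PrimTime {α β : Type*} [Primcodable α] [Coded α] [Primcodable β] [Coded β] (f : α → β) : Prop :=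
  Primrec f ∧ ∃ (P : Program) (T : α → ℕ), Primrec T ∧
    ∀ a, P.Trans [toData a] [toData (f a)] (T a)

/-! ### Programs for the primitive recursive functions. -/

namespace PrimTime

variable {α β γ σ : Type*} [Primcodable α] [Coded α] [Primcodable β] [Coded β] [Primcodable γ]
  [Coded γ] [Primcodable σ] [Coded σ]

theorem of_eq {f g : α → β} (hf : PrimTime f) (h : ∀ a, f a = g a) : PrimTime g :=
  (funext h : f = g) ▸ hf

theorem of_polyTime [SizeBounded α] {f : α → β} (hf : Primrec f) (h : PolyTime f) :
    PrimTime f := by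
  obtain ⟨B, hB, hB'⟩ := SizeBounded.exists_bound (α := α)
  obtain ⟨P, p, hP⟩ := h
  exact ⟨hf, P, fun a => p.eval (B a), (primrec_eval p).comp hB, fun a =>
    (hP a).mono (p.eval_nat_mono (hB' a))⟩

theorem comp {f : β → γ} {g : α → β} (hf : PrimTime f) (hg : PrimTime g) :
    PrimTime fun a => f (g a) := by
  obtain ⟨hf, P, T, hT, hP⟩ := hf
  obtain ⟨hg, P', T', hT', hP'⟩ := hg
  exact ⟨hf.comp hg, P'.seq P, fun a => T' a + T (g a), Primrec.nat_add.comp hT' (hT.comp hg),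
    fun a => (hP' a).seq (hP _)⟩

theorem pair [SizeBounded α] {f : α → β} {g : α → γ} (hf : PrimTime f) (hg : PrimTime g) :
    PrimTime fun a => (f a, g a) := by
  obtain ⟨B, hB, hB'⟩ := SizeBounded.exists_bound (α := α)
  obtain ⟨hf, P, T, hT, hP⟩ := hf
  obtain ⟨hg, P', T', hT', hP'⟩ := hg
  refine ⟨hf.pair hg, P.both P', fun a => (T a + T' a) + (26 * (B a + T' a) + 11), ?_, fun a =>
    ((hP a).both (hP' a)).mono ?_⟩
  · exact Primrec.nat_add.comp (Primrec.nat_add.comp hT hT') (Primrec.nat_add.comp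
      (Primrec.nat_mul.comp (Primrec.const 26) (Primrec.nat_add.comp hB hT')) (Primrec.const 11))
  · have h1 := hB' a
    have h2 := (hP' a).size_le
    simp only [sz] at h1
    beta_reduce
    omega

/-- Iterate a function as long as a condition holds. -/
theorem exists_while [SizeBounded σ] {test : σ → Bool} {body : σ → σ} (ht : PrimTime test)
    (hb : PrimTime body) : ∃ (P : Program) (τ : σ → ℕ), Primrec τ ∧ ∀ (k : ℕ) (s : σ),
      (∀ i < k, test (body^[i] s) = true) → test (body^[k] s) = false →
      P.Trans [toData s] [toData (body^[k] s)] (∑ i ∈ Finset.range (k + 1), τ (body^[i] s)) := by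
  obtain ⟨B, hB, hB'⟩ := SizeBounded.exists_bound (α := σ)
  obtain ⟨-, P, T, hT, hP⟩ := ht
  obtain ⟨-, Q, U, hU, hQ⟩ := hb
  have h1 (s : σ) : (dup.seq P).Trans [toData s] [toData (test s), toData s]
      (10 * B s + 4 + T s) :=
    ((trans_dup _).seq ((hP s).frame [_])).mono (by have := hB' s; simp only [sz] at this; omega)
  refine ⟨(dup.seq P).seq (whilePair (((drop.seq drop).seq Q).seq (dup.seq P))),
    fun s => 10 * B s + 4 + T s + U s + 20, ?_, fun k s hk hk' => ?_⟩
  · exact Primrec.nat_add.comp (Primrec.nat_add.comp (Primrec.nat_add.comp (Primrec.nat_add.comp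
      (Primrec.nat_mul.comp (Primrec.const 10) hB) (Primrec.const 4)) hT) hU) (Primrec.const 20)
  · suffices ∀ (k : ℕ) (s : σ), (∀ i < k, test (body^[i] s) = true) →
        test (body^[k] s) = false →
        (whilePair (((drop.seq drop).seq Q).seq (dup.seq P))).Trans [toData (test s), toData s]
          [toData (body^[k] s)] (∑ i ∈ Finset.range k,
            (10 * B (body^[i + 1] s) + 4 + T (body^[i + 1] s) + U (body^[i + 1] s) + 20) +
              U s + 20) by
      refine ((h1 s).seq (this k s hk hk')).mono ?_
      rw [Finset.sum_range_succ']
      simp only [Function.iterate_zero, id]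
      omega
    clear hk hk'
    intro k
    induction k with
    | zero =>
      intro s _ hs
      simp only [Function.iterate_zero, id] at hs ⊢
      rw [hs]
      exact (trans_whilePair_nil _ _).mono (by omega)
    | succ k ih =>
      intro s hs hs'
      have h2 := ih (body s) (fun i hi => hs (i + 1) (by omega)) hs'
      have h3 : test s = true := hs 0 (by omega)
      have h4 : drop.Trans [Data.nil, Data.nil, toData s] [Data.nil, toData s] 8 :=
        (trans_drop _).frame [_, _]
      have h5 : drop.Trans [Data.nil, toData s] [toData s] 8 := (trans_drop _).frame [_]
      rw [h3]
      refine (trans_whilePair_pair (((h4.seq h5).seq (hQ s)).seq (h1 (body s))) h2).mono ?_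
      rw [Finset.sum_range_succ']
      simp only [Function.iterate_zero, id, Function.iterate_succ_apply]
      omega

theorem vector_head {n : ℕ} : PrimTime (List.Vector.head : List.Vector ℕ (n + 1) → ℕ) :=
  of_polyTime Primrec.vector_head ((PolyTime.list_headD 0 PolyTime.vector_toList).of_eq fun v => by
    rcases v with ⟨_ | ⟨a, l⟩, h⟩
    · simp at h
    · rfl)

theorem vector_tail {n : ℕ} :
    PrimTime (List.Vector.tail : List.Vector ℕ (n + 1) → List.Vector ℕ n) :=
  of_polyTime Primrec.vector_tail (PolyTime.vector_toList_iff.1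
    ((PolyTime.list_tail PolyTime.vector_toList).of_eq fun v => by
      rcases v with ⟨_ | ⟨a, l⟩, h⟩
      · simp at h
      · rfl))

theorem vector_cons [SizeBounded α] {n : ℕ} {f : α → ℕ} {g : α → List.Vector ℕ n}
    (hf : PrimTime f) (hg : PrimTime g) : PrimTime fun a => f a ::ᵥ g a := by
  have : PrimTime fun p : ℕ × List.Vector ℕ n => p.1 ::ᵥ p.2 :=
    of_polyTime (Primrec.vector_cons.comp Primrec.fst Primrec.snd) (PolyTime.vector_toList_iff.1
      ((PolyTime.list_cons PolyTime.fst (PolyTime.vector_toList.comp PolyTime.snd)).of_eq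
        fun p => by simp))
  exact this.comp (hf.pair hg)

theorem vector_ofFn [SizeBounded α] {n : ℕ} {f : Fin n → α → ℕ} (hf : ∀ i, PrimTime (f i)) :
    PrimTime fun a => List.Vector.ofFn fun i => f i a := by
  induction n with
  | zero => exact of_polyTime (Primrec.const _) (PolyTime.const _)
  | succ n ih => exact vector_cons (hf 0) (ih fun i => hf i.succ)

theorem vector_get {n : ℕ} (i : Fin n) : PrimTime fun v : List.Vector ℕ n => v.get i := by
  induction n with
  | zero => exact i.elim0
  | succ n ih =>
    cases i using Fin.cases with
    | zero => exact vector_head.of_eq fun v => by simp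
    | succ i => exact ((ih i).comp vector_tail).of_eq fun v => by simp

theorem id [SizeBounded α] : PrimTime fun a : α => a := of_polyTime Primrec.id PolyTime.id

theorem const [SizeBounded α] (b : β) : PrimTime fun _ : α => b :=
  of_polyTime (Primrec.const b) (PolyTime.const b)

theorem fst [SizeBounded α] [SizeBounded β] : PrimTime (Prod.fst : α × β → α) :=
  of_polyTime Primrec.fst PolyTime.fst

theorem snd [SizeBounded α] [SizeBounded β] : PrimTime (Prod.snd : α × β → β) :=
  of_polyTime Primrec.snd PolyTime.snd

theorem nat_succ : PrimTime Nat.succ := of_polyTime Primrec.succ PolyTime.nat_succ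

/-- Primitive recursion runs as a loop on states consisting of the final index, the current index,
the current value and the parameters. The number of rounds is the head of the input, so the total
time is again primitive recursive. -/
theorem nat_rec {n : ℕ} {f : List.Vector ℕ n → ℕ} {g : List.Vector ℕ (n + 2) → ℕ}
    (hf : PrimTime f) (hg : PrimTime g) : PrimTime fun v : List.Vector ℕ (n + 1) =>
      (v.head.rec (f v.tail) fun y IH => g (y ::ᵥ IH ::ᵥ v.tail) : ℕ) := by
  let body : ℕ × ℕ × ℕ × List.Vector ℕ n → ℕ × ℕ × ℕ × List.Vector ℕ n := fun s =>
    (s.1, s.2.1 + 1, g (s.2.1 ::ᵥ s.2.2.1 ::ᵥ s.2.2.2), s.2.2.2)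
  let test : ℕ × ℕ × ℕ × List.Vector ℕ n → Bool := fun s => cond (decide (s.1 = s.2.1)) false true
  let init : List.Vector ℕ (n + 1) → ℕ × ℕ × ℕ × List.Vector ℕ n := fun v =>
    (v.head, 0, f v.tail, v.tail)
  have htest : PrimTime test := of_polyTime
    (Primrec.cond (Primrec.eq.decide.comp Primrec.fst (Primrec.fst.comp Primrec.snd))
      (Primrec.const false) (Primrec.const true))
    ((PolyTime.eq PolyTime.fst (PolyTime.fst.comp PolyTime.snd)).cond (PolyTime.const _)
      (PolyTime.const _))
  have hi : PrimTime fun s : ℕ × ℕ × ℕ × List.Vector ℕ n => s.2.1 := fst.comp snd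
  have hacc : PrimTime fun s : ℕ × ℕ × ℕ × List.Vector ℕ n => s.2.2.1 := fst.comp (snd.comp snd)
  have hv : PrimTime fun s : ℕ × ℕ × ℕ × List.Vector ℕ n => s.2.2.2 := snd.comp (snd.comp snd)
  have hbody : PrimTime body :=
    fst.pair ((nat_succ.comp hi).pair ((hg.comp (vector_cons hi (vector_cons hacc hv))).pair hv))
  have hinit : PrimTime init :=
    vector_head.pair ((const 0).pair ((hf.comp vector_tail).pair vector_tail))
  obtain ⟨P, τ, hτ, hP⟩ := exists_while htest hbody
  have hiter (v : List.Vector ℕ (n + 1)) (k : ℕ) : body^[k] (init v) =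
      (v.head, k, (k.rec (f v.tail) fun y IH => g (y ::ᵥ IH ::ᵥ v.tail) : ℕ), v.tail) := by
    induction k with
    | zero => rfl
    | succ k ih => rw [Function.iterate_succ_apply', ih]
  have hloop : PrimTime fun v => body^[v.head] (init v) := by
    obtain ⟨hi, Q, T, hT, hQ⟩ := hinit
    refine ⟨Primrec.nat_iterate Primrec.vector_head hi (hbody.1.comp Primrec.snd).to₂, Q.seq P,
      fun v => T v + ∑ i ∈ Finset.range (v.head + 1), τ (body^[i] (init v)), ?_, fun v =>
      (hQ v).seq (hP _ _ (fun i hi => ?_) ?_)⟩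
    · exact Primrec.nat_add.comp hT ((primrec_sum_iterate hτ hbody.1).comp hi
        (Primrec.succ.comp Primrec.vector_head))
    · simp [hiter, test, hi.ne']
    · simp [hiter, test]
  exact (hacc.comp hloop).of_eq fun v => by rw [hiter]

/-- `Nat.Primrec'` generates the primitive recursive functions from vectors of numbers alone, so no
pairing function has to be programmed. -/
theorem of_primrec' {n : ℕ} {f : List.Vector ℕ n → ℕ} (hf : Nat.Primrec' f) : PrimTime f := by
  induction hf with
  | zero => exact const 0
  | succ => exact nat_succ.comp vector_head
  | get i => exact vector_get i
  | comp g _ _ hf hg => exact hf.comp (vector_ofFn hg)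
  | prec _ _ hf hg => exact nat_rec hf hg

theorem of_primrec₂ {f : ℕ → ℕ → ℕ} (hf : Primrec₂ f) : PrimTime fun p : ℕ × ℕ => f p.1 p.2 :=
  ((of_primrec' (Nat.Primrec'.prim_iff₂.2 hf)).comp
    (vector_cons fst (vector_cons snd (const List.Vector.nil)))).of_eq fun p => by simp

end PrimTime

/-- Every partial recursive function is computed by a program whose running time is bounded by a
partial recursive function. -/
theorem exists_program_of_partrec {F : ℕ →. ℕ} (hF : Partrec F) :
    ∃ (P : Program) (T : ℕ →. ℕ), Partrec T ∧
      ∀ n, ∀ y ∈ F n, ∃ t ∈ T n, P.Trans [toData n] [toData y] t := by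
  obtain ⟨c, rfl⟩ := Nat.Partrec.Code.exists_code.1 (Partrec.nat_iff.1 hF)
  -- Evaluation with bound `s` is primitive recursive; the search for a sufficient `s` is the only
  -- part that may fail to halt.
  have heval : Primrec₂ fun n s => Nat.Partrec.Code.evaln s c n :=
    (Nat.Partrec.Code.primrec_evaln.comp ((Primrec.snd.pair (Primrec.const c)).pair
      Primrec.fst)).to₂
  -- The test takes values in `ℕ` to fit `PrimTime.of_primrec₂`. The value 0 means that the bound
  -- was too small and that the loop goes on.
  have hsome : Primrec₂ fun n s => cond (Nat.Partrec.Code.evaln s c n).isSome 1 0 :=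
    (Primrec.cond (Primrec.option_isSome.comp heval) (Primrec.const 1) (Primrec.const 0)).to₂
  have htest : PrimTime fun p : ℕ × ℕ =>
      decide (cond (Nat.Partrec.Code.evaln p.2 c p.1).isSome 1 0 = 0) :=
    PrimTime.comp (f := fun n => decide (n = 0)) (PrimTime.of_polyTime
      (Primrec.eq.decide.comp Primrec.id (Primrec.const 0))
      (PolyTime.eq PolyTime.id (PolyTime.const 0))) (PrimTime.of_primrec₂ hsome)
  have hbody : PrimTime fun p : ℕ × ℕ => (p.1, p.2 + 1) :=
    PrimTime.fst.pair (PrimTime.nat_succ.comp PrimTime.snd)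
  have hinit : PrimTime fun n : ℕ => (n, 0) := PrimTime.id.pair (PrimTime.const 0)
  have hout : PrimTime fun p : ℕ × ℕ => (Nat.Partrec.Code.evaln p.2 c p.1).getD 0 :=
    PrimTime.of_primrec₂ (Primrec.option_getD.comp heval (Primrec.const 0)).to₂
  obtain ⟨P, τ, hτ, hP⟩ := PrimTime.exists_while htest hbody
  obtain ⟨hi, P₁, T₁, hT₁, hP₁⟩ := hinit
  obtain ⟨ho, P₂, T₂, hT₂, hP₂⟩ := hout
  have hiter (n k : ℕ) : (fun p : ℕ × ℕ => (p.1, p.2 + 1))^[k] (n, 0) = (n, k) := by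
    induction k with
    | zero => rfl
    | succ k ih => rw [Function.iterate_succ_apply', ih]
  refine ⟨(P₁.seq P).seq P₂, fun n => (Nat.rfind fun s =>
      Part.some (Nat.Partrec.Code.evaln s c n).isSome).map fun s => T₁ n +
      (∑ i ∈ Finset.range (s + 1), τ ((fun p : ℕ × ℕ => (p.1, p.2 + 1))^[i] (n, 0))) + T₂ (n, s),
    ?_, fun n y hy => ?_⟩
  · have hT : Primrec fun p : ℕ × ℕ => T₁ p.1 + (∑ i ∈ Finset.range (p.2 + 1),
        τ ((fun p : ℕ × ℕ => (p.1, p.2 + 1))^[i] (p.1, 0))) + T₂ (p.1, p.2) := ?_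
    · exact Partrec.map (Partrec.rfind
        ((Primrec.option_isSome.comp heval).to_comp.partrec.to₂)) hT.to_comp.to₂
    exact Primrec.nat_add.comp (Primrec.nat_add.comp (hT₁.comp Primrec.fst)
      ((primrec_sum_iterate hτ hbody.1).comp (hi.comp Primrec.fst)
        (Primrec.succ.comp Primrec.snd))) (hT₂.comp Primrec.id)
  · obtain ⟨k, hk⟩ := Nat.Partrec.Code.evaln_complete.1 hy
    obtain ⟨s, hs, -⟩ := Nat.rfind_min' (p := fun s => (Nat.Partrec.Code.evaln s c n).isSome)
      (m := k) (by simp [Option.mem_def.1 hk])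
    refine ⟨_, Part.mem_map _ hs, ?_⟩
    have h1 : (Nat.Partrec.Code.evaln s c n).isSome = true := by
      simpa using Nat.rfind_spec hs
    obtain ⟨y', hy'⟩ := Option.isSome_iff_exists.1 h1
    obtain rfl : y' = y := Part.mem_unique (Nat.Partrec.Code.evaln_sound hy') hy
    have h2 := hP s (n, 0) (fun i hi => ?_) ?_
    · have h3 := hP₂ (n, s)
      rw [hiter] at h2
      simp only [hy', Option.getD_some] at h3
      exact ((hP₁ n).seq h2).seq h3
    · have : false = (Nat.Partrec.Code.evaln i c n).isSome :=
        Part.mem_some_iff.1 (Nat.rfind_min hs hi)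
      simp [hiter, ← this]
    · simp [hiter, h1]

end StackMachine

/-! ### Names of codes -/

namespace StackMachine

open Data Program Coded

theorem encodeNat_two_mul_add_one (n : ℕ) : encodeNat (2 * n + 1) = true :: encodeNat n := by
  induction n with
  | zero => rfl
  | succ n ih =>
    rw [show 2 * (n + 1) + 1 = 2 * n + 1 + 1 + 1 by ring, encodeNat_succ, encodeNat_succ, ih,
      encodeNat_succ]
    rfl

theorem encodeNat_two_mul {n : ℕ} (hn : n ≠ 0) : encodeNat (2 * n) = false :: encodeNat n := by
  obtain ⟨n, rfl⟩ := Nat.exists_eq_succ_of_ne_zero hn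
  rw [show 2 * (n + 1) = 2 * n + 1 + 1 by ring, encodeNat_succ, encodeNat_two_mul_add_one,
    encodeNat_succ]
  rfl

/-- The number with the given binary digits, least significant first. -/
def ofBits (l : List Bool) : ℕ := l.foldr (fun b n => 2 * n + cond b 1 0) 0

theorem ofBits_ne_zero {l : List Bool} (h : true ∈ l) : ofBits l ≠ 0 := by
  induction l with
  | nil => simp at h
  | cons b l ih =>
    cases b
    · have := ih (by simpa using h)
      simpa [ofBits] using this
    · simp [ofBits]

/-- The final `true` is the leading digit; without it leading zeros would be lost. -/
theorem encodeNat_ofBits (l : List Bool) : encodeNat (ofBits (l ++ [true])) = l ++ [true] := by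
  induction l with
  | nil => rfl
  | cons b l ih =>
    cases b
    · refine (encodeNat_two_mul (ofBits_ne_zero (l := l ++ [true]) (by simp))).trans ?_
      rw [ih]
      rfl
    · refine (encodeNat_two_mul_add_one _).trans ?_
      change true :: encodeNat (ofBits (l ++ [true])) = _
      rw [ih]
      rfl

@[simp] theorem Data.bits_nil : bits nil = [true] := rfl

@[simp] theorem Data.bits_pair (x y : Data) : bits (Data.pair x y) = false :: (bits x ++ bits y) := by
  simp [bits, ser]

/-- The prefix notation of a tree ends with a leaf. Read as binary digits it therefore has no
leading zero, and it can be recovered from the number `name a`. -/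
theorem Data.exists_bits (x : Data) : ∃ l, x.bits = l ++ [true] := by
  induction x with
  | nil => exact ⟨[], rfl⟩
  | pair x y _ ih =>
    obtain ⟨l, h⟩ := ih
    exact ⟨false :: (bits x ++ l), by simp [h]⟩

section name

variable {α β : Type*} [Coded α] [Coded β]

/-- A number that names `a`. -/
def name (a : α) : ℕ := ofBits (toData a).bits

theorem encodeNat_name (a : α) : encodeNat (name a) = (toData a).bits := by
  obtain ⟨l, h⟩ := Data.exists_bits (toData a)
  rw [name, h, encodeNat_ofBits]

theorem name_injective : Function.Injective (name : α → ℕ) := fun a b h =>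
  toData_injective (bits_injective (by rw [← encodeNat_name, h, encodeNat_name]))

/-- The tree of the number `name a` is the list of its digits, and this is just what `quote` writes.
Passing to names thus takes linear time. -/
theorem trans_quote_name (a : α) :
    quote.Trans [toData a] [toData (name a)] (11 * sz a + 4) := by
  have : toData (name a) = ofList ofBool (toData a).bits := by
    change toData (encodeNat (name a)) = _
    rw [encodeNat_name]
    rfl
  rw [this]
  exact trans_quote _

theorem trans_unquote_name (a : α) :
    unquote.Trans [toData (name a)] [toData a] (7 * sz a + 2) := by
  have : toData (name a) = ofList ofBool (toData a).bits := by
    change toData (encodeNat (name a)) = _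
    rw [encodeNat_name]
    rfl
  rw [this]
  exact trans_unquote _

theorem PolyTime.name {f : α → β} (hf : PolyTime f) : PolyTime fun a => name (f a) :=
  PolyTime.comp ⟨quote, 11 * Polynomial.X + 4, fun a => by
    simpa using trans_quote_name a⟩ hf

theorem PolyTime.encodeNat {f : α → ℕ} (hf : PolyTime f) : PolyTime fun a => encodeNat (f a) :=
  hf

end name

/-- Types for which the names are primitive recursive. -/
class NamePrimrec (α : Type*) [Primcodable α] [Coded α] : Prop where
  primrec_bits : Primrec fun a : α => (toData a).bits

open NamePrimrec

section NamePrimrec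

variable {α β : Type*} [Primcodable α] [Coded α] [Primcodable β] [Coded β]

theorem primrec_name [NamePrimrec α] : Primrec fun a : α => name a :=
  Primrec.list_foldr primrec_bits (Primrec.const 0) (Primrec.nat_add.comp
    (Primrec.nat_mul.comp (Primrec.const 2) (Primrec.snd.comp Primrec.snd))
    ((Primrec.dom_bool fun b => cond b 1 0).comp (Primrec.fst.comp Primrec.snd))).to₂

instance : NamePrimrec Bool := ⟨Primrec.dom_bool _⟩

instance [NamePrimrec α] [NamePrimrec β] : NamePrimrec (α × β) :=
  ⟨(Primrec.list_cons.comp (Primrec.const false) (Primrec.list_append.comp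
    (primrec_bits.comp Primrec.fst) (primrec_bits.comp Primrec.snd))).of_eq fun p => by
      rw [← Data.bits_pair]; rfl⟩

instance [NamePrimrec α] : NamePrimrec (List α) :=
  ⟨(Primrec.list_foldr Primrec.id (Primrec.const [true]) (Primrec.list_cons.comp
    (Primrec.const false) (Primrec.list_append.comp
      (primrec_bits.comp (Primrec.fst.comp Primrec.snd))
      (Primrec.snd.comp Primrec.snd))).to₂).of_eq fun l => by
      induction l with
      | nil => rfl
      | cons a l ih =>
        rw [toData_cons, Data.bits_pair, ← ih]
        rfl⟩

theorem primrec_binSucc : Primrec binSucc := by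
  have h : Primrec fun x : List Bool × (Bool × List Bool) × Bool =>
      (x.2.1.1 && x.2.2, (x.2.1.1 != x.2.2) :: x.2.1.2) := by
    have h1 : Primrec fun x : List Bool × (Bool × List Bool) × Bool => x.2.1.1 :=
      Primrec.fst.comp (Primrec.fst.comp Primrec.snd)
    have h2 : Primrec fun x : List Bool × (Bool × List Bool) × Bool => x.2.2 :=
      Primrec.snd.comp Primrec.snd
    exact (Primrec.and.comp h1 h2).pair (Primrec.list_cons.comp
      ((Primrec.dom_bool₂ fun a b => a != b).comp h1 h2)
      (Primrec.snd.comp (Primrec.fst.comp Primrec.snd)))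
  have h' := Primrec.list_foldl (h := fun _ x => (x.1.1 && x.2, (x.1.1 != x.2) :: x.1.2))
    (Primrec.id (α := List Bool)) (Primrec.const (true, [])) h.to₂
  exact (Primrec.list_append.comp (Primrec.list_reverse.comp (Primrec.snd.comp h'))
    ((Primrec.dom_bool fun c => cond c [true] []).comp (Primrec.fst.comp h'))).of_eq fun l =>
      foldl_binSucc l true []

theorem primrec_encodeNat : Primrec encodeNat := by
  refine (Primrec.nat_rec₁ [] (primrec_binSucc.comp Primrec.snd).to₂).of_eq fun n => ?_
  induction n with
  | zero => rfl
  | succ n ih => rw [encodeNat_succ, ← ih]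

instance : NamePrimrec ℕ := ⟨(primrec_bits (α := List Bool)).comp primrec_encodeNat⟩

/-- Every partial recursive function between coded types is computed by a program whose running
time is bounded by a partial recursive function. -/
theorem exists_program_of_partrec' [NamePrimrec α] [NamePrimrec β] {F : α →. β} (hF : Partrec F) :
    ∃ (P : Program) (T : α →. ℕ), Partrec T ∧
      ∀ a, ∀ b ∈ F a, ∃ t ∈ T a, P.Trans [toData a] [toData b] t := by
  classical
  -- `find` inverts `name` by unbounded search. It halts on every name, which is all that is needed
  -- to transfer `F` to numbers.
  let find : ℕ →. α := fun n => Nat.rfindOpt fun k =>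
    (Encodable.decode (α := α) k).bind fun a => if name a = n then some a else none
  have hfind : Partrec find := by
    have h : Primrec₂ fun (n k : ℕ) => (Encodable.decode (α := α) k).bind fun a =>
        if name a = n then some a else none := by
      refine Primrec.option_bind (Primrec.decode.comp Primrec.snd) ?_
      exact (Primrec.ite (Primrec.eq.comp (primrec_name.comp Primrec.snd)
        (Primrec.fst.comp Primrec.fst)) (Primrec.option_some.comp Primrec.snd)
        (Primrec.const none)).to₂
    exact Partrec.rfindOpt h.to_comp
  have mem_find (a : α) : a ∈ find (name a) := by
    have hd : (find (name a)).Dom := Nat.rfindOpt_dom.2 ⟨Encodable.encode a, a, by simp⟩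
    obtain ⟨k, hk⟩ := Nat.rfindOpt_spec (Part.get_mem hd)
    have h : (find (name a)).get hd = a := by
      obtain ⟨b, -, hb⟩ := Option.bind_eq_some_iff.1 (Option.mem_def.1 hk)
      split_ifs at hb with h
      · rw [← Option.some_inj.1 hb]
        exact name_injective h
    have hm := Part.get_mem hd
    rwa [h] at hm
  obtain ⟨P, T, hT, hP⟩ := exists_program_of_partrec
    (F := fun n => (find n).bind fun a => (F a).map name)
    (hfind.bind ((hF.comp Computable.snd).map (primrec_name.to_comp.comp Computable.snd).to₂).to₂)
  obtain ⟨B, hB, hB'⟩ : ∃ B : β → ℕ, Primrec B ∧ ∀ b, sz b ≤ B b :=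
    ⟨fun b => (toData b).bits.length, Primrec.list_length.comp primrec_bits, fun b => by
      simp [sz, Data.size, bits]⟩
  have hB₂ : ∃ A : α → ℕ, Primrec A ∧ ∀ a, sz a ≤ A a :=
    ⟨fun b => (toData b).bits.length, Primrec.list_length.comp primrec_bits, fun b => by
      simp [sz, Data.size, bits]⟩
  obtain ⟨A, hA, hA'⟩ := hB₂
  refine ⟨(quote.seq P).seq unquote, fun a => (T (name a)).bind fun t => (F a).map fun b =>
    11 * A a + 4 + t + (7 * B b + 2), ?_, fun a b hb => ?_⟩
  · have h : Primrec fun x : (α × ℕ) × β => 11 * A x.1.1 + 4 + x.1.2 + (7 * B x.2 + 2) := ?_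
    · exact (hT.comp primrec_name.to_comp).bind (Partrec.map (hF.comp Computable.fst)
        h.to_comp.to₂).to₂
    exact Primrec.nat_add.comp (Primrec.nat_add.comp (Primrec.nat_add.comp (Primrec.nat_mul.comp
      (Primrec.const 11) (hA.comp (Primrec.fst.comp Primrec.fst))) (Primrec.const 4))
      (Primrec.snd.comp Primrec.fst)) (Primrec.nat_add.comp (Primrec.nat_mul.comp
      (Primrec.const 7) (hB.comp Primrec.snd)) (Primrec.const 2))
  · obtain ⟨t, ht, h⟩ := hP (name a) (name b)
      (Part.mem_bind (mem_find a) (Part.mem_map _ hb))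
    refine ⟨_, Part.mem_bind ht (Part.mem_map _ hb), ?_⟩
    refine (((trans_quote_name a).seq h).seq (trans_unquote_name b)).mono ?_
    have := hA' a
    have := hB' b
    omega

end NamePrimrec

/-- A recursively enumerable relation has a partial recursive choice function. -/
theorem exists_partrec_choice {α β : Type*} [Primcodable α] [Primcodable β] {R : α × β → Prop}
    (hR : REPred R) : ∃ F : α →. β, Partrec F ∧ (∀ a, ∀ b ∈ F a, R (a, b)) ∧
      ∀ a b, R (a, b) → (F a).Dom := by
  obtain ⟨c, hc⟩ := Nat.Partrec.Code.exists_code.1 hR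
  have hdom (p : α × β) : ((c.eval (Encodable.encode p)).Dom) ↔ R p := by
    rw [hc]
    simp [Part.assert, Part.bind, Part.map]
  -- Dovetailing: `k` stands for a candidate `b` together with an evaluation bound within which `R
  -- (a, b)` has to be confirmed.
  refine ⟨fun a => Nat.rfindOpt fun k => (Encodable.decode (α := β) k.unpair.1).bind fun b =>
    (Nat.Partrec.Code.evaln k.unpair.2 c (Encodable.encode (a, b))).map fun _ => b,
    ?_, fun a b hb => ?_, fun a b hab => ?_⟩
  · have h : Primrec₂ fun (a : α) (k : ℕ) => (Encodable.decode (α := β) k.unpair.1).bind fun b =>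
        (Nat.Partrec.Code.evaln k.unpair.2 c (Encodable.encode (a, b))).map fun _ => b := ?_
    · exact Partrec.rfindOpt h.to_comp
    refine Primrec.option_bind (Primrec.decode.comp
      (Primrec.fst.comp (Primrec.unpair.comp Primrec.snd))) ?_
    have h : Primrec fun x : (α × ℕ) × β =>
        Nat.Partrec.Code.evaln x.1.2.unpair.2 c (Encodable.encode (x.1.1, x.2)) :=
      Nat.Partrec.Code.primrec_evaln.comp
        (((Primrec.snd.comp (Primrec.unpair.comp (Primrec.snd.comp Primrec.fst))).pair
          (Primrec.const c)).pair (Primrec.encode.comp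
            ((Primrec.fst.comp Primrec.fst).pair Primrec.snd)))
    exact (Primrec.option_map h (Primrec.snd.comp Primrec.fst).to₂).to₂
  · obtain ⟨k, hk⟩ := Nat.rfindOpt_spec hb
    obtain ⟨b', -, hb'⟩ := Option.bind_eq_some_iff.1 (Option.mem_def.1 hk)
    obtain ⟨x, hx, rfl⟩ := Option.map_eq_some_iff.1 hb'
    exact (hdom _).1 (Part.dom_iff_mem.2 ⟨x, Nat.Partrec.Code.evaln_sound hx⟩)
  · obtain ⟨x, hx⟩ := Part.dom_iff_mem.1 ((hdom _).2 hab)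
    obtain ⟨k, hk⟩ := Nat.Partrec.Code.evaln_complete.1 hx
    refine Nat.rfindOpt_dom.2 ⟨Nat.pair (Encodable.encode b) k, b, ?_⟩
    rw [Option.mem_def, Nat.unpair_pair]
    simp only [Encodable.encodek, Option.bind_some, Option.mem_def.1 hk, Option.map_some]

end StackMachine

/-! ### Reading and writing instances -/

namespace StackMachine

open Data Coded

instance : Coded RelAtom where
  toData a := toData (a.rel, a.args)
  toData_injective a b h := by
    have := toData_injective h
    simp only [Prod.mk.injEq] at this
    exact RelAtom.ext this.1 this.2

/-- The state of the parser, which reads a string from the right: the atoms of the part that is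
being read, the atoms of the part that has been read, whether an atom is being read, and the
numbers of this atom. -/
abbrev ParserState :=
  (List (List Bool × List (List Bool)) × List (List Bool × List (List Bool))) ×
    Bool × List (List Bool)

/-- Read one symbol. -/
def parseSymbol (s : Γ') (x : ParserState) : ParserState :=
  if s = .ket then (x.1, true, [])
  else if s = .bra then (((x.2.2.headD [], x.2.2.tail) :: x.1.1, x.1.2), false, [])
  else if s = .comma then cond x.2.1 (x.1, true, [] :: x.2.2) (([], x.1.1), false, [])
  else (x.1, x.2.1, (decide (s = .bit true) :: x.2.2.headD []) :: x.2.2.tail)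

/-- Read a string. -/
def parse (w : List Γ') :
    List (List Bool × List (List Bool)) × List (List Bool × List (List Bool)) :=
  (w.foldr parseSymbol (([], []), false, [])).1

/-- An atom with its numbers in binary notation. -/
def rawAtom (a : RelAtom) : List Bool × List (List Bool) := (encodeNat a.rel, a.args.map encodeNat)

theorem parse_nat (n : ℕ) (w : List Γ') (x y : List (List Bool × List (List Bool)))
    (l : List (List Bool))
    (h : w.foldr parseSymbol (([], []), false, []) = ((x, y), true, l)) :
    (encodeNatStr n ++ w).foldr parseSymbol (([], []), false, []) =
      ((x, y), true, encodeNat n :: l) := by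
  have : ∀ b : List Bool, (b.map Γ'.bit ++ [Γ'.comma]).foldr parseSymbol ((x, y), true, l) =
      ((x, y), true, b :: l) := by
    intro b
    induction b with
    | nil => rfl
    | cons b₀ b ih =>
      rw [List.map_cons, List.cons_append, List.foldr_cons, ih]
      cases b₀ <;> rfl
  rw [List.foldr_append, h]
  exact this _

/-- The symbol `ket`, which is met first when reading from the right, resets the last two components
of the state. Hence `c` and `l` are arbitrary. -/
theorem parse_atom (a : RelAtom) (w : List Γ') (x y : List (List Bool × List (List Bool)))
    (c : Bool) (l : List (List Bool))
    (h : w.foldr parseSymbol (([], []), false, []) = ((x, y), c, l)) :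
    (encodeAtomStr a ++ w).foldr parseSymbol (([], []), false, []) =
      ((rawAtom a :: x, y), false, []) := by
  have h1 : (Γ'.ket :: w).foldr parseSymbol (([], []), false, []) = ((x, y), true, []) := by
    rw [List.foldr_cons, h]
    rfl
  have h2 : ∀ b : List ℕ, (b.flatMap encodeNatStr ++ Γ'.ket :: w).foldr parseSymbol
      (([], []), false, []) = ((x, y), true, b.map encodeNat) := by
    intro b
    induction b with
    | nil => exact h1
    | cons n b ih =>
      rw [List.flatMap_cons, List.append_assoc]
      exact parse_nat n _ _ _ _ ih
  have h3 := parse_nat a.rel _ _ _ _ (h2 a.args)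
  simp only [encodeAtomStr, List.cons_append, List.append_assoc, List.foldr_cons] at h3 ⊢
  simp only [List.nil_append, List.foldr_append] at h3 ⊢
  rw [h3]
  rfl

theorem parse_atoms (q : List RelAtom) (w : List Γ') (y : List (List Bool × List (List Bool)))
    (h : w.foldr parseSymbol (([], []), false, []) = (([], y), false, [])) :
    (q.flatMap encodeAtomStr ++ w).foldr parseSymbol (([], []), false, []) =
      ((q.map rawAtom, y), false, []) := by
  induction q with
  | nil => exact h
  | cons a q ih =>
    rw [List.flatMap_cons, List.append_assoc]
    exact parse_atom a _ _ _ _ _ ih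

theorem parse_encodeInstStr (x : ConjQuery × Database) :
    parse (encodeInstStr x) = (x.1.map rawAtom, x.2.map rawAtom) := by
  have h1 : (x.2.flatMap encodeAtomStr).foldr parseSymbol (([], []), false, []) =
      ((x.2.map rawAtom, []), false, []) := by
    simpa using parse_atoms x.2 [] [] rfl
  -- A comma outside an atom closes the database: the atoms read so far move to the second
  -- component.
  have h2 := parse_atoms x.1 (.comma :: x.2.flatMap encodeAtomStr) (x.2.map rawAtom) (by
    rw [List.foldr_cons, h1]
    rfl)
  rw [parse, encodeInstStr, h2]

theorem toData_map {α β : Type*} [Coded α] [Coded β] {f : α → β}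
    (h : ∀ a, toData (f a) = toData a) (l : List α) : toData (l.map f) = toData l := by
  induction l with
  | nil => rfl
  | cons a l ih => rw [List.map_cons, toData_cons, toData_cons, h, ih]

theorem toData_rawAtom (a : RelAtom) : toData (rawAtom a) = toData a := by
  change Data.pair _ (toData (a.args.map encodeNat)) = Data.pair _ (toData a.args)
  rw [toData_map (f := encodeNat) fun n => rfl]
  rfl

/-- The parser keeps numbers as digit lists, which have the same trees as the numbers. Its output is
therefore already the tree of the instance. -/
theorem toData_parse (x : ConjQuery × Database) : toData (parse (encodeInstStr x)) = toData x := by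
  rw [parse_encodeInstStr, toData_mk, toData_map toData_rawAtom, toData_map toData_rawAtom]
  rfl

namespace PolyTime

variable {α β : Type*} [Coded α] [Coded β]

theorem parse : PolyTime parse := by
  have h1 : PolyTime fun x : List Γ' × Γ' × ParserState => x.2.1 := fst.comp snd
  have h2 : PolyTime fun x : List Γ' × Γ' × ParserState => x.2.2.1 :=
    fst.comp (snd.comp snd)
  have h3 : PolyTime fun x : List Γ' × Γ' × ParserState => x.2.2.2.1 :=
    fst.comp (snd.comp (snd.comp snd))
  have h4 : PolyTime fun x : List Γ' × Γ' × ParserState => x.2.2.2.2 :=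
    snd.comp (snd.comp (snd.comp snd))
  have h : PolyTime fun x : List Γ' × Γ' × ParserState => parseSymbol x.2.1 x.2.2 := by
    unfold parseSymbol
    refine PolyTime.ite (eq h1 (const _)) (h2.pair (const _)) (PolyTime.ite (eq h1 (const _)) ?_
      (PolyTime.ite (eq h1 (const _)) (h3.cond ?_ ?_) ?_))
    · exact ((list_cons ((list_headD [] h4).pair (list_tail h4)) (fst.comp h2)).pair
        (snd.comp h2)).pair (const _)
    · exact h2.pair ((const _).pair (list_cons (const _) h4))
    · exact ((const _).pair (fst.comp h2)).pair (const _)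
    · exact h2.pair (h3.pair (list_cons (list_cons (eq h1 (const _)) (list_headD [] h4))
        (list_tail h4)))
  refine fst.comp (foldr PolyTime.id (const (([], []), false, [])) h ⟨20, fun w s x => ?_⟩)
  obtain ⟨⟨x₁, x₂⟩, c, l⟩ := x
  have h5 : sz (l.headD []) + sz l.tail ≤ sz l + 1 := by cases l <;> simp; omega
  have h6 := sz_bool_le (decide (s = .bit true))
  have h7 : sz true = 3 := rfl
  have h8 : sz false = 1 := rfl
  simp only [parseSymbol, Polynomial.eval_ofNat]
  split_ifs
  · simp only [sz_mk, sz_nil]; omega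
  · simp only [sz_mk, sz_nil, sz_cons]; omega
  · cases c <;> simp only [cond_true, cond_false, sz_mk, sz_nil, sz_cons] <;> omega
  · simp only [sz_mk, sz_cons]; omega

theorem encodeNatStr {f : α → ℕ} (hf : PolyTime f) : PolyTime fun a => encodeNatStr (f a) := by
  have h : PolyTime fun x : α × Bool => Γ'.bit x.2 :=
    (PolyTime.cond snd (const (Γ'.bit true)) (const (Γ'.bit false))).of_eq fun x => by
      cases x.2 <;> rfl
  exact (list_append (list_map hf.encodeNat h) (const [Γ'.comma])).of_eq fun _ => rfl

theorem relAtom_rel : PolyTime RelAtom.rel := by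
  obtain ⟨P, p, hP⟩ := fst (α := ℕ) (β := List ℕ)
  exact ⟨P, p, fun a => hP (a.rel, a.args)⟩

theorem relAtom_args : PolyTime RelAtom.args := by
  obtain ⟨P, p, hP⟩ := snd (α := ℕ) (β := List ℕ)
  exact ⟨P, p, fun a => hP (a.rel, a.args)⟩

theorem relAtom_mk {f : α → ℕ} {g : α → List ℕ} (hf : PolyTime f) (hg : PolyTime g) :
    PolyTime fun a => RelAtom.mk (f a) (g a) := by
  obtain ⟨P, p, hP⟩ := hf.pair hg
  exact ⟨P, p, fun a => hP a⟩

theorem encodeAtomStr {f : α → RelAtom} (hf : PolyTime f) :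
    PolyTime fun a => encodeAtomStr (f a) := by
  have h : PolyTime fun x : α × ℕ => _root_.encodeNatStr x.2 := encodeNatStr snd
  exact (list_cons (const Γ'.bra) (list_append (encodeNatStr (relAtom_rel.comp hf)) (list_append
    (list_flatMap (relAtom_args.comp hf) h) (const [Γ'.ket])))).of_eq fun _ => rfl

theorem encodeInstStr {f g : α → List RelAtom} (hf : PolyTime f) (hg : PolyTime g) :
    PolyTime fun a => encodeInstStr (f a, g a) := by
  have h : PolyTime fun x : α × RelAtom => _root_.encodeAtomStr x.2 := encodeAtomStr snd
  exact (list_append (list_flatMap hf h) (list_cons (const Γ'.comma) (list_flatMap hg h))).of_eq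
    fun _ => rfl

end PolyTime

/-! ### The reduction -/

/-- The characteristic list of the set of elements of `l` with respect to the list `V`. -/
def mask (V l : List ℕ) : List Bool := V.map fun v => decide (v ∈ l)

/-- The elements of `V` at the positions that are marked in `L`. -/
def select (V : List ℕ) (L : List Bool) : List ℕ := ((V.zip L).filter fun p => p.2).map Prod.fst

/-- The variables of a query. -/
def vars (q : ConjQuery) : List ℕ := (q.flatMap fun a => a.args).dedup

/-- The hypergraph of a query as a list of characteristic lists. -/
def masks (q : ConjQuery) : List (List Bool) := (q.map fun a => mask (vars q) a.args).dedup

/-- The constant that the tuple `d` assigns to the variable `u` of the atom `a`. -/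
def value (a d : RelAtom) (u : ℕ) : ℕ :=
  (((a.args.zip d.args).filter fun p => decide (p.1 = u)).map Prod.snd).headD 0

/-- The tuple `d` is an instance of the atom `a`. -/
def Matches (a d : RelAtom) : Prop := a.rel = d.rel ∧ d.args = a.args.map (value a d)

instance (a d : RelAtom) : Decidable (Matches a d) := inferInstanceAs (Decidable (_ ∧ _))

/-- A blueprint lists the edges of a hypergraph `H`. An edge has a target, which is a characteristic
list of an edge of the hypergraph of a query, and it lists its vertices. Every vertex has a
characteristic list of vertices of the hypergraph of the query. -/
abbrev Blueprint := List (List Bool × List (ℕ × List Bool))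

/-- The atom for an atom `a` and an edge `e` with target `a`. -/
def newAtom (a : RelAtom) (e : List Bool × List (ℕ × List Bool)) : RelAtom :=
  ⟨name (a, e), e.2.map Prod.fst⟩

/-- The tuple for an atom `a`, an edge `e` with target `a` and an instance `d` of `a`. -/
def newTuple (V : List ℕ) (a : RelAtom) (e : List Bool × List (ℕ × List Bool)) (d : RelAtom) :
    RelAtom :=
  ⟨name (a, e), e.2.map fun p => name ((select V p.2).map (value a d))⟩

/-- The edges of a blueprint with target `a`. -/
def edgesAt (V : List ℕ) (r : Blueprint) (a : RelAtom) : Blueprint :=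
  r.filter fun e => decide (e.1 = mask V a.args)

/-- The query of the reduction. -/
def newQuery (q : ConjQuery) (r : Blueprint) : ConjQuery :=
  q.flatMap fun a => (edgesAt (vars q) r a).map (newAtom a)

/-- The database of the reduction. -/
def newDatabase (q : ConjQuery) (D : Database) (r : Blueprint) : Database :=
  q.flatMap fun a => (edgesAt (vars q) r a).flatMap fun e =>
    (D.filter fun d => decide (Matches a d)).map (newTuple (vars q) a e)

/-! ### The reduction map takes polynomial time. -/

namespace PolyTime

variable {α β : Type*} [Coded α] [Coded β]

theorem list_dedup [DecidableEq β] {f : α → List β} (hf : PolyTime f) :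
    PolyTime fun a => (f a).dedup := by
  have h : PolyTime fun x : α × β × List β => if x.2.1 ∈ x.2.2 then x.2.2 else x.2.1 :: x.2.2 :=
    PolyTime.ite (list_mem (fst.comp snd) (snd.comp snd)) (snd.comp snd)
      (list_cons (fst.comp snd) (snd.comp snd))
  refine (foldr hf (const []) h ⟨Polynomial.X + 1, fun a b s => ?_⟩).of_eq fun a => ?_
  · simp only
    split_ifs <;> simp; omega
  · induction f a with
    | nil => rfl
    | cons b l ih =>
      rw [List.foldr_cons, ih]
      by_cases hb : b ∈ l
      · rw [List.dedup_cons_of_mem hb, if_pos (List.mem_dedup.2 hb)]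
      · rw [List.dedup_cons_of_notMem hb, if_neg (by rwa [List.mem_dedup])]

theorem mask {f g : α → List ℕ} (hf : PolyTime f) (hg : PolyTime g) :
    PolyTime fun a => mask (f a) (g a) := by
  have h : PolyTime fun x : α × ℕ => decide (x.2 ∈ g x.1) := list_mem snd (hg.comp fst)
  exact (list_map hf h).of_eq fun _ => rfl

theorem select {f : α → List ℕ} {g : α → List Bool} (hf : PolyTime f) (hg : PolyTime g) :
    PolyTime fun a => select (f a) (g a) := by
  have h : PolyTime fun x : α × ℕ × Bool => x.2.2 := snd.comp snd
  have h' : PolyTime fun x : α × ℕ × Bool => x.2.1 := fst.comp snd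
  exact (list_map (list_filter (list_zip hf hg) h) h').of_eq fun _ => rfl

theorem vars {f : α → ConjQuery} (hf : PolyTime f) : PolyTime fun a => vars (f a) := by
  have h : PolyTime fun x : α × RelAtom => x.2.args := relAtom_args.comp snd
  exact (list_dedup (list_flatMap hf h)).of_eq fun _ => rfl

theorem masks {f : α → ConjQuery} (hf : PolyTime f) : PolyTime fun a => masks (f a) := by
  have h : PolyTime fun x : α × RelAtom => StackMachine.mask (StackMachine.vars (f x.1)) x.2.args :=
    mask (vars (hf.comp fst)) (relAtom_args.comp snd)
  exact (list_dedup (list_map hf h)).of_eq fun _ => rfl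

theorem value {f g : α → RelAtom} {h : α → ℕ} (hf : PolyTime f) (hg : PolyTime g)
    (hh : PolyTime h) : PolyTime fun a => value (f a) (g a) (h a) := by
  have h₁ : PolyTime fun x : α × ℕ × ℕ => decide (x.2.1 = h x.1) :=
    eq (fst.comp snd) (hh.comp fst)
  have h₂ : PolyTime fun x : α × ℕ × ℕ => x.2.2 := snd.comp snd
  exact (list_headD 0 (list_map (list_filter (list_zip (relAtom_args.comp hf)
    (relAtom_args.comp hg)) h₁) h₂)).of_eq fun _ => rfl

theorem decide_matches {f g : α → RelAtom} (hf : PolyTime f) (hg : PolyTime g) :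
    PolyTime fun a => decide (Matches (f a) (g a)) := by
  have h : PolyTime fun x : α × ℕ => StackMachine.value (f x.1) (g x.1) x.2 :=
    value (hf.comp fst) (hg.comp fst) snd
  refine ((eq (relAtom_rel.comp hf) (relAtom_rel.comp hg)).and
    (eq (relAtom_args.comp hg) (list_map (relAtom_args.comp hf) h))).of_eq fun a => ?_
  rw [Bool.eq_iff_iff, Bool.and_eq_true, decide_eq_true_iff, decide_eq_true_iff,
    decide_eq_true_iff]
  rfl

theorem newAtom {f : α → RelAtom} {g : α → List Bool × List (ℕ × List Bool)} (hf : PolyTime f)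
    (hg : PolyTime g) : PolyTime fun a => newAtom (f a) (g a) := by
  have h : PolyTime fun x : α × ℕ × List Bool => x.2.1 := fst.comp snd
  exact (relAtom_mk (name (hf.pair hg)) (list_map (snd.comp hg) h)).of_eq fun _ => rfl

theorem newTuple {k : α → List ℕ} {f h : α → RelAtom} {g : α → List Bool × List (ℕ × List Bool)}
    (hk : PolyTime k) (hf : PolyTime f) (hg : PolyTime g) (hh : PolyTime h) :
    PolyTime fun a => newTuple (k a) (f a) (g a) (h a) := by
  have h₁ : PolyTime fun y : (α × ℕ × List Bool) × ℕ =>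
      StackMachine.value (f y.1.1) (h y.1.1) y.2 :=
    value (hf.comp (fst.comp fst)) (hh.comp (fst.comp fst)) snd
  have h₂ : PolyTime fun x : α × ℕ × List Bool => StackMachine.select (k x.1) x.2.2 :=
    select (hk.comp fst) (snd.comp snd)
  exact (relAtom_mk (name (hf.pair hg)) (list_map (snd.comp hg)
    (name (list_map h₂ h₁)))).of_eq fun _ => rfl

theorem edgesAt {k : α → List ℕ} {f : α → Blueprint} {g : α → RelAtom} (hk : PolyTime k)
    (hf : PolyTime f) (hg : PolyTime g) : PolyTime fun a => edgesAt (k a) (f a) (g a) := by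
  have h : PolyTime fun x : α × List Bool × List (ℕ × List Bool) =>
      decide (x.2.1 = StackMachine.mask (k x.1) (g x.1).args) :=
    eq (fst.comp snd) (mask (hk.comp fst) (relAtom_args.comp (hg.comp fst)))
  exact (list_filter hf h).of_eq fun _ => rfl

theorem newQuery {f : α → ConjQuery} {g : α → Blueprint} (hf : PolyTime f) (hg : PolyTime g) :
    PolyTime fun a => newQuery (f a) (g a) := by
  have h₁ : PolyTime fun x : α × RelAtom =>
      StackMachine.edgesAt (StackMachine.vars (f x.1)) (g x.1) x.2 :=
    edgesAt (vars (hf.comp fst)) (hg.comp fst) snd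
  have h₂ : PolyTime fun y : (α × RelAtom) × List Bool × List (ℕ × List Bool) =>
      StackMachine.newAtom y.1.2 y.2 := newAtom (snd.comp fst) snd
  exact (list_flatMap hf (list_map h₁ h₂)).of_eq fun _ => rfl

theorem newDatabase {f : α → ConjQuery} {h : α → Database} {g : α → Blueprint} (hf : PolyTime f)
    (hh : PolyTime h) (hg : PolyTime g) : PolyTime fun a => newDatabase (f a) (h a) (g a) := by
  have h₁ : PolyTime fun x : α × RelAtom =>
      StackMachine.edgesAt (StackMachine.vars (f x.1)) (g x.1) x.2 :=
    edgesAt (vars (hf.comp fst)) (hg.comp fst) snd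
  have h₂ : PolyTime fun z : ((α × RelAtom) × List Bool × List (ℕ × List Bool)) × RelAtom =>
      decide (Matches z.1.1.2 z.2) := decide_matches (snd.comp (fst.comp fst)) snd
  have h₃ : PolyTime fun z : ((α × RelAtom) × List Bool × List (ℕ × List Bool)) × RelAtom =>
      StackMachine.newTuple (StackMachine.vars (f z.1.1.1)) z.1.1.2 z.1.2 z.2 :=
    newTuple (vars (hf.comp (fst.comp (fst.comp fst)))) (snd.comp (fst.comp fst))
      (snd.comp fst) snd
  have h₄ : PolyTime fun y : (α × RelAtom) × List Bool × List (ℕ × List Bool) => h y.1.1 :=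
    hh.comp (fst.comp fst)
  exact (list_flatMap hf (list_flatMap h₁ (list_map (list_filter h₄ h₂) h₃))).of_eq fun _ => rfl

end PolyTime

end StackMachine

/-! ### Correctness of the reduction -/

namespace StackMachine

theorem mem_select {V : List ℕ} {L : List Bool} {u : ℕ} :
    u ∈ select V L ↔ ∃ j : ℕ, V[j]? = some u ∧ L[j]? = some true := by
  have : u ∈ select V L ↔ (u, true) ∈ V.zip L := by simp [select]
  rw [this, List.mem_iff_getElem?]
  simp only [List.getElem?_zip_eq_some]

theorem getElem?_mask_eq_some_true {V l : List ℕ} {j : ℕ} :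
    (mask V l)[j]? = some true ↔ ∃ v, V[j]? = some v ∧ v ∈ l := by
  simp [mask]

theorem mem_vars {q : ConjQuery} {u : ℕ} : u ∈ vars q ↔ ∃ a ∈ q, u ∈ a.args := by
  simp [vars]

theorem mem_masks {q : ConjQuery} {F : List Bool} :
    F ∈ masks q ↔ ∃ a ∈ q, mask (vars q) a.args = F := by
  simp [masks]

theorem mem_edgesAt {V : List ℕ} {r : Blueprint} {a : RelAtom}
    {e : List Bool × List (ℕ × List Bool)} :
    e ∈ edgesAt V r a ↔ e ∈ r ∧ e.1 = mask V a.args := by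
  simp [edgesAt]

/-- The subsets of a list. -/
def subsets {α : Type*} (l : List α) : List (List α) :=
  l.foldr (fun a s => s ++ s.map (a :: ·)) [[]]

theorem filter_mem_subsets {α : Type*} (p : α → Bool) (l : List α) : l.filter p ∈ subsets l := by
  induction l with
  | nil => simp [subsets]
  | cons a l ih =>
    simp only [subsets, List.foldr_cons] at ih ⊢
    rw [List.filter_cons]
    split_ifs
    · exact List.mem_append_right _ (List.mem_map_of_mem ih)
    · exact List.mem_append_left _ ih

namespace Blueprint

/-- The presentation of the hypergraph of a blueprint. -/
def presentation (r : Blueprint) : List ℕ × List (List ℕ) :=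
  (r.flatMap fun e => e.2.map Prod.fst, r.map fun e => e.2.map Prod.fst)

/-- The list `X` of edges contains with an edge all edges that have target `F` and share with it a
vertex whose characteristic list is `F`. -/
def Closed (r : Blueprint) (F : List Bool) (X : Blueprint) : Prop :=
  ∀ e ∈ X, ∀ e' ∈ r, e'.1 = F → (∃ p ∈ e.2, p ∈ e'.2 ∧ p.2 = F) → e' ∈ X

/-- The edges of the blueprint represent the edges in the list `c`, and the `j`-th vertex can be
read off at the vertex `s[j]` of the blueprint. -/
structure Represents (r : Blueprint) (c : List (List Bool)) (s : List ℕ) : Prop where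
  target_mem : ∀ e ∈ r, e.1 ∈ c
  subset_target : ∀ e ∈ r, ∀ p ∈ e.2, ∀ j < p.2.length, p.2[j]? = some true → e.1[j]? = some true
  label_unique : ∀ e ∈ r, ∀ p ∈ e.2, ∀ e' ∈ r, ∀ p' ∈ e'.2, p.1 = p'.1 → p.2 = p'.2
  exists_edge : ∀ F ∈ c, ∃ e₀ ∈ r, e₀.1 = F ∧ ∀ j < F.length, F[j]? = some true →
    ∀ X ∈ subsets r, e₀ ∈ X → Closed r F X →
      ∃ e ∈ X, ∃ p ∈ e.2, s[j]? = some p.1 ∧ p.2[j]? = some true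

end Blueprint

open Blueprint

variable {q : ConjQuery} {D : Database} {r : Blueprint} {s : List ℕ}

/-- The target of an edge of the blueprint belongs to some atom of `q`, so every edge occurs in the
new query. Several atoms with the same target only repeat the edge. -/
theorem isPresentedBy_newQuery (h : ∀ e ∈ r, e.1 ∈ masks q) :
    (newQuery q r).hypergraph.IsPresentedBy r.presentation := by
  have key (e) (he : e ∈ r) : ∃ a ∈ q, newAtom a e ∈ newQuery q r := by
    obtain ⟨a, ha, hae⟩ := mem_masks.1 (h e he)
    exact ⟨a, ha, List.mem_flatMap.2 ⟨a, ha,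
      List.mem_map_of_mem (mem_edgesAt.2 ⟨he, hae.symm⟩)⟩⟩
  have key' (b) (hb : b ∈ newQuery q r) : ∃ e ∈ r, b.args = e.2.map Prod.fst := by
    obtain ⟨a, -, hb⟩ := List.mem_flatMap.1 hb
    obtain ⟨e, he, rfl⟩ := List.mem_map.1 hb
    exact ⟨e, (mem_edgesAt.1 he).1, rfl⟩
  constructor
  · ext w
    constructor
    · rintro ⟨b, hb, hw⟩
      obtain ⟨e, he, hbe⟩ := key' b hb
      exact List.mem_flatMap.2 ⟨e, he, hbe ▸ hw⟩
    · intro hw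
      obtain ⟨e, he, hw⟩ := List.mem_flatMap.1 hw
      obtain ⟨a, -, ha⟩ := key e he
      exact ⟨_, ha, hw⟩
  · ext f
    constructor
    · rintro ⟨b, hb, rfl⟩
      obtain ⟨e, he, hbe⟩ := key' b hb
      exact ⟨b.args, hbe ▸ List.mem_map_of_mem he, rfl⟩
    · rintro ⟨l, hl, rfl⟩
      obtain ⟨e, he, rfl⟩ := List.mem_map.1 hl
      obtain ⟨a, -, ha⟩ := key e he
      exact ⟨_, ha, rfl⟩

/-- `value` looks at the first occurrence of `u` in `a`; in a tuple that comes from an assignment,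
all occurrences agree. -/
theorem value_map (a : RelAtom) (ν : ℕ → ℕ) {u : ℕ} (hu : u ∈ a.args) :
    value a ⟨a.rel, a.args.map ν⟩ u = ν u := by
  obtain ⟨R, l⟩ := a
  rw [value]
  induction l with
  | nil => simp at hu
  | cons v l ih =>
    by_cases h : v = u
    · simp [h]
    · have hu' : u ∈ l := by simpa [Ne.symm h] using hu
      simpa [h] using ih hu'

theorem isSolution_newQuery_of_isSolution (hr : r.Represents (masks q) s) {ν : ℕ → ℕ}
    (hν : q.IsSolution D ν) : ∃ ν', (newQuery q r).IsSolution (newDatabase q D r) ν' := by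
  classical
  -- The new variable `w` stores the restriction of `ν` to its label. By `label_unique` the chosen
  -- label does not depend on the edge; numbers that are not vertices get the irrelevant value 0.
  let ν' : ℕ → ℕ := fun w =>
    if h : ∃ L, ∃ e ∈ r, (w, L) ∈ e.2 then name ((select (vars q) h.choose).map ν) else 0
  have hν' (e) (he : e ∈ r) (p) (hp : p ∈ e.2) : ν' p.1 = name ((select (vars q) p.2).map ν) := by
    have h : ∃ L, ∃ e ∈ r, (p.1, L) ∈ e.2 := ⟨p.2, e, he, hp⟩
    obtain ⟨e', he', hp'⟩ := h.choose_spec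
    simp only [ν', dif_pos h]
    rw [hr.label_unique e he p hp e' he' _ hp' rfl]
  refine ⟨ν', fun b hb => ?_⟩
  obtain ⟨a, ha, hb⟩ := List.mem_flatMap.1 hb
  obtain ⟨e, he, rfl⟩ := List.mem_map.1 hb
  obtain ⟨her, hea⟩ := mem_edgesAt.1 he
  refine List.mem_flatMap.2 ⟨a, ha, List.mem_flatMap.2 ⟨e, he, List.mem_map.2
    ⟨⟨a.rel, a.args.map ν⟩, List.mem_filter.2 ⟨hν a ha, ?_⟩, ?_⟩⟩⟩
  · simp only [decide_eq_true_iff]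
    exact ⟨rfl, List.map_congr_left fun u hu => (value_map a ν hu).symm⟩
  · simp only [newTuple, newAtom, List.map_map]
    congr 1
    refine List.map_congr_left fun p hp => ?_
    rw [Function.comp_apply, hν' e her p hp]
    congr 1
    refine List.map_congr_left fun u hu => value_map a ν ?_
    -- Labels are contained in targets, so the variable `u` really occurs in `a`.
    obtain ⟨j, hj, hpj⟩ := mem_select.1 hu
    have := hr.subset_target e her p hp j (List.getElem?_eq_some_iff.1 hpj).1 hpj
    rw [hea, getElem?_mask_eq_some_true] at this
    obtain ⟨v, hv, hva⟩ := this
    rw [hj, Option.some_inj] at hv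
    exact hv ▸ hva

/-- A solution of the new query selects a tuple for every atom `a` and every edge over it. Edges
sharing a vertex with the full label of `a` select tuples that agree on the variables of `a`,
because that vertex stores all their values. Chains of such edges reach the places where the
variables of `a` are read off, so the tuple of the starting edge `e₀` is the image of `a`. -/
theorem isSolution_of_isSolution_newQuery (hr : r.Represents (masks q) s) {ν' : ℕ → ℕ}
    (hν' : (newQuery q r).IsSolution (newDatabase q D r) ν') : ∃ ν, q.IsSolution D ν := by
  classical
  set V := vars q with hV
  have h1 : ∀ a ∈ q, ∀ e ∈ edgesAt V r a, ∃ d ∈ D, Matches a d ∧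
      ∀ p ∈ e.2, ν' p.1 = name ((select V p.2).map (value a d)) := by
    intro a ha e he
    have := hν' (newAtom a e) (List.mem_flatMap.2 ⟨a, ha, List.mem_map_of_mem he⟩)
    obtain ⟨a', -, this⟩ := List.mem_flatMap.1 this
    obtain ⟨e', -, this⟩ := List.mem_flatMap.1 this
    obtain ⟨d, hd, heq⟩ := List.mem_map.1 this
    simp only [newTuple, newAtom, RelAtom.mk.injEq, List.map_map] at heq
    -- The relation symbol names both the atom and the edge, so the tuple in the new database was
    -- produced for this very pair.
    obtain ⟨rfl, rfl⟩ := Prod.mk.inj (name_injective heq.1)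
    obtain ⟨hd, hm⟩ := List.mem_filter.1 hd
    refine ⟨d, hd, by simpa using hm, fun p hp => ?_⟩
    exact (List.map_inj_left.1 heq.2 p hp).symm
  choose! d hd hmatch hname using h1
  -- `x` is decoded from `ν'` at the vertex where `u` is read off. Since this vertex does not depend
  -- on an atom of `q`, neither does `x`.
  let Good : ℕ → ℕ → Prop := fun u x => ∃ e ∈ r, ∃ p ∈ e.2, s[V.idxOf u]? = some p.1 ∧
    p.2[V.idxOf u]? = some true ∧ ∃ f, ν' p.1 = name ((select V p.2).map f) ∧ f u = x
  have good_unique : ∀ u ∈ V, ∀ x y, Good u x → Good u y → x = y := by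
    rintro u hu x y ⟨e, he, p, hp, hs, hpj, f, hf, rfl⟩ ⟨e', he', p', hp', hs', -, f', hf', rfl⟩
    have hpp : p.1 = p'.1 := by rw [hs] at hs'; exact Option.some_inj.1 hs'
    rw [← hpp, hf, ← hr.label_unique e he p hp e' he' p' hp' hpp] at hf'
    exact List.map_inj_left.1 (name_injective hf') u
      (mem_select.2 ⟨_, List.getElem?_idxOf hu, hpj⟩)
  refine ⟨fun u => if h : ∃ x, Good u x then h.choose else 0, fun a ha => ?_⟩
  obtain ⟨e₀, he₀, hF, he₀'⟩ := hr.exists_edge (mask V a.args) (mem_masks.2 ⟨a, ha, rfl⟩)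
  have he₀a : e₀ ∈ edgesAt V r a := mem_edgesAt.2 ⟨he₀, hF⟩
  -- The edges over `a` that agree with `e₀`. Once this set is closed under links, `exists_edge`
  -- finds in it a place to read off each variable.
  let X := r.filter fun e => decide (e.1 = mask V a.args ∧
    ∀ u ∈ a.args, value a (d a e) u = value a (d a e₀) u)
  have hX (e) : e ∈ X ↔ e ∈ r ∧ e.1 = mask V a.args ∧
      ∀ u ∈ a.args, value a (d a e) u = value a (d a e₀) u := by
    simp [X]
  have hclosed : Closed r (mask V a.args) X := by
    rintro e he e' he' heF ⟨p, hp, hp', hpF⟩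
    obtain ⟨her, hea, hev⟩ := (hX e).1 he
    refine (hX e').2 ⟨he', heF, fun u hu => ?_⟩
    rw [← hev u hu]
    have h2 := hname a ha e (mem_edgesAt.2 ⟨her, hea⟩) p hp
    rw [hname a ha e' (mem_edgesAt.2 ⟨he', heF⟩) p hp'] at h2
    have huV : u ∈ V := mem_vars.2 ⟨a, ha, hu⟩
    refine List.map_inj_left.1 (name_injective h2) u (mem_select.2 ⟨_, List.getElem?_idxOf huV, ?_⟩)
    -- The shared vertex has the full label, so it stores the value of every variable `u` of `a`.
    rw [hpF]
    exact getElem?_mask_eq_some_true.2 ⟨u, List.getElem?_idxOf huV, hu⟩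
  have hvalue : ∀ u ∈ a.args,
      (if h : ∃ x, Good u x then h.choose else 0) = value a (d a e₀) u := by
    intro u hu
    have huV : u ∈ V := mem_vars.2 ⟨a, ha, hu⟩
    have hj : (mask V a.args)[V.idxOf u]? = some true :=
      getElem?_mask_eq_some_true.2 ⟨u, List.getElem?_idxOf huV, hu⟩
    obtain ⟨e, he, p, hp, hs, hpj⟩ := he₀' _ (List.getElem?_eq_some_iff.1 hj).1 hj X
      (filter_mem_subsets _ _) ((hX e₀).2 ⟨he₀, hF, fun _ _ => rfl⟩) hclosed
    obtain ⟨her, hea, hev⟩ := (hX e).1 he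
    have hgood : Good u (value a (d a e₀) u) :=
      ⟨e, her, p, hp, hs, hpj, _, hname a ha e (mem_edgesAt.2 ⟨her, hea⟩) p hp, hev u hu⟩
    have h : ∃ x, Good u x := ⟨_, hgood⟩
    rw [dif_pos h]
    exact good_unique u huV _ _ h.choose_spec hgood
  rw [List.map_congr_left hvalue, (hmatch a ha e₀ he₀a).1, ← (hmatch a ha e₀ he₀a).2]
  exact hd a ha e₀ he₀a

theorem exists_isSolution_newQuery_iff (hr : r.Represents (masks q) s) :
    (∃ ν, q.IsSolution D ν) ↔ ∃ ν, (newQuery q r).IsSolution (newDatabase q D r) ν :=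
  ⟨fun ⟨_, h⟩ => isSolution_newQuery_of_isSolution hr h,
    fun ⟨_, h⟩ => isSolution_of_isSolution_newQuery hr h⟩

end StackMachine

/-! ### Enumerability of the blueprints -/

namespace PrimrecPred

variable {α β : Type*} [Primcodable α] [Primcodable β]

theorem imp {p q : α → Prop} (hp : PrimrecPred p) (hq : PrimrecPred q) :
    PrimrecPred fun a => p a → q a :=
  (hp.not.or hq).of_eq fun _ => imp_iff_not_or.symm

theorem ball_mem {f : α → List β} {p : α → β → Prop} (hf : Primrec f)
    (hp : PrimrecPred fun x : α × β => p x.1 x.2) : PrimrecPred fun a => ∀ b ∈ f a, p a b :=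
  have h : PrimrecRel fun (b : β) (a : α) => p a b := hp.comp (Primrec.snd.pair Primrec.fst)
  h.forall_mem_list.comp hf Primrec.id

theorem bex_mem {f : α → List β} {p : α → β → Prop} (hf : Primrec f)
    (hp : PrimrecPred fun x : α × β => p x.1 x.2) : PrimrecPred fun a => ∃ b ∈ f a, p a b :=
  have h : PrimrecRel fun (b : β) (a : α) => p a b := hp.comp (Primrec.snd.pair Primrec.fst)
  h.exists_mem_list.comp hf Primrec.id

theorem ball_lt {f : α → ℕ} {p : α → ℕ → Prop} (hf : Primrec f)
    (hp : PrimrecPred fun x : α × ℕ => p x.1 x.2) : PrimrecPred fun a => ∀ j < f a, p a j :=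
  (ball_mem (Primrec.list_range.comp hf) hp).of_eq fun a => by simp

theorem mem {f : α → β} {g : α → List β} (hf : Primrec f) (hg : Primrec g) :
    PrimrecPred fun a => f a ∈ g a :=
  (bex_mem (p := fun a b => b = f a) hg
    (Primrec.eq.comp Primrec.snd (hf.comp Primrec.fst))).of_eq fun a => by simp

theorem getElem?_eq_some {f : α → List β} {g : α → ℕ} {h : α → β} (hf : Primrec f)
    (hg : Primrec g) (hh : Primrec h) : PrimrecPred fun a => (f a)[g a]? = some (h a) :=
  Primrec.eq.comp (Primrec.list_getElem?.comp hf hg) (Primrec.option_some.comp hh)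

end PrimrecPred

theorem REPred.comp {α β : Type*} [Primcodable α] [Primcodable β] {p : β → Prop} (hp : REPred p)
    {f : α → β} (hf : Computable f) : REPred fun a => p (f a) :=
  Partrec.comp hp hf

theorem REPred.and {α : Type*} [Primcodable α] {p q : α → Prop} (hp : REPred p) (hq : REPred q) :
    REPred fun a => p a ∧ q a :=
  ((hp.bind (hq.comp Computable.fst).to₂).dom_re).of_eq fun a => by
    simp [Part.assert, Part.bind]

namespace StackMachine.Blueprint

open Primrec PrimrecPred

theorem primrec_subsets {α : Type*} [Primcodable α] : Primrec (subsets : List α → List (List α)) :=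
  list_foldr Primrec.id (Primrec.const [[]]) (list_append.comp (snd.comp snd)
    (list_map (snd.comp snd) (list_cons.comp (fst.comp (snd.comp fst)) snd).to₂)).to₂

theorem primrec_presentation : Primrec presentation :=
  (list_flatMap Primrec.id (list_map (snd.comp snd) (fst.comp snd).to₂).to₂).pair
    (list_map Primrec.id (list_map (snd.comp snd) (fst.comp snd).to₂).to₂)

theorem primrecPred_closed : PrimrecPred fun x : Blueprint × List Bool × Blueprint =>
    Closed x.1 x.2.1 x.2.2 :=
  ball_mem (snd.comp snd) (ball_mem (fst.comp fst) (imp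
    (Primrec.eq.comp (fst.comp snd) (fst.comp (snd.comp (fst.comp fst)))) (imp
      (bex_mem (snd.comp (snd.comp fst)) ((mem snd (snd.comp (snd.comp fst))).and
        (Primrec.eq.comp (snd.comp snd) (fst.comp (snd.comp (fst.comp (fst.comp fst)))))))
      (mem snd (snd.comp (snd.comp (fst.comp fst)))))))

/-- All quantifiers are bounded. In particular, reachability along links is stated without paths, by
quantifying over the closed sets among the finitely many subsets of the blueprint. -/
theorem primrecPred_represents : PrimrecPred fun x : List (List Bool) × Blueprint × List ℕ =>
    Represents x.2.1 x.1 x.2.2 := by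
  have hr : Primrec fun x : List (List Bool) × Blueprint × List ℕ => x.2.1 := fst.comp snd
  have hs : Primrec fun x : List (List Bool) × Blueprint × List ℕ => x.2.2 := snd.comp snd
  have h₁ : PrimrecPred fun x : List (List Bool) × Blueprint × List ℕ => ∀ e ∈ x.2.1, e.1 ∈ x.1 :=
    ball_mem hr (mem (fst.comp snd) (fst.comp fst))
  have h₂ : PrimrecPred fun x : List (List Bool) × Blueprint × List ℕ => ∀ e ∈ x.2.1, ∀ p ∈ e.2,
      ∀ j < p.2.length, p.2[j]? = some true → e.1[j]? = some true :=
    ball_mem hr (ball_mem (snd.comp snd) (ball_lt (list_length.comp (snd.comp snd)) (imp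
      (getElem?_eq_some (snd.comp (snd.comp fst)) snd (Primrec.const true))
      (getElem?_eq_some (fst.comp (snd.comp (fst.comp fst))) snd (Primrec.const true)))))
  have h₃ : PrimrecPred fun x : List (List Bool) × Blueprint × List ℕ => ∀ e ∈ x.2.1, ∀ p ∈ e.2,
      ∀ e' ∈ x.2.1, ∀ p' ∈ e'.2, p.1 = p'.1 → p.2 = p'.2 :=
    ball_mem hr (ball_mem (snd.comp snd) (ball_mem (hr.comp (fst.comp fst))
      (ball_mem (snd.comp snd) (imp
        (Primrec.eq.comp (fst.comp (snd.comp (fst.comp fst))) (fst.comp snd))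
        (Primrec.eq.comp (snd.comp (snd.comp (fst.comp fst))) (snd.comp snd))))))
  have h₄ : PrimrecPred fun x : List (List Bool) × Blueprint × List ℕ => ∀ F ∈ x.1, ∃ e₀ ∈ x.2.1,
      e₀.1 = F ∧ ∀ j < F.length, F[j]? = some true → ∀ X ∈ subsets x.2.1, e₀ ∈ X →
        Closed x.2.1 F X → ∃ e ∈ X, ∃ p ∈ e.2, x.2.2[j]? = some p.1 ∧ p.2[j]? = some true := by
    refine ball_mem fst (bex_mem (hr.comp fst) ((Primrec.eq.comp (fst.comp snd)
      (snd.comp fst)).and (ball_lt (list_length.comp (snd.comp fst)) (imp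
        (getElem?_eq_some (snd.comp (fst.comp fst)) snd (Primrec.const true))
        (ball_mem (primrec_subsets.comp (hr.comp (fst.comp (fst.comp fst)))) (imp
          (mem (snd.comp (fst.comp fst)) snd) (imp ?_ ?_)))))))
    · exact primrecPred_closed.comp ((hr.comp (fst.comp (fst.comp (fst.comp fst)))).pair
        ((snd.comp (fst.comp (fst.comp fst))).pair snd))
    · exact bex_mem snd (bex_mem (snd.comp snd) ((getElem?_eq_some
        (hs.comp (fst.comp (fst.comp (fst.comp (fst.comp (fst.comp fst))))))
        (snd.comp (fst.comp (fst.comp fst))) (fst.comp snd)).and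
        (getElem?_eq_some (snd.comp snd) (snd.comp (fst.comp (fst.comp fst)))
          (Primrec.const true))))
  exact (h₁.and (h₂.and (h₃.and h₄))).of_eq fun x =>
    ⟨fun ⟨h₁, h₂, h₃, h₄⟩ => ⟨h₁, h₂, h₃, h₄⟩, fun ⟨h₁, h₂, h₃, h₄⟩ => ⟨h₁, h₂, h₃, h₄⟩⟩

/-- A blueprint with a hypergraph from the class `𝓗` whose edges represent those in `c`. -/
def IsFor (𝓗 : Set (Hypergraph ℕ)) (c : List (List Bool)) (x : Blueprint × List ℕ) : Prop :=
  (∃ H ∈ 𝓗, H.IsPresentedBy x.1.presentation) ∧ x.1.Represents c x.2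

/-- Membership in `𝓗` is only semidecidable; the remaining condition is decidable. -/
theorem rePred_isFor {𝓗 : Set (Hypergraph ℕ)} (h : Hypergraph.RecursivelyEnumerable 𝓗) :
    REPred fun x : List (List Bool) × Blueprint × List ℕ => IsFor 𝓗 x.1 x.2 :=
  (h.2.comp (primrec_presentation.comp (fst.comp snd)).to_comp).and
    primrecPred_represents.computablePred.to_re

/-- A partial recursive choice of blueprints. -/
theorem exists_partrec_isFor {𝓗 : Set (Hypergraph ℕ)} (h : Hypergraph.RecursivelyEnumerable 𝓗) :
    ∃ F : List (List Bool) →. Blueprint, Partrec F ∧ (∀ c, ∀ r ∈ F c, ∃ s, IsFor 𝓗 c (r, s)) ∧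
      ∀ c x, IsFor 𝓗 c x → (F c).Dom := by
  obtain ⟨F, hF, h₁, h₂⟩ := exists_partrec_choice (rePred_isFor h)
  refine ⟨fun c => (F c).map Prod.fst, hF.map (Computable.fst.comp Computable.snd).to₂,
    fun c r hr => ?_, h₂⟩
  obtain ⟨⟨r, s⟩, hx, rfl⟩ := (Part.mem_map_iff _).1 hr
  exact ⟨s, h₁ c _ hx⟩

end StackMachine.Blueprint

/-! ### Sketches of dilutions -/

namespace Hypergraph

variable {α : Type*} {H H₁ H' : Hypergraph α}

/-- The edge `e'` has image `F` and shares with `e` a vertex with label `F`. -/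
def Linked (H : Hypergraph α) (π : Set α → Set α) (lab : α → Set α) (F : Set α) (e e' : Set α) :
    Prop :=
  e' ∈ H.edgeSet ∧ π e' = F ∧ ∃ v ∈ e, v ∈ e' ∧ lab v = F

/-- A sketch of `H'` in `H` maps edges of `H` to edges of `H'` and labels vertices of `H` by sets of
vertices of `H'`. -/
structure IsSketch (H H' : Hypergraph α) (π : Set α → Set α) (lab : α → Set α) : Prop where
  map_mem : ∀ e ∈ H.edgeSet, π e ∈ H'.edgeSet
  lab_subset : ∀ e ∈ H.edgeSet, ∀ v ∈ e, lab v ⊆ π e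
  mem_lab : ∀ v ∈ H'.vertexSet, v ∈ H.vertexSet ∧ v ∈ lab v
  exists_edge : ∀ F ∈ H'.edgeSet, ∃ e₀ ∈ H.edgeSet, π e₀ = F ∧
    ∀ v ∈ F, ∃ e, Relation.ReflTransGen (H.Linked π lab F) e₀ e ∧ v ∈ e

theorem isSketch_refl (H : Hypergraph α) : IsSketch H H id ({·}) where
  map_mem _ he := he
  lab_subset e _ v hv := by simpa using hv
  mem_lab v hv := ⟨hv, rfl⟩
  exists_edge F hF := ⟨F, hF, rfl, fun v hv => ⟨F, .refl, hv⟩⟩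

/-- Pulling back a sketch of `H'` in `H₁` along a relation `L` between the edges of `H` and those
of `H₁`. -/
theorem IsSketch.of_lift {π₁ : Set α → Set α} {lab₁ : α → Set α} (h : IsSketch H₁ H' π₁ lab₁)
    {π : Set α → Set α} {lab : α → Set α} (L : Set α → Set α → Prop)
    (hπ : ∀ e ∈ H.edgeSet, π e ∈ H'.edgeSet)
    (hlab : ∀ e ∈ H.edgeSet, ∀ v ∈ e, lab v ⊆ π e)
    (hV : ∀ v ∈ H₁.vertexSet, v ∈ H.vertexSet ∧ lab v = lab₁ v)
    (hL : ∀ e₁ ∈ H₁.edgeSet, ∃ e, L e e₁)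
    (hL' : ∀ e e₁, L e e₁ → e ∈ H.edgeSet ∧ π e = π₁ e₁)
    (hmove : ∀ e₁ ∈ H₁.edgeSet, ∀ e, L e e₁ → ∀ v ∈ e₁, ∃ e', L e' e₁ ∧ v ∈ e' ∧
      Relation.ReflTransGen (H.Linked π lab (π₁ e₁)) e e') :
    IsSketch H H' π lab where
  map_mem := hπ
  lab_subset := hlab
  mem_lab v hv := by
    obtain ⟨h₁, h₂⟩ := h.mem_lab v hv
    obtain ⟨h₃, h₄⟩ := hV v h₁
    exact ⟨h₃, h₄ ▸ h₂⟩
  exists_edge F hF := by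
    obtain ⟨e₁, he₁, rfl, hreach⟩ := h.exists_edge F hF
    obtain ⟨e₀, he₀⟩ := hL e₁ he₁
    refine ⟨e₀, (hL' _ _ he₀).1, (hL' _ _ he₀).2, fun v hv => ?_⟩
    -- A chain in `H₁` is lifted link by link. Before each link, `hmove` walks among the edges over
    -- `e₂` to one that contains the shared vertex `u`.
    have path (e₂) (h₂ : Relation.ReflTransGen (H₁.Linked π₁ lab₁ (π₁ e₁)) e₁ e₂) :
        e₂ ∈ H₁.edgeSet ∧ π₁ e₂ = π₁ e₁ ∧
          ∃ e, L e e₂ ∧ Relation.ReflTransGen (H.Linked π lab (π₁ e₁)) e₀ e := by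
      induction h₂ with
      | refl => exact ⟨he₁, rfl, e₀, he₀, .refl⟩
      | tail _ h₃ ih =>
        obtain ⟨he₂, hπ₂, e, he, hp⟩ := ih
        obtain ⟨he₃, hπ₃, u, hu₂, hu₃, hu⟩ := h₃
        obtain ⟨e', he', hue', hp'⟩ := hmove _ he₂ e he u hu₂
        obtain ⟨e'', he''⟩ := hL _ he₃
        obtain ⟨e₃, he₃', hue₃, -⟩ := hmove _ he₃ e'' he'' u hu₃
        refine ⟨he₃, hπ₃, e₃, he₃', (hp.trans (hπ₂ ▸ hp')).tail ⟨(hL' _ _ he₃').1, ?_, u, hue',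
          hue₃, ?_⟩⟩
        · rw [(hL' _ _ he₃').2, hπ₃]
        · rw [(hV u (H₁.subset_vertexSet_of_mem_edgeSet' he₃ hu₃)).2, hu]
    obtain ⟨e₂, h₂, hve₂⟩ := hreach v hv
    obtain ⟨he₂, hπ₂, e, he, hp⟩ := path e₂ h₂
    obtain ⟨e', he', hve', hp'⟩ := hmove _ he₂ e he v hve₂
    exact ⟨e', hp.trans (hπ₂ ▸ hp'), hve'⟩

/-- The deleted vertex gets the empty label and stores nothing; an edge is mapped as its trace
outside `v` was. -/
theorem IsSketch.deleteVertex {v : α} {π₁ : Set α → Set α} {lab₁ : α → Set α}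
    (h : IsSketch (H.deleteVertex v) H' π₁ lab₁) : ∃ π lab, IsSketch H H' π lab := by
  classical
  have hmem (e) (he : e ∈ H.edgeSet) : e \ {v} ∈ (H.deleteVertex v).edgeSet := ⟨e, he, rfl⟩
  refine ⟨fun e => π₁ (e \ {v}), fun u => if u = v then ∅ else lab₁ u,
    h.of_lift (fun e e₁ => e ∈ H.edgeSet ∧ e \ {v} = e₁) (fun e he => h.map_mem _ (hmem e he)) ?_
      ?_ ?_ ?_ ?_⟩
  · intro e he u hu
    split_ifs with huv
    · exact Set.empty_subset _
    · exact h.lab_subset _ (hmem e he) u ⟨hu, huv⟩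
  · exact fun u hu => ⟨hu.1, if_neg hu.2⟩
  · rintro _ ⟨e, he, rfl⟩
    exact ⟨e, he, rfl⟩
  · rintro e _ ⟨he, rfl⟩
    exact ⟨he, rfl⟩
  · rintro _ - e ⟨he, rfl⟩ u hu
    exact ⟨e, ⟨he, rfl⟩, hu.1, .refl⟩

/-- The deleted edge `f` is mapped as `e`, whose image contains all labels of the vertices of `f`.
Chains use only the surviving edges. -/
theorem IsSketch.deleteEdge {f e : Set α} (he : e ∈ H.edgeSet) (hfe : f ⊂ e)
    {π₁ : Set α → Set α} {lab₁ : α → Set α} (h : IsSketch (H.deleteEdge f) H' π₁ lab₁) :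
    ∃ π lab, IsSketch H H' π lab := by
  classical
  have he' : e ∈ (H.deleteEdge f).edgeSet := ⟨he, hfe.ne'⟩
  refine ⟨fun g => if g = f then π₁ e else π₁ g, lab₁,
    h.of_lift (fun g g₁ => g ∈ H.edgeSet ∧ g ≠ f ∧ g = g₁) ?_ ?_ (fun u hu => ⟨hu, rfl⟩) ?_ ?_ ?_⟩
  · intro g hg
    split_ifs with hgf
    · exact h.map_mem e he'
    · exact h.map_mem g ⟨hg, hgf⟩
  · intro g hg u hu
    split_ifs with hgf
    · exact h.lab_subset e he' u (hfe.subset (hgf ▸ hu))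
    · exact h.lab_subset g ⟨hg, hgf⟩ u hu
  · exact fun g hg => ⟨g, hg.1, hg.2, rfl⟩
  · rintro g _ ⟨hg, hgf, rfl⟩
    exact ⟨hg, if_neg hgf⟩
  · rintro _ - g ⟨hg, hgf, rfl⟩ u hu
    exact ⟨g, ⟨hg, hgf, rfl⟩, hu, .refl⟩

/-- All edges through `v` inherit the image of the merged edge `g`, and `v` is labelled with that
whole image. So `v` links these edges and together they act as `g`. Without an edge through `v`
nothing would lie over `g`. -/
theorem IsSketch.merge {v : α} (hv : (H.incident v).Nonempty) {π₁ : Set α → Set α}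
    {lab₁ : α → Set α} (h : IsSketch (H.merge v) H' π₁ lab₁) : ∃ π lab, IsSketch H H' π lab := by
  classical
  obtain ⟨e₀, he₀, hve₀⟩ := hv
  set g := ⋃₀ H.incident v \ {v} with hg
  have hgm : g ∈ (H.merge v).edgeSet := Or.inl rfl
  have hem (e) (he : e ∈ H.edgeSet) (hve : v ∉ e) : e ∈ (H.merge v).edgeSet :=
    Or.inr ⟨he, fun h => hve h.2⟩
  refine ⟨fun e => if v ∈ e then π₁ g else π₁ e, fun u => if u = v then π₁ g else lab₁ u,
    -- An edge of `H` may happen to equal `g`. It is not used as a lift of `g`, so that all lifts of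
    -- `g` contain `v`.
    h.of_lift (fun e e₁ => e ∈ H.edgeSet ∧ (v ∈ e ∧ e₁ = g ∨ v ∉ e ∧ e₁ ≠ g ∧ e = e₁))
      ?_ ?_ ?_ ?_ ?_ ?_⟩
  · intro e he
    split_ifs with hve
    · exact h.map_mem _ hgm
    · exact h.map_mem _ (hem e he hve)
  · intro e he u hu
    split_ifs with huv hve hve
    · exact subset_rfl
    · exact absurd (huv ▸ hu) hve
    · exact h.lab_subset g hgm u ⟨⟨e, ⟨he, hve⟩, hu⟩, huv⟩
    · exact h.lab_subset e (hem e he hve) u hu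
  · exact fun u hu => ⟨hu.1, if_neg hu.2⟩
  · intro e₁ he₁
    by_cases h₁ : e₁ = g
    · exact ⟨e₀, he₀, Or.inl ⟨hve₀, h₁⟩⟩
    · obtain ⟨h₂, h₃⟩ := he₁.resolve_left h₁
      exact ⟨e₁, h₂, Or.inr ⟨fun hve => h₃ ⟨h₂, hve⟩, h₁, rfl⟩⟩
  · rintro e e₁ ⟨he, ⟨hve, rfl⟩ | ⟨hve, -, rfl⟩⟩
    · exact ⟨he, if_pos hve⟩
    · exact ⟨he, if_neg hve⟩
  · rintro e₁ - e ⟨he, ⟨hve, rfl⟩ | ⟨hve, h₁, rfl⟩⟩ u hu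
    · obtain ⟨⟨e', ⟨he', hve'⟩, hu'⟩, -⟩ := hu
      exact ⟨e', ⟨he', Or.inl ⟨hve', rfl⟩⟩, hu',
        .single ⟨he', if_pos hve', v, hve, hve', if_pos rfl⟩⟩
    · exact ⟨e, ⟨he, Or.inr ⟨hve, h₁, rfl⟩⟩, hu, .refl⟩

/-- The sequence is undone from its end, starting from the identity sketch. Freedom from isolated
vertices survives every operation, and merging needs it to have an edge at `v`. -/
theorem exists_isSketch (h : Relation.ReflTransGen DilutionStep H H')
    (hH : ∀ v ∈ H.vertexSet, ¬ H.IsIsolated v) : ∃ π lab, IsSketch H H' π lab := by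
  induction h using Relation.ReflTransGen.head_induction_on with
  | refl => exact ⟨_, _, isSketch_refl _⟩
  | head hstep _ ih =>
    simp only [IsIsolated, not_forall, not_not] at hH ih
    cases hstep with
    | deleteVertex v hv =>
      obtain ⟨π, lab, h⟩ := ih fun u hu => by
        obtain ⟨e, he, hue⟩ := hH u hu.1
        exact ⟨e \ {v}, ⟨e, he, rfl⟩, hue, hu.2⟩
      exact h.deleteVertex
    | deleteEdge f e hf he hfe =>
      obtain ⟨π, lab, h⟩ := ih fun u hu => by
        obtain ⟨e', he', hue⟩ := hH u hu
        by_cases hf' : e' = f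
        · exact ⟨e, ⟨he, hfe.ne'⟩, hfe.subset (hf' ▸ hue)⟩
        · exact ⟨e', ⟨he', hf'⟩, hue⟩
      exact h.deleteEdge he hfe
    | merge v hv =>
      obtain ⟨π, lab, h⟩ := ih fun u hu => by
        obtain ⟨e', he', hue⟩ := hH u hu.1
        by_cases hve : v ∈ e'
        · exact ⟨_, Or.inl rfl, ⟨e', ⟨he', hve⟩, hue⟩, hu.2⟩
        · exact ⟨e', Or.inr ⟨he', fun h => hve h.2⟩, hue⟩
      obtain ⟨e, he, hve⟩ := hH v hv
      exact h.merge ⟨e, he, hve⟩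

end Hypergraph

/-! ### Blueprints of dilutions -/

namespace StackMachine

open Blueprint Hypergraph

open Classical in
/-- The blueprint of a sketch. -/
theorem exists_isFor_of_isSketch {𝓗 : Set (Hypergraph ℕ)} {H H' : Hypergraph ℕ} (hH : H ∈ 𝓗)
    (hiso : ∀ v ∈ H.vertexSet, ¬ H.IsIsolated v) {d : List ℕ × List (List ℕ)}
    (hd : H.IsPresentedBy d) {π : Set ℕ → Set ℕ} {lab : ℕ → Set ℕ} (h : IsSketch H H' π lab)
    {vs : List ℕ} {c : List (List Bool)}
    (hc : ∀ F, F ∈ c ↔ ∃ e ∈ H'.edgeSet, F = vs.map fun v => decide (v ∈ e)) :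
    ∃ x, IsFor 𝓗 c x := by
  obtain ⟨-, hE⟩ := hd
  let bl : Set ℕ → List Bool := fun S => vs.map fun v => decide (v ∈ S)
  have hbl {S : Set ℕ} {j : ℕ} : (bl S)[j]? = some true ↔ ∃ v, vs[j]? = some v ∧ v ∈ S := by
    simp [bl]
  let entry : List ℕ → List Bool × List (ℕ × List Bool) := fun l =>
    (bl (π {v | v ∈ l}), l.map fun w => (w, bl (lab w)))
  have hentry (l) : ((entry l).2.map Prod.fst) = l := by simp [entry, Function.comp_def]
  have hmem {e} (he : e ∈ d.2.map entry) : ∃ l ∈ d.2, {v | v ∈ l} ∈ H.edgeSet ∧ e = entry l := by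
    obtain ⟨l, hl, rfl⟩ := List.mem_map.1 he
    exact ⟨l, hl, hE ▸ ⟨l, hl, rfl⟩, rfl⟩
  have hmem₂ {l p} (hp : p ∈ (entry l).2) : p.1 ∈ l ∧ p.2 = bl (lab p.1) := by
    obtain ⟨w, hw, rfl⟩ := List.mem_map.1 hp
    exact ⟨hw, rfl⟩
  -- Dilution operations do not rename vertices, so a vertex of `H'` is read off at itself in `H`.
  refine ⟨(d.2.map entry, vs), ⟨H, hH, ?_, ?_⟩, ?_, ?_, ?_, ?_⟩
  · ext v
    simp only [presentation, Set.mem_ofPred_eq, List.flatMap_map, hentry, List.mem_flatMap]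
    constructor
    -- A blueprint only knows the vertices that lie in edges; here these are all vertices of `H`.
    · intro hv
      have := hiso v hv
      simp only [IsIsolated, not_forall, not_not] at this
      obtain ⟨e, he, hve⟩ := this
      rw [hE] at he
      obtain ⟨l, hl, rfl⟩ := he
      exact ⟨l, hl, hve⟩
    · rintro ⟨l, hl, hv⟩
      exact H.subset_vertexSet_of_mem_edgeSet' (hE ▸ ⟨l, hl, rfl⟩ : {v | v ∈ l} ∈ H.edgeSet) hv
  · rw [hE]
    simp only [presentation, List.map_map, Function.comp_def, hentry, List.map_id']
  · intro e he
    obtain ⟨l, -, hl, rfl⟩ := hmem he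
    exact (hc _).2 ⟨_, h.map_mem _ hl, rfl⟩
  · rintro e he p hp j - hj
    obtain ⟨l, -, hl, rfl⟩ := hmem he
    obtain ⟨hpl, hp₂⟩ := hmem₂ hp
    rw [hp₂] at hj
    obtain ⟨v, hv, hvp⟩ := hbl.1 hj
    exact hbl.2 ⟨v, hv, h.lab_subset _ hl p.1 hpl hvp⟩
  · intro e he p hp e' he' p' hp' hpp
    obtain ⟨l, -, -, rfl⟩ := hmem he
    obtain ⟨l', -, -, rfl⟩ := hmem he'
    rw [(hmem₂ hp).2, (hmem₂ hp').2, hpp]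
  · intro F hF
    obtain ⟨e, he, rfl⟩ := (hc F).1 hF
    obtain ⟨e₀, he₀, hπ, hreach⟩ := h.exists_edge e he
    have he₀' := he₀
    rw [hE] at he₀'
    obtain ⟨l₀, hl₀, rfl⟩ := he₀'
    refine ⟨entry l₀, List.mem_map_of_mem hl₀, congrArg bl hπ, ?_⟩
    rintro j - hj X - hX hclosed
    obtain ⟨v, hv, hve⟩ := hbl.1 hj
    obtain ⟨f, hf, hvf⟩ := hreach v hve
    -- A closed set containing the start of a chain of links contains all its members.
    have path : ∃ l ∈ d.2, f = {v | v ∈ l} ∧ entry l ∈ X := by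
      clear hvf
      induction hf with
      | refl => exact ⟨l₀, hl₀, rfl, hX⟩
      | tail _ h₁ ih =>
        obtain ⟨l, hl, rfl, hlX⟩ := ih
        obtain ⟨hf', hπ', w, hw, hw', hlab⟩ := h₁
        rw [hE] at hf'
        obtain ⟨l', hl', rfl⟩ := hf'
        refine ⟨l', hl', rfl, hclosed _ hlX _ (List.mem_map_of_mem hl') (congrArg bl hπ')
          ⟨(w, bl (lab w)), List.mem_map_of_mem hw, List.mem_map_of_mem hw', congrArg bl hlab⟩⟩
    obtain ⟨l, hl, rfl, hlX⟩ := path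
    exact ⟨_, hlX, (v, bl (lab v)), List.mem_map_of_mem hvf, hv,
      hbl.2 ⟨v, hv, (h.mem_lab v (H'.subset_vertexSet_of_mem_edgeSet' he hve)).2⟩⟩

/-- Renaming the vertices does not change characteristic lists, so the blueprint of the reached
hypergraph also serves its isomorphic copy `M`. -/
theorem exists_isFor {𝓗 : Set (Hypergraph ℕ)} {M H : Hypergraph ℕ} (hH : H ∈ 𝓗)
    (hiso : ∀ v ∈ H.vertexSet, ¬ H.IsIsolated v) (hpres : ∃ d, H.IsPresentedBy d)
    (hM : M.IsDilutionOf H) {vs : List ℕ} {es : List (List ℕ)} (hMp : M.IsPresentedBy (vs, es))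
    {c : List (List Bool)} (hc : ∀ F, F ∈ c ↔ ∃ l ∈ es, mask vs l = F) : ∃ x, IsFor 𝓗 c x := by
  classical
  obtain ⟨d, hd⟩ := hpres
  obtain ⟨H', hdil, φ, hφ, rfl⟩ := hM
  obtain ⟨π, lab, h⟩ := exists_isSketch hdil hiso
  obtain ⟨hV, hE⟩ := hMp
  refine exists_isFor_of_isSketch (vs := vs.map φ) hH hiso hd h fun F => ?_
  have key (l) (hl : l ∈ es) :
      mask vs l = (vs.map φ).map fun v => decide (v ∈ φ '' {v | v ∈ l}) := by
    have hlM : {v | v ∈ l} ∈ M.edgeSet := hE ▸ ⟨l, hl, rfl⟩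
    rw [List.map_map]
    refine List.map_congr_left fun v hv => ?_
    simp only [Function.comp_apply, decide_eq_decide]
    rw [hφ.mem_image_iff (M.subset_vertexSet_of_mem_edgeSet' hlM) (hV ▸ hv)]
    rfl
  rw [hc]
  constructor
  · rintro ⟨l, hl, rfl⟩
    exact ⟨φ '' {v | v ∈ l}, ⟨_, hE ▸ ⟨l, hl, rfl⟩, rfl⟩, by rw [key l hl]⟩
  · rintro ⟨_, ⟨e, he, rfl⟩, rfl⟩
    rw [hE] at he
    obtain ⟨l, hl, rfl⟩ := he
    exact ⟨l, hl, key l hl⟩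

end StackMachine

/-! ### Bounds in terms of the parameter -/

theorem Hypergraph.Iso.symm_trans {α : Type*} {H H₁ H₂ : Hypergraph α} (h₁ : H.Iso H₁)
    (h₂ : H.Iso H₂) : H₁.Iso H₂ := by
  obtain ⟨φ, hφ, rfl⟩ := h₁
  obtain ⟨ψ, hψ, rfl⟩ := h₂
  rcases isEmpty_or_nonempty α with hα | hα
  · exact ⟨id, Function.injective_id.injOn, by
      rw [Subsingleton.elim φ ψ, Hypergraph.image_image, Function.id_comp]⟩
  have hinv : ∀ v ∈ H.vertexSet, Function.invFunOn φ H.vertexSet (φ v) = v :=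
    fun v hv => hφ.leftInvOn_invFunOn hv
  refine ⟨ψ ∘ Function.invFunOn φ H.vertexSet, ?_, ?_⟩
  · rintro _ ⟨u, hu, rfl⟩ _ ⟨v, hv, rfl⟩ h
    simp only [Function.comp_apply, hinv u hu, hinv v hv] at h
    rw [hψ hu hv h]
  · rw [Hypergraph.image_image]
    have heq : Set.EqOn ((ψ ∘ Function.invFunOn φ H.vertexSet) ∘ φ) ψ H.vertexSet := fun v hv => by
      simp only [Function.comp_apply, hinv v hv]
    refine Hypergraph.ext (Set.image_congr heq) (Set.image_congr fun e he => Set.image_congr ?_)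
    exact heq.mono (H.subset_vertexSet_of_mem_edgeSet' he)

theorem Hypergraph.Iso.refl {α : Type*} (H : Hypergraph α) : H.Iso H :=
  ⟨id, Function.injective_id.injOn, Hypergraph.ext (by simp) (by simp)⟩

theorem ConjQuery.isPresentedBy_hypergraph (q : ConjQuery) :
    q.hypergraph.IsPresentedBy (q.flatMap fun a => a.args, q.map fun a => a.args) := by
  constructor
  · ext v
    simp [ConjQuery.hypergraph]
  · ext e
    simp [ConjQuery.hypergraph]

namespace StackMachine

open Hypergraph

/-- The lists of length at most `n` with elements in `l`. -/
def words {α : Type*} (l : List α) (n : ℕ) : List (List α) :=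
  n.rec [[]] fun _ s => [] :: s.flatMap fun w => l.map (· :: w)

theorem mem_words {α : Type*} {l w : List α} {n : ℕ} :
    w ∈ words l n ↔ w.length ≤ n ∧ w ⊆ l := by
  induction n generalizing w with
  | zero =>
    change w ∈ [[]] ↔ _
    rw [List.mem_singleton, Nat.le_zero, List.length_eq_zero_iff]
    exact ⟨fun h => ⟨h, by simp [h]⟩, fun h => h.1⟩
  | succ n ih =>
    change w ∈ [] :: (words l n).flatMap (fun w => l.map (· :: w)) ↔ _
    cases w with
    | nil => simp
    | cons a w =>
      simp only [List.mem_cons, reduceCtorEq, false_or, List.mem_flatMap, List.mem_map, ih,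
        List.cons.injEq, List.length_cons, Nat.add_le_add_iff_right, List.cons_subset]
      constructor
      · rintro ⟨w', ⟨h₁, h₂⟩, a', ha', rfl, rfl⟩
        exact ⟨h₁, ha', h₂⟩
      · rintro ⟨h₁, ha, h₂⟩
        exact ⟨w, ⟨h₁, h₂⟩, a, ha, rfl, rfl⟩

/-- The lists of characteristic lists of the edges of the hypergraph with presentation `d`, for all
orders of its vertices and edges. -/
def codes (d : List ℕ × List (List ℕ)) : List (List (List Bool)) :=
  ((words d.1 d.1.length).filter fun vs => decide (∀ v ∈ d.1, v ∈ vs)).flatMap fun vs =>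
    ((words d.2 d.2.length).map fun es => es.map (mask vs)).filter fun c =>
      decide (∀ l ∈ d.2, mask vs l ∈ c)

theorem mem_codes {d : List ℕ × List (List ℕ)} {c : List (List Bool)} :
    c ∈ codes d ↔ ∃ vs, vs.length ≤ d.1.length ∧ (∀ v, v ∈ vs ↔ v ∈ d.1) ∧ ∃ es : List (List ℕ),
      es.length ≤ d.2.length ∧ es ⊆ d.2 ∧ es.map (mask vs) = c ∧ ∀ l ∈ d.2, mask vs l ∈ c := by
  simp only [codes, List.mem_flatMap, List.mem_filter, mem_words, decide_eq_true_iff, List.mem_map]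
  constructor
  · rintro ⟨vs, ⟨⟨h₁, h₂⟩, h₃⟩, ⟨es, ⟨h₄, h₅⟩, h₆⟩, h₇⟩
    exact ⟨vs, h₁, fun v => ⟨fun h => h₂ h, h₃ v⟩, es, h₄, h₅, h₆, h₇⟩
  · rintro ⟨vs, h₁, h₂, es, h₄, h₅, h₆, h₇⟩
    exact ⟨vs, ⟨⟨h₁, fun v hv => (h₂ v).1 hv⟩, fun v hv => (h₂ v).2 hv⟩, ⟨es, ⟨h₄, h₅⟩, h₆⟩, h₇⟩

theorem mask_eq_mask_iff {V l l' : List ℕ} :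
    mask V l = mask V l' ↔ ∀ v ∈ V, v ∈ l ↔ v ∈ l' := by
  simp [mask, List.map_inj_left]

/-- All lists in `codes d` come from presentations of the same hypergraph. Hence the search for a
blueprint halts on each of them, not only on `masks q`. -/
theorem exists_isPresentedBy_of_mem_codes {H : Hypergraph ℕ} {d : List ℕ × List (List ℕ)}
    (hd : H.IsPresentedBy d) {c : List (List Bool)} (hc : c ∈ codes d) :
    ∃ vs es, H.IsPresentedBy (vs, es) ∧ es.map (mask vs) = c := by
  obtain ⟨vs, -, hvs, es, -, hes, rfl, hcov⟩ := mem_codes.1 hc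
  obtain ⟨hV, hE⟩ := hd
  refine ⟨vs, es, ⟨?_, ?_⟩, rfl⟩
  · rw [hV]
    exact Set.ext fun v => (hvs v).symm
  · rw [hE]
    ext e
    constructor
    · rintro ⟨l, hl, rfl⟩
      obtain ⟨l', hl', h⟩ := List.mem_map.1 (hcov l hl)
      rw [mask_eq_mask_iff] at h
      have hsub (l₁) (h₁ : l₁ ∈ d.2) (v) (hv : v ∈ l₁) : v ∈ vs := by
        have hm : {v | v ∈ l₁} ∈ H.edgeSet := hE ▸ ⟨l₁, h₁, rfl⟩
        have := H.subset_vertexSet_of_mem_edgeSet' hm hv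
        rw [hV] at this
        exact (hvs v).2 this
      refine ⟨l', hl', Set.ext fun v => ⟨fun hv => ?_, fun hv => ?_⟩⟩
      · exact (h v (hsub l hl v hv)).2 hv
      · exact (h v (hsub l' (hes hl') v hv)).1 hv
    · rintro ⟨l, hl, rfl⟩
      exact ⟨l, hes hl, rfl⟩

/-- Renamed by `φ`, the order of variables and edges in `masks q` is among the orders that `codes`
runs through. The length bounds hold because `vars q` and `masks q` have no repetitions. -/
theorem masks_mem_codes {q : ConjQuery} {H : Hypergraph ℕ} (hH : q.hypergraph.Iso H)
    {d : List ℕ × List (List ℕ)} (hd : H.IsPresentedBy d) : masks q ∈ codes d := by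
  obtain ⟨φ, hφ, rfl⟩ := hH
  obtain ⟨hV, hE⟩ := hd
  have hV' (v) : v ∈ vars q ↔ v ∈ q.hypergraph.vertexSet := mem_vars
  have hφ' : Set.InjOn φ {v | v ∈ vars q} := fun u hu v hv h => hφ ((hV' u).1 hu) ((hV' v).1 hv) h
  have hmask (a) (ha : a ∈ q) (l) (hl : φ '' {v | v ∈ a.args} = {v | v ∈ l}) :
      mask ((vars q).map φ) l = mask (vars q) a.args := by
    rw [mask, List.map_map]
    refine List.map_congr_left fun v hv => ?_
    simp only [Function.comp_apply, decide_eq_decide]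
    have : φ v ∈ l ↔ φ v ∈ φ '' {v | v ∈ a.args} := by
      rw [hl]
      rfl
    have hsub : {v | v ∈ a.args} ⊆ {v | v ∈ vars q} := fun u hu => mem_vars.2 ⟨a, ha, hu⟩
    rw [this, hφ'.mem_image_iff hsub hv]
    rfl
  have hvs (v) : v ∈ (vars q).map φ ↔ v ∈ d.1 := by
    have : v ∈ (q.hypergraph.image φ).vertexSet ↔ v ∈ d.1 := by rw [hV]; rfl
    rw [← this, List.mem_map]
    simp only [hV']
    rfl
  have hlist (F) (hF : F ∈ masks q) : ∃ l ∈ d.2, mask ((vars q).map φ) l = F := by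
    obtain ⟨a, ha, rfl⟩ := mem_masks.1 hF
    have hm : φ '' {v | v ∈ a.args} ∈ (q.hypergraph.image φ).edgeSet := ⟨_, ⟨a, ha, rfl⟩, rfl⟩
    rw [hE] at hm
    obtain ⟨l, hl, hal⟩ := hm
    exact ⟨l, hl, hmask a ha l hal⟩
  choose! f hf hf' using hlist
  have hes : ((masks q).map f).map (mask ((vars q).map φ)) = masks q := by
    rw [List.map_map]
    exact (List.map_congr_left hf').trans (List.map_id _)
  have hsub : (masks q).map f ⊆ d.2 := fun l hl => by
    obtain ⟨F, hF, rfl⟩ := List.mem_map.1 hl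
    exact hf F hF
  refine mem_codes.2 ⟨(vars q).map φ, ?_, hvs, (masks q).map f, ?_, hsub, hes, fun l hl => ?_⟩
  · exact (((List.nodup_dedup _).map_on fun u hu v hv h => hφ' hu hv h).subperm
      fun v hv => (hvs v).1 hv).length_le
  · exact ((List.Nodup.of_map (mask ((vars q).map φ)) (by
      rw [hes]; exact List.nodup_dedup _)).subperm hsub).length_le
  · have hm : {v | v ∈ l} ∈ (q.hypergraph.image φ).edgeSet := hE ▸ ⟨l, hl, rfl⟩
    obtain ⟨_, ⟨a, ha, rfl⟩, hal⟩ := hm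
    rw [hmask a ha l hal]
    exact mem_masks.2 ⟨a, ha, rfl⟩

open Primrec in
theorem primrec_words {α : Type*} [Primcodable α] :
    Primrec₂ (words : List α → ℕ → List (List α)) := by
  have h : Primrec₂ fun (l : List α) (x : ℕ × List (List α)) =>
      [] :: x.2.flatMap fun w => l.map (· :: w) :=
    list_cons.comp (Primrec.const []) (list_flatMap (snd.comp snd)
      (list_map (fst.comp fst) (list_cons.comp snd (snd.comp fst)).to₂).to₂)
  exact Primrec.nat_rec (Primrec.const [[]]) h

theorem primrec_mask : Primrec₂ mask :=
  Primrec.list_map Primrec.fst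
    (PrimrecPred.mem Primrec.snd (Primrec.snd.comp Primrec.fst)).decide.to₂

open Primrec in
theorem primrec_codes : Primrec codes := by
  have h₁ : PrimrecRel fun (vs : List ℕ) (d : List ℕ × List (List ℕ)) => ∀ v ∈ d.1, v ∈ vs :=
    PrimrecPred.ball_mem (fst.comp snd) (PrimrecPred.mem snd (fst.comp fst))
  have h₂ : PrimrecRel fun (c : List (List Bool)) (x : (List ℕ × List (List ℕ)) × List ℕ) =>
      ∀ l ∈ x.1.2, mask x.2 l ∈ c :=
    PrimrecPred.ball_mem (snd.comp (fst.comp snd)) (PrimrecPred.mem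
      (primrec_mask.comp (snd.comp (snd.comp fst)) snd) (fst.comp fst))
  have h₃ : Primrec fun x : (List ℕ × List (List ℕ)) × List ℕ =>
      (words x.1.2 x.1.2.length).map fun es => es.map (mask x.2) :=
    list_map (primrec_words.comp (snd.comp fst) (list_length.comp (snd.comp fst)))
      (list_map snd (primrec_mask.comp (snd.comp (fst.comp fst)) snd).to₂).to₂
  exact list_flatMap (h₁.listFilter.comp (primrec_words.comp fst (list_length.comp fst)) Primrec.id)
    (h₂.listFilter.comp h₃ Primrec.id).to₂

/-- A partial recursive function bounds the values of `G` on the elements of a list on which `G` is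
defined. -/
theorem exists_partrec_list_bound {α : Type*} [Primcodable α] {G : α →. ℕ} (hG : Partrec G) :
    ∃ g : List α →. ℕ, Partrec g ∧ ∀ l, (∀ a ∈ l, (G a).Dom) → ∃ b ∈ g l, ∀ a ∈ l, ∀ t ∈ G a,
      t ≤ b := by
  obtain ⟨code, hcode⟩ := Nat.Partrec.Code.exists_code.1 hG
  have heval (a : α) : code.eval (Encodable.encode a) = G a := by
    rw [hcode]
    simp only [Encodable.encodek, Part.coe_some, Part.bind_some]
    exact Part.map_id' (fun _ => rfl) _
  let ev : ℕ → α → Option ℕ := fun n a => Nat.Partrec.Code.evaln n code (Encodable.encode a)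
  -- The sum of the values, defined as soon as the bound `n` suffices for all members of `l`; the
  -- sum dominates each value.
  let total : List α → ℕ → Option ℕ := fun l n =>
    l.foldr (fun a o => o.bind fun s => (ev n a).map fun t => s + t) (some 0)
  have htotal : Primrec₂ total := by
    have h : Primrec fun x : ((List α × ℕ) × α × Option ℕ) × ℕ => ev x.1.1.2 x.1.2.1 :=
      Nat.Partrec.Code.primrec_evaln.comp (((Primrec.snd.comp (Primrec.fst.comp Primrec.fst)).pair
        (Primrec.const code)).pair (Primrec.encode.comp
          (Primrec.fst.comp (Primrec.snd.comp Primrec.fst))))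
    exact Primrec.list_foldr Primrec.fst (Primrec.const (some 0)) (Primrec.option_bind
      (Primrec.snd.comp Primrec.snd) (Primrec.option_map h (Primrec.nat_add.comp
        (Primrec.snd.comp Primrec.fst) Primrec.snd).to₂).to₂).to₂
  refine ⟨fun l => Nat.rfindOpt (total l), Partrec.rfindOpt htotal.to_comp, fun l hl => ?_⟩
  have hmono {m n : ℕ} (hmn : m ≤ n) {a : α} {t : ℕ} (h : ev m a = some t) : ev n a = some t :=
    Nat.Partrec.Code.evaln_mono hmn h
  have hdom (l : List α) : (∀ a ∈ l, (G a).Dom) → ∃ n, ∀ m, n ≤ m → ∃ b, total l m = some b := by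
    induction l with
    | nil => exact fun _ => ⟨0, fun _ _ => ⟨0, rfl⟩⟩
    | cons a l ih =>
      intro h
      obtain ⟨n, hn⟩ := ih fun b hb => h b (List.mem_cons_of_mem _ hb)
      obtain ⟨t, ht⟩ := Part.dom_iff_mem.1 (h a List.mem_cons_self)
      rw [← heval] at ht
      obtain ⟨k, hk⟩ := Nat.Partrec.Code.evaln_complete.1 ht
      refine ⟨max n k, fun m hm => ?_⟩
      obtain ⟨b, hb⟩ := hn m ((le_max_left _ _).trans hm)
      have := hmono ((le_max_right _ _).trans hm) hk
      refine ⟨b + t, ?_⟩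
      simp only [total, List.foldr_cons] at hb ⊢
      rw [hb, this]
      rfl
  have hbound (n : ℕ) (l : List α) : ∀ b, total l n = some b → ∀ a ∈ l, ∀ t ∈ G a, t ≤ b := by
    induction l with
    | nil => simp
    | cons a l ih =>
      intro b hb
      simp only [total, List.foldr_cons] at hb
      obtain ⟨s, hs, hb⟩ := Option.bind_eq_some_iff.1 hb
      obtain ⟨t, ht, rfl⟩ := Option.map_eq_some_iff.1 hb
      rintro a' ha' t' ht'
      rcases List.mem_cons.1 ha' with rfl | ha'
      · have := Nat.Partrec.Code.evaln_sound ht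
        rw [heval] at this
        rw [Part.mem_unique ht' this]
        exact Nat.le_add_left _ _
      · exact (ih s hs a' ha' t' ht').trans (Nat.le_add_right _ _)
  obtain ⟨n, hn⟩ := hdom l hl
  obtain ⟨b, hb⟩ := hn n le_rfl
  have hd : (Nat.rfindOpt (total l)).Dom := Nat.rfindOpt_dom.2 ⟨n, b, hb⟩
  refine ⟨_, Part.get_mem hd, ?_⟩
  obtain ⟨m, hm⟩ := Nat.rfindOpt_spec (Part.get_mem hd)
  exact hbound m l _ hm

/-- A partial recursive function of the list of characteristic lists of a query is bounded in terms
of the hypergraph of the query. -/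
theorem exists_partrec_isoCode_bound {G : List (List Bool) →. ℕ} (hG : Partrec G) :
    ∃ g : ℕ →. ℕ, Partrec g ∧ ∀ q : ConjQuery,
      (∀ H vs es, q.hypergraph.Iso H → H.IsPresentedBy (vs, es) → (G (es.map (mask vs))).Dom) →
      ∃ b ∈ g q.hypergraph.isoCode, ∀ t ∈ G (masks q), t ≤ b := by
  obtain ⟨g, hg, hg'⟩ := exists_partrec_list_bound hG
  refine ⟨fun k => (Encodable.decode (α := List ℕ × List (List ℕ)) k : Part _).bind
    fun d => g (codes d), ?_, fun q hq => ?_⟩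
  · exact (Computable.decode.ofOption).bind (hg.comp (primrec_codes.to_comp.comp Computable.snd)).to₂
  · have hne : {n | ∃ (H' : Hypergraph ℕ) (c : List ℕ × List (List ℕ)),
        q.hypergraph.Iso H' ∧ H'.IsPresentedBy c ∧ n = Encodable.encode c}.Nonempty :=
      ⟨_, q.hypergraph, _, .refl _, q.isPresentedBy_hypergraph, rfl⟩
    -- The infimum is attained, so the parameter decodes to a presentation `d` of an isomorphic
    -- copy, from which all orders can be computed.
    obtain ⟨H, d, hiso, hd, hcode⟩ := Nat.sInf_mem hne
    obtain ⟨b, hb, hb'⟩ := hg' (codes d) fun c hc => by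
      obtain ⟨vs, es, hp, rfl⟩ := exists_isPresentedBy_of_mem_codes hd hc
      exact hq H vs es hiso hp
    refine ⟨b, Part.mem_bind_iff.2 ⟨d, ?_, hb⟩, hb' _ (masks_mem_codes hiso hd)⟩
    rw [isoCode, hcode, Encodable.encodek]
    exact Part.mem_some d

end StackMachine

/-! ### The machine of the reduction -/

theorem Hypergraph.IsPresentedBy.eq {α : Type*} {H H' : Hypergraph α} {d : List α × List (List α)}
    (h : H.IsPresentedBy d) (h' : H'.IsPresentedBy d) : H = H' :=
  Hypergraph.ext (h.1.trans h'.1.symm) (h.2.trans h'.2.symm)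

theorem Hypergraph.IsPresentedBy.isoCode_le {H : Hypergraph ℕ} {d : List ℕ × List (List ℕ)}
    (h : H.IsPresentedBy d) : H.isoCode ≤ Encodable.encode d :=
  Nat.sInf_le ⟨H, d, .refl H, h, rfl⟩

namespace StackMachine

open Coded Program Polynomial

theorem sz_string_le (w : List Γ') : sz w ≤ 20 * w.length + 1 := by
  have h (a : Γ') : sz a ≤ 19 := by rcases a with _ | (_ | _) | _ | _ | _ <;> decide
  induction w with
  | nil => simp
  | cons a w ih =>
    have := h a
    simp only [sz_cons, List.length_cons]
    omega

/-- Running a program between two polynomial-time functions. -/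
theorem exists_program_comp {α β γ δ ε : Type*} [Coded α] [Coded β] [Coded γ] [Coded δ] [Coded ε]
    {f : α → γ × β} {h : δ × β → ε} (hf : PolyTime f) (hh : PolyTime h) (P : Program) :
    ∃ (P' : Program) (p : Polynomial ℕ), ∀ a z t, P.Trans [toData (f a).1] [toData z] t →
      P'.Trans [toData a] [toData (h (z, (f a).2))] (p.eval (sz a + t)) := by
  obtain ⟨q, hq⟩ := hf.sz_le
  obtain ⟨A, p₁, hA⟩ := hf
  obtain ⟨B, p₂, hB⟩ := hh
  -- The second component waits on the stack while `P` works on the first. The result of `P` exceeds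
  -- its input by at most `t`, so the total time is polynomial in `sz a + t`.
  refine ⟨(A.seq (ifPair (P.seq cons) skip)).seq B, p₁ + X + 3 + p₂.comp (q + X), fun a z t ht => ?_⟩
  have h₁ : (ifPair (P.seq cons) skip).Trans [toData (f a)] [toData (z, (f a).2)] (t + 1 + 1) :=
    trans_ifPair_pair skip ((ht.frame [toData (f a).2]).seq (trans_cons (toData z) _))
  refine (((hA a).seq h₁).seq (hB _)).mono ?_
  have h₂ := ht.size_le
  have h₃ := hq a
  have h₄ : sz (f a) = sz (f a).1 + sz (f a).2 + 1 := sz_mk _ _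
  have h₅ : sz (z, (f a).2) ≤ q.eval (sz a + t) + (sz a + t) := by
    have := q.eval_nat_mono (Nat.le_add_right (sz a) t)
    rw [sz_mk]
    simp only [sz] at *
    omega
  have h₆ := p₂.eval_nat_mono h₅
  have h₇ := p₁.eval_nat_mono (Nat.le_add_right (sz a) t)
  simp only [eval_add, eval_comp, eval_X, eval_ofNat]
  omega

/-- The function of the reduction on instances and blueprints. -/
theorem polyTime_reduction : PolyTime fun x : Blueprint × ConjQuery × Database =>
    encodeInstStr (newQuery x.2.1 x.1, newDatabase x.2.1 x.2.2 x.1) :=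
  PolyTime.encodeInstStr (PolyTime.newQuery (PolyTime.fst.comp PolyTime.snd) PolyTime.fst)
    (PolyTime.newDatabase (PolyTime.fst.comp PolyTime.snd) (PolyTime.snd.comp PolyTime.snd)
      PolyTime.fst)

/-- The machine of the reduction. -/
theorem exists_program_reduction (P : Program) : ∃ (P' : Program) (p : Polynomial ℕ),
    ∀ (x : ConjQuery × Database) (r : Blueprint) (t : ℕ),
      P.Trans [toData (masks x.1)] [toData r] t →
      Nonempty (Turing.TM2OutputsInTime P'.machineAux.tm
        ((encodeInstStr x).map P'.machineAux.inputAlphabet.symm)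
        (some ((encodeInstStr (newQuery x.1 r, newDatabase x.1 x.2 r)).map
          P'.machineAux.outputAlphabet.symm)) (p.eval ((encodeInstStr x).length + t))) := by
  have hm : PolyTime fun x : ConjQuery × Database => (masks x.1, x) :=
    (PolyTime.masks PolyTime.fst).pair PolyTime.id
  obtain ⟨B, Q, hB⟩ := exists_program_comp hm polyTime_reduction P
  obtain ⟨A, p, hA⟩ := PolyTime.parse
  -- At the input length plus `t`, `L` bounds the tree of the input string and `E` the tree of the
  -- parsed instance plus `t`.
  let L : Polynomial ℕ := 20 * X + 1
  let E : Polynomial ℕ := L + p.comp L + X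
  refine ⟨((readInput.seq A).seq B).seq writeOutput,
    15 * X + 6 + p.comp L + Q.comp E + 15 * (E + Q.comp E), fun x r t ht => ?_⟩
  set w := encodeInstStr x with hw
  set y := encodeInstStr (newQuery x.1 r, newDatabase x.1 x.2 r) with hy
  set N := w.length + t with hN
  have hA' : A.Trans [toData w] [toData x] (p.eval (sz w)) := by
    rw [← toData_parse]
    exact hA w
  have hB' : B.Trans [toData x] [toData y] (Q.eval (sz x + t)) := hB x r t ht
  have h₁ : sz w ≤ L.eval N := by
    have := sz_string_le w
    simp only [L, eval_add, eval_mul, eval_X, eval_ofNat, eval_one]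
    omega
  have h₂ := p.eval_nat_mono h₁
  have h₃ : sz x + t ≤ E.eval N := by
    have : sz x ≤ sz w + p.eval (sz w) := hA'.size_le
    simp only [E, eval_add, eval_comp, eval_X]
    omega
  have h₄ := Q.eval_nat_mono h₃
  have h₅ : y.length ≤ E.eval N + Q.eval (E.eval N) := by
    have : sz y ≤ sz x + Q.eval (sz x + t) := hB'.size_le
    have := length_lt_sz y
    omega
  have hst (v v' : List Γ') : Function.update (fun _ => []) .left v = st [] v [] [] ∧
      Function.update (fun _ => []) .right v' = st [] [] v' [] := by
    constructor <;> funext k <;> cases k <;> simp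
  have hexec : (((readInput.seq A).seq B).seq writeOutput).Exec
      (Function.update (fun _ => []) .left w) (Function.update (fun _ => []) .right y)
      ((15 * w.length + 3) + p.eval (sz w) + Q.eval (sz x + t) + (15 * y.length + 2)) := by
    rw [(hst w y).1, (hst w y).2]
    have h₆ : A.Exec (st (toData w).ser [] [] []) (st (toData x).ser [] [] [])
        (p.eval (sz w)) := by
      simpa using hA' []
    have h₇ : B.Exec (st (toData x).ser [] [] []) (st (toData y).ser [] [] [])
        (Q.eval (sz x + t)) := by
      simpa using hB' []
    exact (((exec_readInput w).seq h₆).seq h₇).seq (exec_writeOutput y)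
  obtain ⟨h⟩ := hexec.outputs
  refine ⟨⟨h.toEvalsTo, h.steps_le_m.trans ?_⟩⟩
  simp only [eval_add, eval_mul, eval_comp, eval_X, eval_ofNat] at *
  omega

end StackMachine

open StackMachine in
theorem mainTheorem4 (𝓗 𝓜 : Set (Hypergraph ℕ))
    (h𝓗 : Hypergraph.RecursivelyEnumerable 𝓗)
    (h𝓜 : ∀ M ∈ 𝓜, ∃ H ∈ 𝓗, (∀ v ∈ H.vertexSet, ¬ H.IsIsolated v) ∧ M.IsDilutionOf H) :
    FPTReducible (pCQ 𝓜) (pCQ 𝓗) := by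
  obtain ⟨F, hF, hF₁, hF₂⟩ := Blueprint.exists_partrec_isFor h𝓗
  obtain ⟨P, T, hT, hP⟩ := exists_program_of_partrec' hF
  obtain ⟨P', p, hP'⟩ := exists_program_reduction P
  -- An isomorphic copy of a dilution is a dilution, so the search halts for every presentation of
  -- every copy. The bounds in terms of the parameter range over all of these.
  have hdom (q : ConjQuery) (hq : q.hypergraph ∈ 𝓜) (H : Hypergraph ℕ) (vs : List ℕ)
      (es : List (List ℕ)) (hiso : q.hypergraph.Iso H) (hH : H.IsPresentedBy (vs, es)) :
      (F (es.map (mask vs))).Dom := by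
    obtain ⟨H₀, hH₀, hv, H', hdil, hiso'⟩ := h𝓜 _ hq
    obtain ⟨x, hx⟩ := exists_isFor hH₀ hv (h𝓗.1 H₀ hH₀) ⟨H', hdil, hiso.symm_trans hiso'⟩ hH
      fun F => List.mem_map
    exact hF₂ _ x hx
  have hr (x : (pCQ 𝓜).Inst) : ∃ r, r ∈ F (masks x.1.1) := by
    have hp := x.1.1.isPresentedBy_hypergraph
    obtain ⟨vs, es, hp', h⟩ := exists_isPresentedBy_of_mem_codes hp (masks_mem_codes (.refl _) hp)
    exact h ▸ Part.dom_iff_mem.1 (hdom _ x.2 _ vs es (.refl _) hp')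
  choose r hr using hr
  have hrep (x : (pCQ 𝓜).Inst) : ∃ s, (r x).Represents (masks x.1.1) s := by
    obtain ⟨s, -, hs⟩ := hF₁ _ _ (hr x)
    exact ⟨s, hs⟩
  have hpres (x : (pCQ 𝓜).Inst) :
      (newQuery x.1.1 (r x)).hypergraph.IsPresentedBy (r x).presentation := by
    obtain ⟨s, hs⟩ := hrep x
    exact isPresentedBy_newQuery hs.target_mem
  have hmem (x : (pCQ 𝓜).Inst) : (newQuery x.1.1 (r x)).hypergraph ∈ 𝓗 := by
    obtain ⟨s, ⟨H, hH, hHp⟩, -⟩ := hF₁ _ _ (hr x)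
    rwa [(hpres x).eq hHp]
  refine ⟨fun x => ⟨(newQuery x.1.1 (r x), newDatabase x.1.1 x.1.2 (r x)), hmem x⟩, fun x => ?_,
    ⟨P'.machineAux, ?_⟩, ?_⟩
  · obtain ⟨s, hs⟩ := hrep x
    exact exists_isSolution_newQuery_iff hs
  · obtain ⟨f, hf, hf'⟩ := exists_partrec_isoCode_bound (G := fun c => (T c).map fun t =>
      p.eval (t + 1)) (hT.map ((primrec_eval p).to_comp.comp
        (Computable.succ.comp Computable.snd)).to₂)
    refine ⟨f, p.comp (Polynomial.X + 1), hf, fun x => ?_⟩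
    obtain ⟨b, hb, hbt⟩ := hf' x.1.1 fun H vs es hiso hH => by
      obtain ⟨t, ht, -⟩ := hP _ _ (Part.get_mem (hdom _ x.2 H vs es hiso hH))
      exact Part.dom_iff_mem.2 ⟨_, Part.mem_map _ ht⟩
    obtain ⟨t, ht, htrans⟩ := hP _ _ (hr x)
    obtain ⟨h⟩ := hP' x.1 (r x) t htrans
    refine ⟨b, hb, ⟨⟨h.toEvalsTo, h.steps_le_m.trans ?_⟩⟩⟩
    have := hbt _ (Part.mem_map _ ht)
    -- The input length and the search time `t` are separated; `f` bounds the factor that contains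
    -- `t`.
    refine (p.eval_nat_add_le _ _).trans ?_
    rw [mul_comm]
    rw [Polynomial.eval_comp, Polynomial.eval_add, Polynomial.eval_X, Polynomial.eval_one]
    exact Nat.mul_le_mul_right _ this
  -- The new parameter is at most the code of the presentation of the blueprint, which is a partial
  -- recursive function of `masks q`.
  · obtain ⟨g, hg, hg'⟩ := exists_partrec_isoCode_bound (G := fun c => (F c).map fun r =>
      Encodable.encode r.presentation) (hF.map ((Primrec.encode.comp
        Blueprint.primrec_presentation).to_comp.comp Computable.snd).to₂)
    refine ⟨g, hg, fun x => ?_⟩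
    obtain ⟨b, hb, hbt⟩ := hg' x.1.1 fun H vs es hiso hH => hdom _ x.2 H vs es hiso hH
    exact ⟨b, hb, (hpres x).isoCode_le.trans (hbt _ (Part.mem_map _ (hr x)))⟩
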